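/- Let $N\ge 1$ be an integer, $p\ge 2$ and $0<\alpha<N$ real. On the lattice graph $\mathbb{Z}^N$ (with $x\sim y$ iff $\sum_i|x_i-y_i|=1$) put $$\nabla u\nabla v(x)=\tfrac12\sum_{y\sim x}(u(y)-u(x))(v(y)-v(x)),\qquad |\nabla u|(x)=\Big(\tfrac12\sum_{y\sim x}(u(y)-u(x))^2\Big)^{1/2},$$ $$\Delta_p u(x)=\tfrac12\sum_{y\sim x}\big(|\nabla u|^{p-2}(y)+|\nabla u|^{p-2}(x)\big)(u(y)-u(x)),$$ and let $$R_\alpha(x,y)=\frac{K_\alpha}{(2\pi)^N}\int_{[0,2\pi]^N}e^{i(x-y)\cdot k}\mu(k)^{-\alpha/2}\,dk,\quad K_\alpha=\frac1{(2\pi)^N}\int_{[0,2\pi]^N}\mu(k)^{\alpha/2}\,dk,\quad \mu(k)=2N-2\sum_{j=1}^N\cos k_j,$$ with $(R_\alpha*g)(x)=\sum_{y}R_\alpha(x,y)g(y)$. Let $h:\mathbb{Z}^N\to\mathbb{R}$ satisfy * $(h_1)$ there is $h_0>0$ with $h(x)\ge h_0$ for all $x$; * $(h_2)$ there is a nonzero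 integer $T$ with $h(x+Tk)=h(x)$ for all $x,k\in\mathbb{Z}^N$. Let $W^{1,p}(\mathbb{Z}^N)$ be the completion of the finitely supported functions in the norm $\big(\sum_x(|\nabla u|^p+|u|^p)\big)^{1/p}$, and let $H=\{u\in W^{1,p}(\mathbb{Z}^N):\sum_x h|u|^p<\infty\}$ with the norm $\|u\|=\big(\sum_x(|\nabla u|^p+h|u|^p)\big)^{1/p}$. Let $f:\mathbb{R}\to\mathbb{R}$, $F(t)=\int_0^t f(s)\,ds$, satisfy * $(f_1)$ $f$ is continuous and $f(t)=o(|t|^{p-1})$ as $t\to0$; * $(f_2)$ there are $C>0$ and $\tau>\frac{(N+\alpha)p}{2N}$ with $|f(t)|\le C(1+|t|^{\tau-1})$ for all $t\in\mathbb{R}$; * $(f_3)$ there is $\theta>p$ with $0\le\theta F(t)\le 2f(t)t$ for all $t\in\mathbb{R}$; * $(f_4)$ for every $u\in H\setminus\{0\}$ the function $t\mapsto t^{-p}\sum_{x}(R_\alpha*F(tu))(x)\,f(tu(x))\,u(x)$ is strictly increasing on $(0,\infty)$. Then the functional $$J(u)=\frac1p\sum_x\big(|\nabla u|^p+h|u|^p\big)-\frac12\sum_x(R_\alpha*F(u))F(u)$$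 is of class $C^1$ on $H$, and the equation $$-\Delta_p u+h|u|^{p-2}u=(R_\alpha*F(u))f(u)\quad\text{on }\mathbb{Z}^N$$ has a ground state solution: there is $u\in H\setminus\{0\}$ with $J'(u)=0$ and $J(u)=\min_{\mathcal M}J$, where $\mathcal M=\{v\in H\setminus\{0\}:\langle J'(v),v\rangle=0\}$ is the Nehari manifold, and $u$ satisfies the equation at every point of $\mathbb{Z}^N$. -/

import Mathlib

open Filter Topology MeasureTheory

noncomputable section

namespace Choquard

variable {N : ℕ}

/-- The neighbours of a vertex `x` of the lattice graph `ℤ^N`; see `mem_nbrs`. -/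
def nbrs (x : Fin N → ℤ) : Finset (Fin N → ℤ) :=
  (Fintype.piFinset fun i => Finset.Icc (x i - 1) (x i + 1)).filter
    fun y => ∑ i, |x i - y i| = 1

theorem mem_nbrs (x y : Fin N → ℤ) : y ∈ nbrs x ↔ ∑ i, |x i - y i| = 1 := by
  simp only [nbrs, Finset.mem_filter, Fintype.mem_piFinset, Finset.mem_Icc]
  refine ⟨fun h => h.2, fun h => ⟨fun i => ?_, h⟩⟩
  have h1 : |x i - y i| ≤ 1 :=
    h ▸ Finset.single_le_sum (f := fun i => |x i - y i|) (fun j _ => abs_nonneg _)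
      (Finset.mem_univ i)
  rw [abs_le] at h1
  constructor <;> linarith [h1.1, h1.2]

/-- The gradient form `Γ(u, v)(x) = ½ ∑_{y ∼ x} (u y - u x) (v y - v x)`. -/
def gradForm (u v : (Fin N → ℤ) → ℝ) (x : Fin N → ℤ) : ℝ :=
  (1 / 2) * ∑ y ∈ nbrs x, (u y - u x) * (v y - v x)

/-- The length of the gradient `|∇u|(x) = √Γ(u, u)(x)`. -/
def gradNorm (u : (Fin N → ℤ) → ℝ) (x : Fin N → ℤ) : ℝ :=
  √(gradForm u u x)

/-- The `p`-Laplacian of the lattice graph. -/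
def pLaplacian (p : ℝ) (u : (Fin N → ℤ) → ℝ) (x : Fin N → ℤ) : ℝ :=
  (1 / 2) * ∑ y ∈ nbrs x, (gradNorm u y ^ (p - 2) + gradNorm u x ^ (p - 2)) * (u y - u x)

/-- `|∇u|^p + h |u|^p`, the density of the `p`-th power of the norm with weight `h`. -/
def density (p : ℝ) (h u : (Fin N → ℤ) → ℝ) (x : Fin N → ℤ) : ℝ :=
  gradNorm u x ^ p + h x * |u x| ^ p

/-- `(∑ (|∇u|^p + h |u|^p))^(1/p)`; meaningful when the density is summable. -/
def wnorm (p : ℝ) (h u : (Fin N → ℤ) → ℝ) : ℝ :=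
  (∑' x, density p h u x) ^ (1 / p)

/-- Membership in `W^{1,p}(ℤ^N)`, the completion of the finitely supported functions for the
norm `(∑ (|∇u|^p + |u|^p))^(1/p)`. As this norm dominates every point evaluation, the completion is
the space of functions of finite norm that are limits of finitely supported ones. -/
def MemW (p : ℝ) (u : (Fin N → ℤ) → ℝ) : Prop :=
  Summable (density p 1 u) ∧
    ∀ ε > 0, ∃ φ : (Fin N → ℤ) → ℝ, φ.support.Finite ∧
      Summable (density p 1 (u - φ)) ∧ wnorm p 1 (u - φ) < ε

/-! ### Facts that make `H` a normed space -/

theorem gradNorm_nonneg (u : (Fin N → ℤ) → ℝ) (x) : 0 ≤ gradNorm u x := Real.sqrt_nonneg _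

theorem gradNorm_eq (u : (Fin N → ℤ) → ℝ) (x) :
    gradNorm u x = √(1 / 2) * √(∑ y ∈ nbrs x, (u y - u x) ^ 2) := by
  rw [gradNorm, gradForm, Real.sqrt_mul (by norm_num)]
  simp only [pow_two]

theorem gradNorm_add_le (u v : (Fin N → ℤ) → ℝ) (x) :
    gradNorm (u + v) x ≤ gradNorm u x + gradNorm v x := by
  have key := Real.Lp_add_le (nbrs x) (fun y => u y - u x) (fun y => v y - v x)
    (p := 2) (by norm_num)
  simp only [Real.rpow_two, sq_abs, ← Real.sqrt_eq_rpow] at key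
  rw [gradNorm_eq, gradNorm_eq, gradNorm_eq, ← mul_add]
  refine mul_le_mul_of_nonneg_left ?_ (Real.sqrt_nonneg _)
  refine le_trans (le_of_eq ?_) key
  refine congrArg Real.sqrt (Finset.sum_congr rfl fun y _ => ?_)
  simp only [Pi.add_apply]
  ring

theorem gradNorm_smul (c : ℝ) (u : (Fin N → ℤ) → ℝ) (x) :
    gradNorm (c • u) x = |c| * gradNorm u x := by
  rw [gradNorm_eq, gradNorm_eq, ← Real.sqrt_sq_eq_abs c]
  have : ∑ y ∈ nbrs x, ((c • u) y - (c • u) x) ^ 2 = c ^ 2 * ∑ y ∈ nbrs x, (u y - u x) ^ 2 := by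
    rw [Finset.mul_sum]
    refine Finset.sum_congr rfl fun y _ => ?_
    simp only [Pi.smul_apply, smul_eq_mul]
    ring
  rw [this, Real.sqrt_mul (sq_nonneg c)]
  ring

theorem density_nonneg {p : ℝ} {h : (Fin N → ℤ) → ℝ} (hh : ∀ x, 0 ≤ h x)
    (u : (Fin N → ℤ) → ℝ) (x) : 0 ≤ density p h u x :=
  add_nonneg (Real.rpow_nonneg (gradNorm_nonneg _ _) _)
    (mul_nonneg (hh x) (Real.rpow_nonneg (abs_nonneg _) _))

theorem density_smul {p : ℝ} (h : (Fin N → ℤ) → ℝ) (c : ℝ) (u : (Fin N → ℤ) → ℝ) (x) :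
    density p h (c • u) x = |c| ^ p * density p h u x := by
  rw [density, density, gradNorm_smul, Real.mul_rpow (abs_nonneg _) (gradNorm_nonneg _ _),
    Pi.smul_apply, smul_eq_mul, abs_mul, Real.mul_rpow (abs_nonneg _) (abs_nonneg _)]
  ring

theorem density_rpow {p : ℝ} (hp : 2 ≤ p) {h : (Fin N → ℤ) → ℝ} (hh : ∀ x, 0 ≤ h x)
    (u : (Fin N → ℤ) → ℝ) (x) : (density p h u x ^ (1 / p)) ^ p = density p h u x := by
  rw [← Real.rpow_mul (density_nonneg hh u x), one_div_mul_cancel (by linarith), Real.rpow_one]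

theorem density_add_le {p : ℝ} (hp : 2 ≤ p) {h : (Fin N → ℤ) → ℝ} (hh : ∀ x, 0 ≤ h x)
    (u v : (Fin N → ℤ) → ℝ) (x) :
    density p h (u + v) x ^ (1 / p) ≤ density p h u x ^ (1 / p) + density p h v x ^ (1 / p) := by
  have hp0 : 0 < p := by linarith
  have e : ∀ t : ℝ, 0 ≤ t → (h x ^ (1 / p) * t) ^ p = h x * t ^ p := fun t ht => by
    rw [Real.mul_rpow (Real.rpow_nonneg (hh x) _) ht, ← Real.rpow_mul (hh x),
      one_div_mul_cancel hp0.ne', Real.rpow_one]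
  have hr : 0 ≤ h x ^ (1 / p) := Real.rpow_nonneg (hh x) _
  have key := Real.Lp_add_le_of_nonneg (Finset.univ : Finset (Fin 2)) (p := p) (by linarith)
    (f := ![gradNorm u x, h x ^ (1 / p) * |u x|]) (g := ![gradNorm v x, h x ^ (1 / p) * |v x|])
    (by
      intro i _
      fin_cases i
      · exact gradNorm_nonneg _ _
      · exact mul_nonneg hr (abs_nonneg _))
    (by
      intro i _
      fin_cases i
      · exact gradNorm_nonneg _ _
      · exact mul_nonneg hr (abs_nonneg _))
  simp only [Fin.sum_univ_two, Matrix.cons_val_zero, Matrix.cons_val_one, ← mul_add] at key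
  rw [e _ (abs_nonneg _), e _ (abs_nonneg _), e _ (by positivity)] at key
  refine le_trans (Real.rpow_le_rpow (density_nonneg hh _ _) ?_ (by positivity)) key
  refine add_le_add (Real.rpow_le_rpow (gradNorm_nonneg _ _) (gradNorm_add_le u v x) hp0.le)
    (mul_le_mul_of_nonneg_left (Real.rpow_le_rpow (abs_nonneg _) (abs_add_le _ _) hp0.le) (hh x))

theorem wnorm_add {p : ℝ} (hp : 2 ≤ p) {h : (Fin N → ℤ) → ℝ} (hh : ∀ x, 0 ≤ h x)
    {u v : (Fin N → ℤ) → ℝ} (hu : Summable (density p h u)) (hv : Summable (density p h v)) :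
    Summable (density p h (u + v)) ∧ wnorm p h (u + v) ≤ wnorm p h u + wnorm p h v := by
  have hp0 : 0 < p := by linarith
  have nn : ∀ (w : (Fin N → ℤ) → ℝ) x, 0 ≤ density p h w x ^ (1 / p) := fun w x =>
    Real.rpow_nonneg (density_nonneg hh w x) _
  have key := Real.Lp_add_le_tsum_of_nonneg (p := p) (by linarith) (nn u) (nn v)
    (by simpa only [density_rpow hp hh] using hu) (by simpa only [density_rpow hp hh] using hv)
  simp only [density_rpow hp hh] at key
  have le : ∀ x, density p h (u + v) x ≤
      (density p h u x ^ (1 / p) + density p h v x ^ (1 / p)) ^ p := fun x => by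
    rw [← density_rpow hp hh (u + v) x]
    exact Real.rpow_le_rpow (nn _ _) (density_add_le hp hh u v x) hp0.le
  have hs : Summable (density p h (u + v)) :=
    Summable.of_nonneg_of_le (density_nonneg hh _) le key.1
  exact ⟨hs, le_trans (Real.rpow_le_rpow (tsum_nonneg (density_nonneg hh _))
    (hs.tsum_le_tsum le key.1) (by positivity)) key.2⟩

theorem summable_smul {p : ℝ} {h : (Fin N → ℤ) → ℝ} (c : ℝ)
    {u : (Fin N → ℤ) → ℝ} (hu : Summable (density p h u)) : Summable (density p h (c • u)) := by
  simpa only [← density_smul] using hu.mul_left (|c| ^ p)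

theorem wnorm_smul {p : ℝ} (hp : 2 ≤ p) {h : (Fin N → ℤ) → ℝ} (hh : ∀ x, 0 ≤ h x) (c : ℝ)
    (u : (Fin N → ℤ) → ℝ) : wnorm p h (c • u) = |c| * wnorm p h u := by
  simp only [wnorm, density_smul, tsum_mul_left]
  rw [Real.mul_rpow (Real.rpow_nonneg (abs_nonneg _) _) (tsum_nonneg (density_nonneg hh _)),
    ← Real.rpow_mul (abs_nonneg _), mul_one_div_cancel (by linarith), Real.rpow_one]

theorem density_zero {p : ℝ} (hp : 2 ≤ p) (h : (Fin N → ℤ) → ℝ) : density p h 0 = 0 := by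
  funext x
  have hp0 : p ≠ 0 := by linarith
  simp [density, gradNorm, gradForm, Real.zero_rpow hp0]

theorem wnorm_zero {p : ℝ} (hp : 2 ≤ p) (h : (Fin N → ℤ) → ℝ) : wnorm p h 0 = 0 := by
  have hp0 : p ≠ 0 := by linarith
  simp [wnorm, density_zero hp, Real.zero_rpow (inv_ne_zero hp0)]

theorem MemW.add {p : ℝ} (hp : 2 ≤ p) {u v : (Fin N → ℤ) → ℝ} (hu : MemW p u) (hv : MemW p v) :
    MemW p (u + v) := by
  have h1 : ∀ x : Fin N → ℤ, (0 : ℝ) ≤ (1 : (Fin N → ℤ) → ℝ) x := fun _ => zero_le_one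
  refine ⟨(wnorm_add hp h1 hu.1 hv.1).1, fun ε hε => ?_⟩
  obtain ⟨φ, hφ, sφ, nφ⟩ := hu.2 (ε / 2) (half_pos hε)
  obtain ⟨ψ, hψ, sψ, nψ⟩ := hv.2 (ε / 2) (half_pos hε)
  have key := wnorm_add hp h1 sφ sψ
  rw [show u - φ + (v - ψ) = u + v - (φ + ψ) by abel] at key
  exact ⟨φ + ψ, (hφ.union hψ).subset (Function.support_add _ _), key.1, by linarith [key.2]⟩

theorem MemW.smul {p : ℝ} (hp : 2 ≤ p) (c : ℝ) {u : (Fin N → ℤ) → ℝ} (hu : MemW p u) :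
    MemW p (c • u) := by
  have h1 : ∀ x : Fin N → ℤ, (0 : ℝ) ≤ (1 : (Fin N → ℤ) → ℝ) x := fun _ => zero_le_one
  refine ⟨summable_smul c hu.1, fun ε hε => ?_⟩
  have hc : 0 < |c| + 1 := by positivity
  obtain ⟨φ, hφ, sφ, nφ⟩ := hu.2 (ε / (|c| + 1)) (div_pos hε hc)
  refine ⟨c • φ, hφ.subset (Function.support_const_smul_subset c φ), ?_, ?_⟩
  · rw [← smul_sub]
    exact summable_smul c sφ
  · rw [← smul_sub, wnorm_smul hp h1]
    have h0 : 0 ≤ wnorm p 1 (u - φ) :=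
      Real.rpow_nonneg (tsum_nonneg (density_nonneg h1 _)) _
    rw [lt_div_iff₀ hc] at nφ
    nlinarith

theorem MemW.zero {p : ℝ} (hp : 2 ≤ p) : MemW p (0 : (Fin N → ℤ) → ℝ) := by
  have s : Summable (density p 1 (0 : (Fin N → ℤ) → ℝ)) := by
    rw [density_zero hp]
    exact summable_zero
  refine ⟨s, fun ε hε => ⟨0, by simp, by simpa using s, ?_⟩⟩
  rw [sub_zero, wnorm_zero hp]
  exact hε

theorem summable_gradNorm {p : ℝ} {u : (Fin N → ℤ) → ℝ} (hu : MemW p u) :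
    Summable fun x => gradNorm u x ^ p :=
  Summable.of_nonneg_of_le (fun _ => Real.rpow_nonneg (gradNorm_nonneg _ _) _)
    (fun _ => le_add_of_nonneg_right
      (mul_nonneg zero_le_one (Real.rpow_nonneg (abs_nonneg _) _))) hu.1

theorem summable_density {p : ℝ} {h u : (Fin N → ℤ) → ℝ} (hu : MemW p u)
    (hs : Summable fun x => h x * |u x| ^ p) : Summable (density p h u) :=
  (summable_gradNorm hu).add hs

theorem summable_weighted {p : ℝ} {h u : (Fin N → ℤ) → ℝ} (hh : ∀ x, 0 ≤ h x)
    (hs : Summable (density p h u)) : Summable fun x => h x * |u x| ^ p :=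
  Summable.of_nonneg_of_le (fun x => mul_nonneg (hh x) (Real.rpow_nonneg (abs_nonneg _) _))
    (fun _ => le_add_of_nonneg_left (Real.rpow_nonneg (gradNorm_nonneg _ _) _)) hs

theorem potential_nonneg {h : (Fin N → ℤ) → ℝ} (h₁ : ∃ h₀ > 0, ∀ x, h₀ ≤ h x) (x) : 0 ≤ h x := by
  obtain ⟨h₀, h0, hx⟩ := h₁
  exact h0.le.trans (hx x)

/-- The linear space `{u ∈ W^{1,p}(ℤ^N) : ∑ h |u|^p < ∞}`. -/
def hSubmodule (p : ℝ) (h : (Fin N → ℤ) → ℝ) (hp : 2 ≤ p) (h₁ : ∃ h₀ > 0, ∀ x, h₀ ≤ h x) :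
    Submodule ℝ ((Fin N → ℤ) → ℝ) where
  carrier := {u | MemW p u ∧ Summable fun x => h x * |u x| ^ p}
  add_mem' {u v} hu hv := ⟨hu.1.add hp hv.1, summable_weighted (potential_nonneg h₁)
    (wnorm_add hp (potential_nonneg h₁) (summable_density hu.1 hu.2)
      (summable_density hv.1 hv.2)).1⟩
  zero_mem' := ⟨MemW.zero hp, by
    have hp0 : p ≠ 0 := by linarith
    simp [Real.zero_rpow hp0, summable_zero]⟩
  smul_mem' c u hu := ⟨hu.1.smul hp c, summable_weighted (potential_nonneg h₁)
    (summable_smul c (summable_density hu.1 hu.2))⟩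

/-- The space `H`, normed by `‖u‖ = (∑ (|∇u|^p + h |u|^p))^(1/p)`. -/
def HSpace (p : ℝ) (h : (Fin N → ℤ) → ℝ) (hp : 2 ≤ p) (h₁ : ∃ h₀ > 0, ∀ x, h₀ ≤ h x) : Type :=
  ↥(hSubmodule p h hp h₁)

variable {p : ℝ} {h : (Fin N → ℤ) → ℝ} {hp : 2 ≤ p} {h₁ : ∃ h₀ > 0, ∀ x, h₀ ≤ h x}

instance : AddCommGroup (HSpace p h hp h₁) := inferInstanceAs (AddCommGroup (hSubmodule p h hp h₁))

instance : Module ℝ (HSpace p h hp h₁) := inferInstanceAs (Module ℝ (hSubmodule p h hp h₁))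

/-- An element of `H` is used as a function on `ℤ^N`. -/
instance : CoeFun (HSpace p h hp h₁) fun _ => (Fin N → ℤ) → ℝ := ⟨fun u => u.1⟩

theorem HSpace.summable (u : HSpace p h hp h₁) : Summable (density p h u) :=
  summable_density u.2.1 u.2.2

theorem HSpace.eq_zero (u : HSpace p h hp h₁) (hu : wnorm p h u = 0) : u = 0 := by
  have hp0 : p ≠ 0 := by linarith
  have nn := density_nonneg (p := p) (potential_nonneg h₁) u
  have h0 : ∑' x, density p h u x = 0 :=
    (Real.rpow_eq_zero (tsum_nonneg nn) (one_div_ne_zero hp0)).1 hu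
  have hd : density p h u = 0 := (hasSum_zero_iff_of_nonneg nn).1 (h0 ▸ u.summable.hasSum)
  refine Subtype.ext (funext fun x => ?_)
  obtain ⟨c, hc, hx⟩ := h₁
  have hx0 : 0 < h x := lt_of_lt_of_le hc (hx x)
  have hdx : gradNorm u x ^ p + h x * |u x| ^ p = 0 := congrFun hd x
  have a : 0 ≤ gradNorm u x ^ p := Real.rpow_nonneg (gradNorm_nonneg _ _) _
  have b : 0 ≤ |u x| ^ p := Real.rpow_nonneg (abs_nonneg _) _
  have hb : |u x| ^ p = 0 := by nlinarith
  exact abs_eq_zero.1 ((Real.rpow_eq_zero (abs_nonneg _) hp0).1 hb)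

instance : NormedAddCommGroup (HSpace p h hp h₁) :=
  AddGroupNorm.toNormedAddCommGroup
    { toFun := fun u => wnorm p h u
      map_zero' := wnorm_zero hp h
      add_le' := fun u v => (wnorm_add hp (potential_nonneg h₁) u.summable v.summable).2
      neg' := fun u => by
        have := wnorm_smul hp (potential_nonneg h₁) (-1) u
        rw [abs_neg, abs_one, one_mul, neg_one_smul] at this
        exact this
      eq_zero_of_map_eq_zero' := fun u hu => u.eq_zero hu }

theorem HSpace.norm_def (u : HSpace p h hp h₁) :
    ‖u‖ = (∑' x, (gradNorm u x ^ p + h x * |u x| ^ p)) ^ (1 / p) := rfl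

instance : NormedSpace ℝ (HSpace p h hp h₁) where
  norm_smul_le c u := le_of_eq (wnorm_smul hp (potential_nonneg h₁) c u)

/-! ### The Green's function of the discrete fractional Laplacian -/

/-- `μ(k) = 2N - 2 ∑ cos k_j`. -/
def symbol (k : Fin N → ℝ) : ℝ := 2 * N - 2 * ∑ j, Real.cos (k j)

/-- The torus `[0, 2π]^N`. -/
def torus (N : ℕ) : Set (Fin N → ℝ) := Set.Icc 0 fun _ => 2 * Real.pi

/-- The fractional degree `K_α`. -/
def fracDegree (N : ℕ) (α : ℝ) : ℝ :=
  1 / (2 * Real.pi) ^ N * ∫ k in torus N, symbol k ^ (α / 2)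

/-- `R_α(x, y)`. The integral is real, by the symmetry `k ↦ 2π - k`, so that taking the real part
only changes the type. -/
def green (α : ℝ) (x y : Fin N → ℤ) : ℝ :=
  (((fracDegree N α / (2 * Real.pi) ^ N : ℝ) : ℂ) *
    ∫ k in torus N, Complex.exp (Complex.I * ((∑ j, ((x j - y j : ℤ) : ℝ) * k j : ℝ) : ℂ)) *
      ((symbol k ^ (-(α / 2)) : ℝ) : ℂ)).re

/-- `(R_α ∗ g)(x) = ∑_y R_α(x, y) g(y)`. -/
def greenConv (α : ℝ) (g : (Fin N → ℤ) → ℝ) (x : Fin N → ℤ) : ℝ := ∑' y, green α x y * g y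

/-! ### The energy, the Nehari manifold and ground states -/

/-- The primitive `F(t) = ∫_0^t f`. -/
def primitive (f : ℝ → ℝ) (t : ℝ) : ℝ := ∫ s in (0 : ℝ)..t, f s

/-- The energy functional `J` on `H`. -/
def energy (α : ℝ) (f : ℝ → ℝ) (u : HSpace p h hp h₁) : ℝ :=
  1 / p * ∑' x, (gradNorm u x ^ p + h x * |u x| ^ p) -
    1 / 2 * ∑' x, greenConv α (fun y => primitive f (u y)) x * primitive f (u x)

/-- The Nehari manifold `{v ∈ H \ {0} : ⟨J'(v), v⟩ = 0}`. -/
def nehari (α : ℝ) (f : ℝ → ℝ) : Set (HSpace p h hp h₁) :=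
  {v | v ≠ 0 ∧ fderiv ℝ (energy α f) v v = 0}

/-- A ground state solution: a nontrivial critical point of `J` at which `J` attains its infimum
over the Nehari manifold. -/
def IsGroundState (α : ℝ) (f : ℝ → ℝ) (u : HSpace p h hp h₁) : Prop :=
  u ≠ 0 ∧ HasFDerivAt (energy α f) (0 : HSpace p h hp h₁ →L[ℝ] ℝ) u ∧
    IsLeast (energy α f '' (nehari α f : Set (HSpace p h hp h₁))) (energy α f u)

end Choquard

end

/-! ### Calculus of infinite sums and elementary splitting inequalities -/

noncomputable section

namespace Choquard

/-! The kernel $R_\alpha$ is the Fourier transform of a nonnegative integrable density, so it is the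
Gram matrix of vectors $e_x$ in $L^2$ of the torus, all of the same norm (`exists_inner_eq_green`).
The nonlocal energy is therefore $\frac12\|S_F(u)\|^2$ with $S_F(u)=\sum_x F(u(x))e_x$. On the
lattice $H$ embeds into $\ell^p$, hence into $\ell^\infty$, and $(f_1)$ gives $|F(t)|\le C|t|^p$ on
bounded sets; so $S_F(u)$ converges absolutely. A general principle on sums of $C^1$ functions of
linear maps (`exists_hasFDerivAt_tsum_comp`) makes both $\|u\|^p$ and $S_F$ of class $C^1$, and with
them $J$.

Write $A(u)=\sum(R_\alpha*F(u))f(u)u$ and $P(u)=\|S_F(u)\|^2$, so that $J'(u)u=\|u\|^p-A(u)$.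
Condition $(f_4)$ says $A(tu)>t^{p+1}A(u)$ for $t>1$. Hence every ray meets the Nehari manifold, and
the ray inequality `ray_le` holds: for $t>0$, $J(tu)+\frac{A(u)-\|u\|^p}{p}t^p\le G(u)$, where
$G=\frac1pA-\frac12P$ agrees with $J$ on the manifold. Since $R_\alpha\ge0$ (`green_nonneg`),
$(f_3)$ may be summed against $R_\alpha*F(u)$; it gives $A\ge\frac\theta2P$, so
$G\ge(\frac1p-\frac1\theta)A\ge0$ and minimizing sequences are bounded.

On bounded parts of the manifold the supremum norm stays away from zero, so translation by periods
of $h$ yields a minimizing sequence $w_n$ with a nonzero pointwise limit $v$. Brezis–Lieb splitting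
holds for $\|\cdot\|^p$, $A$ and $P$; for the nonlocal terms the cross terms vanish because
$R_\alpha(x,y)\to0$ as $x\to\infty$ (`tendsto_green_cofinite`). With $m$ the infimum, $G(w_n-v)\to
m-G(v)$ and $\|w_n-v\|^p-A(w_n-v)\to A(v)-\|v\|^p$. If $A(v)<\|v\|^p$, the ray inequality for
$w_n-v$ gives $G(w_n-v)\ge m$ eventually, which contradicts $G(v)>0$. Otherwise the ray inequality
for $v$ together with $G(v)\le m$ forces $A(v)=\|v\|^p$ and $J(v)=m$. Neither Palais–Smale sequences
nor differentiability of the manifold is needed.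

A minimizer is critical by a mountain-pass style perturbation (`critical_of_isMin_nehari`), and
testing $J'(u)=0$ with indicator functions of points gives the equation. -/

theorem rpow_one_div_le {p x y : ℝ} (hp : 0 < p) (hx : 0 ≤ x) (hy : 0 ≤ y) (h : x ≤ y ^ p) :
    x ^ (1 / p) ≤ y := by
  rw [one_div]
  exact (Real.rpow_inv_le_iff_of_pos hx hy hp).2 h

/-! ### Sums of compositions of `C^1` functions with linear maps -/

section SumComp

variable {X W ι : Type*} [NormedAddCommGroup X] [NormedSpace ℝ X] [NormedAddCommGroup W]
  [NormedSpace ℝ W] {V : ι → Type*} [∀ i, NormedAddCommGroup (V i)] [∀ i, NormedSpace ℝ (V i)]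

/-- Hölder's inequality for a finite sum of the operators `g' i (L i u) ∘ L i`. -/
theorem norm_sum_comp_le {p B : ℝ} (hp : 1 < p) (hB : 0 ≤ B) {L : ∀ i, X →L[ℝ] V i}
    (hL : ∀ u (s : Finset ι), ∑ i ∈ s, ‖L i u‖ ^ p ≤ (B * ‖u‖) ^ p) {A : ∀ i, V i →L[ℝ] W}
    {u : X} {C : ℝ} (hC : 0 ≤ C) {s : Finset ι}
    (hA : ∀ i ∈ s, ‖A i‖ ≤ C * ‖L i u‖ ^ (p - 1)) :
    ‖∑ i ∈ s, (A i).comp (L i)‖ ≤ C * B * ((∑ i ∈ s, ‖L i u‖ ^ p) ^ (1 / p)) ^ (p - 1) := by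
  have hp0 : 0 < p := by linarith
  have hs0 : ∀ w : X, 0 ≤ ∑ i ∈ s, ‖L i w‖ ^ p := fun w => by positivity
  refine ContinuousLinearMap.opNorm_le_bound _ (by have := hs0 u; positivity) fun v => ?_
  have hpq : (p / (p - 1)).HolderConjugate p := (Real.HolderConjugate.conjExponent hp).symm
  have hol := Real.inner_le_Lp_mul_Lq_of_nonneg s hpq (f := fun i => ‖L i u‖ ^ (p - 1))
    (g := fun i => ‖L i v‖) (fun i _ => by positivity) (fun i _ => by positivity)
  have e1 : ∀ i, (‖L i u‖ ^ (p - 1)) ^ (p / (p - 1)) = ‖L i u‖ ^ p := fun i => by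
    rw [← Real.rpow_mul (norm_nonneg _), mul_div_cancel₀ _ (by linarith)]
  have e2 : (∑ i ∈ s, ‖L i u‖ ^ p) ^ (1 / (p / (p - 1))) =
      ((∑ i ∈ s, ‖L i u‖ ^ p) ^ (1 / p)) ^ (p - 1) := by
    rw [← Real.rpow_mul (hs0 u)]
    congr 1
    field_simp
  have e3 : (∑ i ∈ s, ‖L i v‖ ^ p) ^ (1 / p) ≤ B * ‖v‖ :=
    rpow_one_div_le hp0 (hs0 v) (by positivity) (hL v s)
  simp only [e1] at hol
  rw [e2] at hol
  calc ‖(∑ i ∈ s, (A i).comp (L i)) v‖ = ‖∑ i ∈ s, A i (L i v)‖ := by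
        simp
    _ ≤ ∑ i ∈ s, C * (‖L i u‖ ^ (p - 1) * ‖L i v‖) := by
        refine norm_sum_le_of_le _ fun i hi => ((A i).le_opNorm _).trans ?_
        rw [← mul_assoc]
        exact mul_le_mul_of_nonneg_right (hA i hi) (norm_nonneg _)
    _ = C * ∑ i ∈ s, ‖L i u‖ ^ (p - 1) * ‖L i v‖ := by rw [Finset.mul_sum]
    _ ≤ C * (((∑ i ∈ s, ‖L i u‖ ^ p) ^ (1 / p)) ^ (p - 1) * (B * ‖v‖)) := by
        refine mul_le_mul_of_nonneg_left (hol.trans ?_) hC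
        refine mul_le_mul_of_nonneg_left e3 (by have := hs0 u; positivity)
    _ = _ := by ring

/-- Minkowski's inequality along a family of linear maps. -/
theorem lp_sum_le {p B : ℝ} (hp : 1 < p) (hB : 0 ≤ B) {L : ∀ i, X →L[ℝ] V i}
    (hL : ∀ u (s : Finset ι), ∑ i ∈ s, ‖L i u‖ ^ p ≤ (B * ‖u‖) ^ p) (u v : X) (s : Finset ι) :
    (∑ i ∈ s, ‖L i u‖ ^ p) ^ (1 / p) ≤ (∑ i ∈ s, ‖L i v‖ ^ p) ^ (1 / p) + B * ‖u - v‖ := by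
  have hp0 : 0 < p := by linarith
  have mink := Real.Lp_add_le_of_nonneg s hp.le (f := fun i => ‖L i v‖)
    (g := fun i => ‖L i (u - v)‖) (fun i _ => by positivity) (fun i _ => by positivity)
  have e3 : (∑ i ∈ s, ‖L i (u - v)‖ ^ p) ^ (1 / p) ≤ B * ‖u - v‖ :=
    rpow_one_div_le hp0 (by positivity) (by positivity) (hL (u - v) s)
  refine le_trans (Real.rpow_le_rpow (by positivity) ?_ (by positivity)) (mink.trans (by gcongr))
  refine Finset.sum_le_sum fun i _ => Real.rpow_le_rpow (by positivity) ?_ hp0.le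
  have : L i u = L i v + L i (u - v) := by simp
  rw [this]
  exact norm_add_le _ _

/-- If the maps `L i` embed `X` into an `ℓ^p` sum and the `g i` are `C^1` functions with derivative
of growth `‖v‖^(p-1)`, then `u ↦ ∑ g i (L i u)` is `C^1`. -/
theorem exists_hasFDerivAt_tsum_comp [CompleteSpace W] {p B : ℝ} (hp : 1 < p) (hB : 0 ≤ B)
    {L : ∀ i, X →L[ℝ] V i}
    (hL : ∀ u (s : Finset ι), ∑ i ∈ s, ‖L i u‖ ^ p ≤ (B * ‖u‖) ^ p)
    {g : ∀ i, V i → W} {g' : ∀ i, V i → V i →L[ℝ] W}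
    (hg : ∀ i v, HasFDerivAt (g i) (g' i v) v) (hg' : ∀ i, Continuous (g' i))
    (hb : ∀ M, ∃ C, 0 ≤ C ∧ ∀ i v, ‖v‖ ≤ M →
      ‖g i v‖ ≤ C * ‖v‖ ^ p ∧ ‖g' i v‖ ≤ C * ‖v‖ ^ (p - 1)) :
    ∃ D : X → X →L[ℝ] W, Continuous D ∧
      ∀ u, HasFDerivAt (fun u => ∑' i, g i (L i u)) (D u) u ∧
        ∀ v, HasSum (fun i => g' i (L i u) (L i v)) (D u v) := by
  have hp0 : 0 < p := by linarith
  set T : ι → X → X →L[ℝ] W := fun i u => (g' i (L i u)).comp (L i) with hT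
  have hLi : ∀ i u, ‖L i u‖ ≤ B * ‖u‖ := fun i u => by
    have := hL u {i}
    rw [Finset.sum_singleton] at this
    exact (Real.rpow_le_rpow_iff (norm_nonneg _) (by positivity) hp0).1 this
  have hsm : ∀ u, Summable fun i => ‖L i u‖ ^ p := fun u =>
    summable_of_sum_le (fun i => by positivity) (hL u)
  -- Tails of the derivative series are small uniformly near `u₀`: Hölder bounds them by a constant
  -- times the power `p - 1` of the `ℓ^p` norm of the tail of `u`, and Minkowski compares this tail
  -- with that of `u₀`.
  have key : ∀ u₀ : X, ∀ ε > 0, ∃ s₀ : Finset ι, ∃ δ > 0, ∀ u, ‖u - u₀‖ < δ →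
      ∀ s, Disjoint s s₀ → ‖∑ i ∈ s, T i u‖ < ε := by
    intro u₀ ε hε
    obtain ⟨C, hC0, hC⟩ := hb (B * (‖u₀‖ + 1))
    have hlim : Tendsto (fun r : ℝ => C * B * r ^ (p - 1)) (𝓝 0) (𝓝 0) := by
      have : Tendsto (fun r : ℝ => C * B * r ^ (p - 1)) (𝓝 0) (𝓝 (C * B * 0 ^ (p - 1))) :=
        (tendsto_id.rpow_const (Or.inr (by linarith))).const_mul _
      rwa [Real.zero_rpow (by linarith), mul_zero] at this
    obtain ⟨η, hη, hηε⟩ := Metric.eventually_nhds_iff.1 (hlim.eventually_lt_const hε)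
    have hη2 : 0 < (η / 4) ^ p := by positivity
    obtain ⟨s₀, hs₀⟩ := summable_iff_vanishing_norm.1 (hsm u₀) _ hη2
    -- The bound `1` keeps `u` in the ball where `C` is valid; the other makes the Minkowski error
    -- at most `η / 4`, which is added to the tail `η / 4` of `u₀`.
    refine ⟨s₀, min 1 (η / (4 * (B + 1))), by positivity, fun u hu s hs => ?_⟩
    have hu1 : ‖u - u₀‖ < 1 := hu.trans_le (min_le_left _ _)
    have hu2 : B * ‖u - u₀‖ ≤ η / 4 := by
      have h1 := hu.le.trans (min_le_right _ _)
      rw [le_div_iff₀ (by positivity)] at h1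
      nlinarith [norm_nonneg (u - u₀)]
    have hun : ‖u‖ ≤ ‖u₀‖ + 1 := by
      have := norm_le_norm_add_norm_sub' u u₀
      linarith
    have hr0 : 0 ≤ (∑ i ∈ s, ‖L i u‖ ^ p) ^ (1 / p) := by positivity
    have hr : (∑ i ∈ s, ‖L i u‖ ^ p) ^ (1 / p) < η := by
      have h1 := lp_sum_le hp hB hL u u₀ s
      have h2 : (∑ i ∈ s, ‖L i u₀‖ ^ p) ^ (1 / p) ≤ η / 4 := by
        have := (hs₀ s hs).le
        rw [Real.norm_of_nonneg (by positivity)] at this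
        exact rpow_one_div_le hp0 (by positivity) (by positivity) this
      linarith
    refine (norm_sum_comp_le hp hB hL hC0 (u := u) fun i _ => (hC i _ ?_).2).trans_lt ?_
    · exact (hLi i u).trans (by gcongr)
    · refine hηε ?_
      rw [dist_zero_right, Real.norm_of_nonneg hr0]
      exact hr
  have hTs : ∀ u, Summable fun i => T i u := fun u => by
    refine summable_iff_vanishing_norm.2 fun ε hε => ?_
    obtain ⟨s₀, δ, hδ, H⟩ := key u ε hε
    exact ⟨s₀, fun t ht => H u (by simpa using hδ) t ht⟩
  have hloc : TendstoLocallyUniformly (fun (s : Finset ι) u => ∑ i ∈ s, T i u)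
      (fun u => ∑' i, T i u) atTop := by
    rw [Metric.tendstoLocallyUniformly_iff]
    intro ε hε u₀
    obtain ⟨s₀, δ, hδ, H⟩ := key u₀ (ε / 2) (half_pos hε)
    refine ⟨Metric.ball u₀ δ, Metric.ball_mem_nhds _ hδ, ?_⟩
    filter_upwards [eventually_ge_atTop s₀] with s hs u hu
    rw [Metric.mem_ball, dist_eq_norm] at hu
    rw [dist_eq_norm]
    have hlim : Tendsto (fun t : Finset ι => ‖∑ i ∈ t, T i u - ∑ i ∈ s, T i u‖) atTop
        (𝓝 ‖∑' i, T i u - ∑ i ∈ s, T i u‖) := ((hTs u).hasSum.sub_const _).norm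
    refine lt_of_le_of_lt (le_of_tendsto hlim ?_) (half_lt_self hε)
    classical
    filter_upwards [eventually_ge_atTop s] with t ht
    rw [← Finset.sum_sdiff ht, add_sub_cancel_right]
    exact (H u hu _ (Finset.disjoint_of_subset_right hs Finset.sdiff_disjoint)).le
  refine ⟨fun u => ∑' i, T i u, ?_, fun u => ⟨?_, fun v => ?_⟩⟩
  · refine hloc.continuous (Frequently.of_forall fun s => ?_)
    refine continuous_finsetSum _ fun i _ => ?_
    exact ((hg' i).comp (L i).continuous).clm_comp continuous_const
  · refine hasFDerivAt_of_tendstoLocallyUniformlyOn (l := (atTop : Filter (Finset ι)))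
      (f := fun s u => ∑ i ∈ s, g i (L i u)) isOpen_univ
      (tendstoLocallyUniformlyOn_univ.2 hloc) (fun s u _ => ?_) (fun u _ => ?_) (Set.mem_univ u)
    · exact HasFDerivAt.fun_sum fun i _ => (hg i _).comp u (L i).hasFDerivAt
    · obtain ⟨C, hC0, hC⟩ := hb (B * ‖u‖)
      exact (Summable.of_norm_bounded ((hsm u).mul_left C) fun i => (hC i _ (hLi i u)).1).hasSum
  · have := (ContinuousLinearMap.apply ℝ W v).hasSum (hTs u).hasSum
    simpa only [hT, ContinuousLinearMap.apply_apply, ContinuousLinearMap.comp_apply] using this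

end SumComp

/-! ### Brezis–Lieb type lemmas -/

/-- Nonnegative sums tend to `0` if the terms do and are dominated, up to `ε` times a bounded sum,
by a summable function. -/
theorem tendsto_tsum_zero_of_almost_dominated {ι : Type*} {d m : ℕ → ι → ℝ}
    (hd : ∀ n i, 0 ≤ d n i) (hd0 : ∀ i, Tendsto (fun n => d n i) atTop (𝓝 0))
    (hm : ∀ n, Summable (m n)) {M : ℝ} (hM : ∀ n, ∑' i, m n i ≤ M)
    (hm0 : ∀ n i, 0 ≤ m n i)
    (H : ∀ ε > 0, ∃ b : ι → ℝ, Summable b ∧ ∀ n i, d n i ≤ ε * m n i + b i) :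
    Tendsto (fun n => ∑' i, d n i) atTop (𝓝 0) := by
  have hM0 : 0 ≤ M := (tsum_nonneg (hm0 0)).trans (hM 0)
  rw [Metric.tendsto_atTop']
  intro ε hε
  have hη : 0 < ε / (2 * (M + 1)) := by positivity
  obtain ⟨b, hbs, hb⟩ := H _ hη
  set η := ε / (2 * (M + 1)) with hη'
  have hηM : η * M < ε / 2 := by
    have : η * (M + 1) = ε / 2 := by rw [hη']; field_simp
    nlinarith
  have e1 : ∀ n i, ‖max (d n i - η * m n i) 0‖ ≤ |b i| := fun n i => by
    rw [Real.norm_of_nonneg (le_max_right _ _)]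
    refine max_le ?_ (abs_nonneg _)
    linarith [hb n i, le_abs_self (b i)]
  -- The positive part of `d - η m` is dominated by `|b|`, so dominated convergence applies to it;
  -- what is cut off sums to at most `η M < ε / 2`.
  have e2 : Tendsto (fun n => ∑' i, max (d n i - η * m n i) 0) atTop (𝓝 (∑' _ : ι, (0 : ℝ))) := by
    refine tendsto_tsum_of_dominated_convergence hbs.abs (fun i => ?_)
      (Eventually.of_forall fun n k => e1 n k)
    refine squeeze_zero (fun n => le_max_right _ _) (fun n => ?_) (hd0 i)
    refine max_le ?_ (hd n i)
    linarith [mul_nonneg hη.le (hm0 n i)]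
  rw [tsum_zero] at e2
  obtain ⟨n₀, hn₀⟩ := eventually_atTop.1 (e2.eventually_lt_const (half_pos hε))
  refine ⟨n₀, fun n hn => ?_⟩
  have s1 : Summable fun i => max (d n i - η * m n i) 0 :=
    Summable.of_norm_bounded hbs.abs fun i => e1 n i
  have le1 : ∀ i, d n i ≤ max (d n i - η * m n i) 0 + η * m n i := fun i => by
    linarith [le_max_left (d n i - η * m n i) 0]
  have s2 := s1.add ((hm n).mul_left η)
  have s3 : Summable (d n) := Summable.of_nonneg_of_le (hd n) le1 s2
  have := s3.tsum_le_tsum le1 s2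
  rw [s1.tsum_add ((hm n).mul_left η), tsum_mul_left] at this
  rw [dist_zero_right, Real.norm_of_nonneg (tsum_nonneg (hd n))]
  have h1 := hn₀ n hn.le
  have h2 := mul_le_mul_of_nonneg_left (hM n) hη.le
  linarith

/-- Dichotomy for a small `κ`: if `d ≤ κ b`, then `a` lies between `(1 - κ) b` and `(1 + κ) b`, and
`(1 ± κ) ^ p` is within `ε` of `1`; otherwise `a` and `b` are both at most `(κ⁻¹ + 1) d`. This is
the elementary inequality behind the splitting of the norm. -/
theorem exists_abs_rpow_sub_rpow_le {p : ℝ} (hp : 0 < p) {ε : ℝ} (hε : 0 < ε) :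
    ∃ C, 0 ≤ C ∧ ∀ a b d : ℝ, 0 ≤ a → 0 ≤ b → |a - b| ≤ d →
      |a ^ p - b ^ p| ≤ ε * b ^ p + C * d ^ p := by
  have c1 : Tendsto (fun κ : ℝ => (1 + κ) ^ p) (𝓝 0) (𝓝 1) := by
    have : ContinuousAt (fun κ : ℝ => (1 + κ) ^ p) 0 :=
      (continuousAt_const.add continuousAt_id).rpow_const (Or.inr hp.le)
    simpa [ContinuousAt] using this
  have c2 : Tendsto (fun κ : ℝ => (1 - κ) ^ p) (𝓝 0) (𝓝 1) := by
    have : ContinuousAt (fun κ : ℝ => (1 - κ) ^ p) 0 :=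
      (continuousAt_const.sub continuousAt_id).rpow_const (Or.inr hp.le)
    simpa [ContinuousAt] using this
  have ev : ∀ᶠ κ : ℝ in 𝓝[>] 0, (1 + κ) ^ p < 1 + ε ∧ 1 - ε < (1 - κ) ^ p ∧ κ < 1 ∧ 0 < κ := by
    filter_upwards [(c1.eventually_lt_const (by linarith : (1 : ℝ) < 1 + ε)).filter_mono
        nhdsWithin_le_nhds, (c2.eventually_const_lt (by linarith : 1 - ε < 1)).filter_mono
        nhdsWithin_le_nhds, (eventually_lt_nhds zero_lt_one).filter_mono nhdsWithin_le_nhds,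
        self_mem_nhdsWithin] with κ h1 h2 h3 h4
    exact ⟨h1, h2, h3, h4⟩
  obtain ⟨κ, h1, h2, h3, h4⟩ := ev.exists
  refine ⟨(κ⁻¹ + 1) ^ p, by positivity, fun a b d ha hb hd => ?_⟩
  have hd0 : 0 ≤ d := (abs_nonneg _).trans hd
  obtain ⟨hd1, hd2⟩ := abs_le.1 hd
  have hbp : 0 ≤ b ^ p := by positivity
  rcases le_or_gt d (κ * b) with hdb | hdb
  · have u1 : a ^ p ≤ (1 + ε) * b ^ p := by
      calc a ^ p ≤ ((1 + κ) * b) ^ p := Real.rpow_le_rpow ha (by linarith) hp.le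
        _ = (1 + κ) ^ p * b ^ p := Real.mul_rpow (by linarith) hb
        _ ≤ _ := by gcongr
    have u2 : (1 - ε) * b ^ p ≤ a ^ p := by
      calc (1 - ε) * b ^ p ≤ (1 - κ) ^ p * b ^ p := by gcongr
        _ = ((1 - κ) * b) ^ p := (Real.mul_rpow (by linarith) hb).symm
        _ ≤ a ^ p := Real.rpow_le_rpow (mul_nonneg (by linarith) hb) (by linarith) hp.le
    have : 0 ≤ (κ⁻¹ + 1) ^ p * d ^ p := by positivity
    rw [abs_le]
    constructor <;> linarith
  · have hb' : b ≤ κ⁻¹ * d := by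
      rw [inv_mul_eq_div, le_div_iff₀ h4]
      linarith
    have u1 : a ^ p ≤ (κ⁻¹ + 1) ^ p * d ^ p := by
      rw [← Real.mul_rpow (by positivity) hd0]
      exact Real.rpow_le_rpow ha (by linarith) hp.le
    have u2 : b ^ p ≤ (κ⁻¹ + 1) ^ p * d ^ p := by
      rw [← Real.mul_rpow (by positivity) hd0]
      exact Real.rpow_le_rpow hb (by linarith) hp.le
    have u3 : 0 ≤ a ^ p := by positivity
    have u4 : 0 ≤ ε * b ^ p := by positivity
    rw [abs_le]
    constructor <;> linarith

/-- `k` is continuous and `o(|t|^p)` at the origin. -/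
structure IsSmallPow (p : ℝ) (k : ℝ → ℝ) : Prop where
  cont : Continuous k
  small : ∀ ε > 0, ∃ δ > 0, ∀ t, |t| ≤ δ → |k t| ≤ ε * |t| ^ p

namespace IsSmallPow

variable {p : ℝ} {k : ℝ → ℝ}

theorem apply_zero (hk : IsSmallPow p k) (hp : 0 < p) : k 0 = 0 := by
  obtain ⟨δ, hδ, H⟩ := hk.small 1 one_pos
  have := H 0 (by simpa using hδ.le)
  simpa [Real.zero_rpow hp.ne'] using this

/-- Away from the origin, `|t| ^ p` is bounded below by `δ ^ p` and `k` is bounded by compactness.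
Elements of `H` are bounded functions, so a bound on bounded sets is what the sums over the lattice
require. -/
theorem exists_abs_le (hk : IsSmallPow p k) (hp : 0 ≤ p) (M : ℝ) :
    ∃ C, 0 ≤ C ∧ ∀ t, |t| ≤ M → |k t| ≤ C * |t| ^ p := by
  obtain ⟨δ, hδ, H⟩ := hk.small 1 one_pos
  obtain ⟨K, hK⟩ := (isCompact_Icc (a := -M) (b := M)).exists_bound_of_continuousOn
    hk.cont.continuousOn
  refine ⟨max 1 (K / δ ^ p), by positivity, fun t ht => ?_⟩
  rcases le_or_gt |t| δ with h | h
  · refine (H t h).trans ?_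
    gcongr
    exact le_max_left _ _
  · have h1 : |k t| ≤ K := hK t (abs_le.1 ht)
    have hK0 : 0 ≤ K := (abs_nonneg _).trans h1
    calc |k t| ≤ K / δ ^ p * δ ^ p := by rwa [div_mul_cancel₀ _ (by positivity)]
      _ ≤ K / δ ^ p * |t| ^ p := by gcongr
      _ ≤ _ := by gcongr; exact le_max_right _ _

/-- When both arguments are below `δ`, smallness at the origin suffices. Otherwise `|a| ^ p + |b| ^
p ≥ δ ^ p`, and uniform continuity with tolerance `ε * δ ^ p` settles close arguments, while for `|a
- b| ≥ κ` the term with `C` exceeds the trivial bound `2 * |K|`. -/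
theorem exists_abs_sub_le (hk : IsSmallPow p k) (hp : 0 ≤ p) (M : ℝ) {ε : ℝ} (hε : 0 < ε) :
    ∃ C, 0 ≤ C ∧ ∀ a b, |a| ≤ M → |b| ≤ M →
      |k a - k b| ≤ ε * (|a| ^ p + |b| ^ p) + C * |a - b| ^ p := by
  obtain ⟨δ, hδ, H⟩ := hk.small ε hε
  obtain ⟨K, hK⟩ := (isCompact_Icc (a := -M) (b := M)).exists_bound_of_continuousOn
    hk.cont.continuousOn
  have huc := (isCompact_Icc (a := -M) (b := M)).uniformContinuousOn_of_continuous
    hk.cont.continuousOn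
  obtain ⟨κ, hκ, hκ'⟩ := Metric.uniformContinuousOn_iff.1 huc (ε * δ ^ p) (by positivity)
  refine ⟨2 * |K| / κ ^ p, by positivity, fun a b ha hb => ?_⟩
  have p1 : 0 ≤ |a| ^ p := by positivity
  have p2 : 0 ≤ |b| ^ p := by positivity
  have p3 : 0 ≤ 2 * |K| / κ ^ p * |a - b| ^ p := by positivity
  by_cases hab : |a| ≤ δ ∧ |b| ≤ δ
  · have := abs_sub (k a) (k b)
    linarith [H a hab.1, H b hab.2]
  · have hδp : δ ^ p ≤ |a| ^ p + |b| ^ p := by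
      rcases not_and_or.1 hab with h | h
      · have := Real.rpow_le_rpow hδ.le (not_le.1 h).le hp
        linarith
      · have := Real.rpow_le_rpow hδ.le (not_le.1 h).le hp
        linarith
    rcases lt_or_ge |a - b| κ with h | h
    · have := (hκ' a (abs_le.1 ha) b (abs_le.1 hb) h).le
      rw [Real.dist_eq] at this
      nlinarith
    · have h1 : |k a| ≤ |K| := (hK a (abs_le.1 ha)).trans (le_abs_self _)
      have h2 : |k b| ≤ |K| := (hK b (abs_le.1 hb)).trans (le_abs_self _)
      have h3 := abs_sub (k a) (k b)
      have h4 : 2 * |K| ≤ 2 * |K| / κ ^ p * |a - b| ^ p := by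
        calc 2 * |K| = 2 * |K| / κ ^ p * κ ^ p := by rw [div_mul_cancel₀ _ (by positivity)]
          _ ≤ _ := by gcongr
      nlinarith [mul_nonneg hε.le (add_nonneg p1 p2)]

end IsSmallPow

end Choquard

end

/-! ### Fourier analysis of the Green's function -/

noncomputable section

namespace Choquard

variable {N : ℕ}

/-! ### The symbol of the lattice Laplacian -/

theorem symbol_eq_sum (k : Fin N → ℝ) : symbol k = ∑ j, 4 * Real.sin (k j / 2) ^ 2 := by
  have h : ∀ j, 4 * Real.sin (k j / 2) ^ 2 = 2 - 2 * Real.cos (k j) := fun j => by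
    have h1 := Real.cos_two_mul (k j / 2)
    have h2 := Real.sin_sq_add_cos_sq (k j / 2)
    rw [mul_div_cancel₀ _ two_ne_zero] at h1
    linarith
  simp only [h, symbol, Finset.sum_sub_distrib, ← Finset.mul_sum]
  simp [mul_comm]

theorem sin_sq_le_symbol (k : Fin N → ℝ) (j : Fin N) :
    4 * Real.sin (k j / 2) ^ 2 ≤ symbol k := by
  rw [symbol_eq_sum]
  exact Finset.single_le_sum (f := fun j => 4 * Real.sin (k j / 2) ^ 2)
    (fun i _ => by positivity) (Finset.mem_univ j)

theorem symbol_nonneg (k : Fin N → ℝ) : 0 ≤ symbol k := by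
  rw [symbol_eq_sum]
  positivity

theorem continuous_symbol : Continuous (symbol : (Fin N → ℝ) → ℝ) := by
  unfold symbol
  fun_prop

theorem measurable_symbol_rpow (s : ℝ) : Measurable fun k : Fin N → ℝ => symbol k ^ s :=
  continuous_symbol.measurable.pow_const s

theorem measurableSet_torus : MeasurableSet (torus N) := measurableSet_Icc

theorem torus_ae_eq : (Set.univ.pi fun _ : Fin N => Set.Ioo (0 : ℝ) (2 * Real.pi)) =ᵐ[volume]
    torus N := Measure.univ_pi_Ioo_ae_eq_Icc (f := fun _ : Fin N => (0 : ℝ))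

theorem restrict_torus : (volume : Measure (Fin N → ℝ)).restrict (torus N) =
    Measure.pi fun _ : Fin N => (volume : Measure ℝ).restrict (Set.Ioo 0 (2 * Real.pi)) := by
  rw [← Measure.restrict_congr_set torus_ae_eq, volume_pi, Measure.restrict_pi_pi]

instance : IsFiniteMeasure ((volume : Measure (Fin N → ℝ)).restrict (torus N)) := by
  rw [restrict_torus]
  infer_instance

theorem ae_torus_mem_Ioo : ∀ᵐ k ∂(volume : Measure (Fin N → ℝ)).restrict (torus N),
    ∀ j, k j ∈ Set.Ioo 0 (2 * Real.pi) := by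
  rw [← Measure.restrict_congr_set torus_ae_eq]
  refine (ae_restrict_mem (MeasurableSet.univ_pi fun _ => measurableSet_Ioo)).mono fun k hk j => ?_
  exact hk j (Set.mem_univ j)

theorem sin_half_pos {t : ℝ} (ht : t ∈ Set.Ioo 0 (2 * Real.pi)) : 0 < Real.sin (t / 2) :=
  Real.sin_pos_of_pos_of_lt_pi (by linarith [ht.1]) (by linarith [ht.2])

theorem ae_symbol_pos (hN : N ≠ 0) : ∀ᵐ k ∂(volume : Measure (Fin N → ℝ)).restrict (torus N),
    0 < symbol k := by
  filter_upwards [ae_torus_mem_Ioo] with k hk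
  have := sin_half_pos (hk ⟨0, Nat.pos_of_ne_zero hN⟩)
  exact lt_of_lt_of_le (by positivity) (sin_sq_le_symbol k ⟨0, Nat.pos_of_ne_zero hN⟩)

/-- Jordan's inequality bounds `sin (t / 2)` below by `r / π`, with `r` the distance from `t` to the
nearer endpoint, and `r ^ (-2β)` is integrable because `2β < 1`. -/
theorem integrableOn_sin_sq_rpow {β : ℝ} (hβ : 0 ≤ β) (hβ' : β < 1 / 2) :
    IntegrableOn (fun t : ℝ => (4 * Real.sin (t / 2) ^ 2) ^ (-β)) (Set.Ioo 0 (2 * Real.pi)) := by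
  have hpi := Real.pi_pos
  have i1 : IntervalIntegrable (fun t : ℝ => t ^ (-(2 * β))) volume 0 (2 * Real.pi) :=
    intervalIntegral.intervalIntegrable_rpow' (by linarith)
  have i2 : IntervalIntegrable (fun t : ℝ => (2 * Real.pi - t) ^ (-(2 * β))) volume 0
      (2 * Real.pi) := by
    have := (i1.comp_sub_left (2 * Real.pi)).symm
    simpa using this
  have i3 : IntegrableOn (fun t : ℝ => (4 / Real.pi ^ 2) ^ (-β) *
      (t ^ (-(2 * β)) + (2 * Real.pi - t) ^ (-(2 * β)))) (Set.Ioo 0 (2 * Real.pi)) :=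
    (intervalIntegrable_iff_integrableOn_Ioo_of_le (by positivity)).1 ((i1.add i2).const_mul _)
  refine Integrable.mono' i3 ?_ ?_
  · exact Measurable.aestronglyMeasurable (by fun_prop)
  · refine ae_restrict_of_forall_mem measurableSet_Ioo fun t ht => ?_
    have bd : ∀ r : ℝ, 0 < r → r / Real.pi ≤ Real.sin (t / 2) →
        (4 * Real.sin (t / 2) ^ 2) ^ (-β) ≤ (4 / Real.pi ^ 2) ^ (-β) * r ^ (-(2 * β)) := by
      intro r hr h
      have e : (4 / Real.pi ^ 2) ^ (-β) * r ^ (-(2 * β)) = (4 * (r / Real.pi) ^ 2) ^ (-β) := by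
        rw [show -(2 * β) = 2 * (-β) by ring, Real.rpow_mul hr.le, Real.rpow_two,
          ← Real.mul_rpow (by positivity) (by positivity)]
        congr 1
        ring
      rw [e]
      refine Real.rpow_le_rpow_of_nonpos (by positivity) ?_ (by linarith)
      gcongr
    rw [Real.norm_of_nonneg (by positivity), mul_add]
    have ht1 : 0 < t := ht.1
    have ht2 : 0 < 2 * Real.pi - t := by linarith [ht.2]
    rcases le_total t Real.pi with h | h
    · have := Real.mul_le_sin (x := t / 2) (by linarith) (by linarith)
      refine (bd t ht1 (le_trans (le_of_eq (by field_simp)) this)).trans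
        (le_add_of_nonneg_right (by positivity))
    · have := Real.mul_le_sin (x := Real.pi - t / 2) (by linarith) (by linarith)
      rw [Real.sin_pi_sub] at this
      refine (bd _ ht2 (le_trans (le_of_eq (by field_simp)) this)).trans
        (le_add_of_nonneg_left (by positivity))

/-- Splitting the power into `N` equal factors and bounding the symbol in the `j`-th one below by `4
sin² (k j / 2)` dominates the integrand by a product of one-variable functions with exponent `α /
(2N)`; this is below `1 / 2` exactly when `α < N`. -/
theorem integrable_symbol_rpow {α : ℝ} (hα : 0 < α) (hαN : α < N) :
    Integrable (fun k : Fin N → ℝ => symbol k ^ (-(α / 2))) (volume.restrict (torus N)) := by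
  have hN0 : (0 : ℝ) < N := hα.trans hαN
  have hint : Integrable (fun k : Fin N → ℝ =>
      ∏ j, (4 * Real.sin (k j / 2) ^ 2) ^ (-(α / (2 * N)))) (volume.restrict (torus N)) := by
    rw [restrict_torus]
    refine Integrable.fintype_prod (f := fun _ t => (4 * Real.sin (t / 2) ^ 2) ^ (-(α / (2 * N))))
      fun j => integrableOn_sin_sq_rpow (by positivity) ?_
    rw [div_lt_div_iff₀ (by positivity) (by positivity)]
    linarith
  refine Integrable.mono' hint (measurable_symbol_rpow _).aestronglyMeasurable ?_
  filter_upwards [ae_torus_mem_Ioo] with k hk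
  have hs := symbol_nonneg k
  rw [Real.norm_of_nonneg (by positivity)]
  have e : symbol k ^ (-(α / 2)) = ∏ _j : Fin N, symbol k ^ (-(α / (2 * N))) := by
    rw [Finset.prod_const, Finset.card_univ, Fintype.card_fin, ← Real.rpow_natCast,
      ← Real.rpow_mul hs]
    congr 1
    field_simp
  rw [e]
  refine Finset.prod_le_prod (fun j _ => by positivity) fun j _ => ?_
  have := sin_half_pos (hk j)
  exact Real.rpow_le_rpow_of_nonpos (by positivity) (sin_sq_le_symbol k j)
    (neg_nonpos.2 (by positivity))

/-! ### Elementary properties of the Green's function -/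

/-- The pairing `x · k` of a lattice point with a frequency. -/
def pairing (x : Fin N → ℤ) (k : Fin N → ℝ) : ℝ := ∑ j, (x j : ℝ) * k j

theorem continuous_pairing (x : Fin N → ℤ) : Continuous (pairing x) := by
  unfold pairing
  fun_prop

theorem fracDegree_nonneg (α : ℝ) : 0 ≤ fracDegree N α :=
  mul_nonneg (by positivity)
    (integral_nonneg fun k => Real.rpow_nonneg (symbol_nonneg k) _)

theorem green_eq_integral_cos {α : ℝ} (hα : 0 < α) (hαN : α < N) (x y : Fin N → ℤ) :
    green α x y = fracDegree N α / (2 * Real.pi) ^ N *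
      ∫ k in torus N, Real.cos (pairing (x - y) k) * symbol k ^ (-(α / 2)) := by
  have hint : Integrable (fun k : Fin N → ℝ =>
      Complex.exp (Complex.I * ((∑ j, ((x j - y j : ℤ) : ℝ) * k j : ℝ) : ℂ)) *
        ((symbol k ^ (-(α / 2)) : ℝ) : ℂ)) (volume.restrict (torus N)) := by
    refine (integrable_symbol_rpow hα hαN).ofReal.bdd_mul (c := 1)
      (Continuous.aestronglyMeasurable (by fun_prop)) (Eventually.of_forall fun k => ?_)
    rw [mul_comm, Complex.norm_exp_ofReal_mul_I]
  rw [green, Complex.re_ofReal_mul, ← RCLike.re_eq_complex_re, ← integral_re hint]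
  congr 1
  refine integral_congr_ae (Eventually.of_forall fun k => ?_)
  simp only [RCLike.re_eq_complex_re, Complex.re_mul_ofReal]
  rw [mul_comm Complex.I, Complex.exp_ofReal_mul_I_re]
  rfl

theorem green_add_add (α : ℝ) (x y z : Fin N → ℤ) :
    green α (x + z) (y + z) = green α x y := by
  simp [green]

/-- The Green's function is the Gram matrix of a family of vectors in an `L²` space. -/
theorem exists_inner_eq_green {α : ℝ} (hα : 0 < α) (hαN : α < N) :
    ∃ e : (Fin N → ℤ) → Lp ℂ 2 ((volume : Measure (Fin N → ℝ)).restrict (torus N)),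
      ∀ x y, inner ℝ (e x) (e y) = green α x y := by
  set c := fracDegree N α / (2 * Real.pi) ^ N with hc
  have hc0 : 0 ≤ c := div_nonneg (fracDegree_nonneg α) (by positivity)
  -- The Gram vectors are the characters multiplied by the square root of the spectral density. They
  -- are square integrable because the density is integrable.
  set r : (Fin N → ℝ) → ℝ := fun k => √(c * symbol k ^ (-(α / 2))) with hr
  have hrr : ∀ k, r k * r k = c * symbol k ^ (-(α / 2)) := fun k =>
    Real.mul_self_sqrt (mul_nonneg hc0 (Real.rpow_nonneg (symbol_nonneg k) _))
  have hrm : Measurable r := ((measurable_symbol_rpow _).const_mul c).sqrt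
  set w : (Fin N → ℤ) → (Fin N → ℝ) → ℂ :=
    fun x k => Complex.exp ((pairing x k : ℝ) * Complex.I) * (r k : ℂ) with hw
  have hwL : ∀ x, MemLp (w x) 2 (volume.restrict (torus N)) := fun x => by
    have hm : AEStronglyMeasurable (w x) (volume.restrict (torus N)) := by
      have h1 : Continuous fun k : Fin N → ℝ => Complex.exp ((pairing x k : ℝ) * Complex.I) := by
        have := continuous_pairing x
        fun_prop
      exact (h1.measurable.mul (Complex.measurable_ofReal.comp hrm)).aestronglyMeasurable
    rw [memLp_two_iff_integrable_sq_norm hm]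
    refine ((integrable_symbol_rpow hα hαN).const_mul c).congr (Eventually.of_forall fun k => ?_)
    simp only [hw, norm_mul, Complex.norm_exp_ofReal_mul_I, one_mul, Complex.norm_real,
      Real.norm_eq_abs, sq_abs]
    rw [sq, hrr]
  refine ⟨fun x => (hwL x).toLp, fun x y => ?_⟩
  rw [L2.inner_def, green_eq_integral_cos hα hαN, ← hc, ← integral_const_mul]
  refine integral_congr_ae ?_
  filter_upwards [(hwL x).coeFn_toLp, (hwL y).coeFn_toLp] with k hx hy
  rw [hx, hy, Complex.inner]
  have e1 : pairing (x - y) k = pairing x k - pairing y k := by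
    simp [pairing, sub_mul]
  simp only [hw, map_mul, Complex.conj_ofReal]
  rw [e1, Real.cos_sub]
  simp only [Complex.exp_mul_I, ← Complex.ofReal_cos, ← Complex.ofReal_sin, map_add, map_mul,
    Complex.conj_ofReal, Complex.conj_I, Complex.mul_re, Complex.mul_im, Complex.add_re,
    Complex.add_im, Complex.ofReal_re, Complex.ofReal_im, Complex.I_re, Complex.I_im,
    Complex.neg_re, Complex.neg_im]
  have := hrr k
  ring_nf at this ⊢
  rw [this]

/-- Riemann–Lebesgue: up to a constant, the kernel is a Fourier coefficient of an integrable
function. -/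
theorem tendsto_green_cofinite {α : ℝ} (hα : 0 < α) (hαN : α < N) (y : Fin N → ℤ) :
    Tendsto (fun x => green α x y) cofinite (𝓝 0) := by
  -- The factor `-1 / (2π)` matches the normalization of `Real.fourierChar`. Testing operator norms
  -- on basis vectors shows that only finitely many `x` have `w x` in a given ball.
  set w : (Fin N → ℤ) → StrongDual ℝ (Fin N → ℝ) := fun x =>
    ∑ j, (-((x - y) j : ℝ) / (2 * Real.pi)) • ContinuousLinearMap.proj (R := ℝ) j with hw
  have hwa : ∀ x k, -(w x k) * (2 * Real.pi) = pairing (x - y) k := fun x k => by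
    simp only [hw, pairing, FunLike.coe_sum, Finset.sum_apply, FunLike.coe_smul, Pi.smul_apply,
      ContinuousLinearMap.proj_apply, smul_eq_mul, Pi.sub_apply, Int.cast_sub]
    rw [← Finset.sum_neg_distrib, Finset.sum_mul]
    refine Finset.sum_congr rfl fun j _ => ?_
    have := Real.pi_pos
    field_simp
  have hwt : Tendsto w cofinite (cocompact _) := by
    rw [← Metric.cobounded_eq_cocompact, ← tendsto_norm_atTop_iff_cobounded, tendsto_atTop]
    intro M
    set m : ℤ := ⌈|M| * (2 * Real.pi)⌉
    have hfin : (Set.Icc (fun j => y j - m) (fun j => y j + m)).Finite := Set.finite_Icc _ _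
    refine (hfin.subset ?_ : Set.Finite _)
    intro x hx
    have hx' : ‖w x‖ < M := not_le.1 hx
    have hj : ∀ j, |x j - y j| ≤ m := fun j => by
      have h1 := (w x).le_opNorm (Pi.single j 1)
      have h2 : pairing (x - y) (Pi.single j 1) = ((x j - y j : ℤ) : ℝ) := by
        simp [pairing, Pi.single_apply]
      have h3 := hwa x (Pi.single j 1)
      rw [h2] at h3
      have h4 : ‖(Pi.single j 1 : Fin N → ℝ)‖ = 1 := by simp [Pi.norm_single]
      rw [h4, mul_one, Real.norm_eq_abs] at h1
      have h5 : |((x j - y j : ℤ) : ℝ)| ≤ |M| * (2 * Real.pi) := by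
        rw [← h3, abs_mul, abs_neg, abs_of_pos (by positivity : 0 < 2 * Real.pi)]
        have := le_abs_self M
        exact mul_le_mul_of_nonneg_right (by linarith) (by positivity)
      have h6 := h5.trans (Int.le_ceil _)
      rw [← Int.cast_abs] at h6
      exact_mod_cast h6
    constructor <;> intro j <;> have := abs_le.1 (hj j) <;> simp only <;> linarith [this.1, this.2]
  have hRL := (tendsto_integral_exp_smul_cocompact (V := Fin N → ℝ)
    ((torus N).indicator fun k => ((symbol k ^ (-(α / 2)) : ℝ) : ℂ)) volume).comp hwt
  have hre := ((Complex.continuous_re.tendsto 0).comp hRL).const_mul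
    (fracDegree N α / (2 * Real.pi) ^ N)
  rw [Complex.zero_re, mul_zero] at hre
  refine hre.congr fun x => ?_
  rw [green_eq_integral_cos hα hαN]
  congr 1
  have hint : Integrable (fun k : Fin N → ℝ => Real.fourierChar (-(w x) k) •
      ((symbol k ^ (-(α / 2)) : ℝ) : ℂ)) (volume.restrict (torus N)) := by
    simp only [Circle.smul_def, smul_eq_mul]
    refine (integrable_symbol_rpow hα hαN).ofReal.bdd_mul (c := 1)
      (Continuous.aestronglyMeasurable ?_) (Eventually.of_forall fun k => ?_)
    · exact continuous_subtype_val.comp (Real.continuous_fourierChar.comp (w x).continuous.neg)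
    · exact (Circle.norm_coe _).le
  have e : ∀ k, Real.fourierChar (-(w x) k) •
      (torus N).indicator (fun k => ((symbol k ^ (-(α / 2)) : ℝ) : ℂ)) k =
      (torus N).indicator (fun k => Real.fourierChar (-(w x) k) •
        ((symbol k ^ (-(α / 2)) : ℝ) : ℂ)) k := fun k => by
    by_cases hk : k ∈ torus N <;> simp [hk]
  simp only [Function.comp_apply, e]
  rw [integral_indicator measurableSet_torus, ← RCLike.re_eq_complex_re, ← integral_re hint]
  refine integral_congr_ae (Eventually.of_forall fun k => ?_)
  simp only [RCLike.re_eq_complex_re, Circle.smul_def, smul_eq_mul, Complex.re_mul_ofReal,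
    Real.fourierChar_apply, Complex.exp_ofReal_mul_I_re]
  rw [← hwa, mul_comm (2 * Real.pi)]

/-! ### Positivity of the Green's function -/

theorem integral_exp_pairing (z : ℤ) :
    ∃ r : ℝ, 0 ≤ r ∧ ∫ t in Set.Ioo 0 (2 * Real.pi), Complex.exp (((z : ℝ) * t : ℝ) * Complex.I) =
      (r : ℂ) := by
  have hpi := Real.pi_pos
  rw [← integral_Ioc_eq_integral_Ioo, ← intervalIntegral.integral_of_le (by positivity)]
  rcases eq_or_ne z 0 with rfl | hz
  · exact ⟨2 * Real.pi, by positivity, by simp⟩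
  · refine ⟨0, le_rfl, ?_⟩
    have hz' : ((z : ℂ) * Complex.I) ≠ 0 := mul_ne_zero (by exact_mod_cast hz) Complex.I_ne_zero
    have e : ∀ t : ℝ, (((z : ℝ) * t : ℝ) : ℂ) * Complex.I = (z : ℂ) * Complex.I * t := fun t => by
      push_cast
      ring
    simp only [e]
    rw [integral_exp_mul_complex hz']
    have : (z : ℂ) * Complex.I * ((2 * Real.pi : ℝ) : ℂ) = z * (2 * Real.pi * Complex.I) := by
      push_cast
      ring
    rw [this, Complex.exp_int_mul_two_pi_mul_I]
    simp

theorem integral_cos_pairing_nonneg (z : Fin N → ℤ) :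
    0 ≤ ∫ k in torus N, Real.cos (pairing z k) := by
  have hint : Integrable (fun k : Fin N → ℝ => Complex.exp ((pairing z k : ℝ) * Complex.I))
      (volume.restrict (torus N)) := by
    refine Integrable.mono' (integrable_const (1 : ℝ)) (Continuous.aestronglyMeasurable ?_)
      (Eventually.of_forall fun k => ?_)
    · have := continuous_pairing z
      fun_prop
    · rw [Complex.norm_exp_ofReal_mul_I]
  have e : ∀ k : Fin N → ℝ, Real.cos (pairing z k) =
      RCLike.re (Complex.exp ((pairing z k : ℝ) * Complex.I)) := fun k => by
    rw [RCLike.re_eq_complex_re, Complex.exp_ofReal_mul_I_re]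
  simp only [e]
  rw [integral_re hint, restrict_torus]
  have e2 : ∀ k : Fin N → ℝ, Complex.exp ((pairing z k : ℝ) * Complex.I) =
      ∏ j, Complex.exp (((z j : ℝ) * k j : ℝ) * Complex.I) := fun k => by
    rw [← Complex.exp_sum, pairing, Complex.ofReal_sum, Finset.sum_mul]
  simp only [e2]
  rw [integral_fintype_prod_eq_prod (𝕜 := ℂ)
    (fun j (t : ℝ) => Complex.exp (((z j : ℝ) * t : ℝ) * Complex.I))]
  choose r hr0 hr using integral_exp_pairing
  simp only [hr, ← Complex.ofReal_prod, RCLike.re_eq_complex_re, Complex.ofReal_re]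
  exact Finset.prod_nonneg fun j _ => hr0 _

theorem integrable_torus_of_continuous {g : (Fin N → ℝ) → ℝ} (hg : Continuous g) :
    Integrable g (volume.restrict (torus N)) :=
  hg.continuousOn.integrableOn_compact isCompact_Icc

/-- The identity `cos (z·k) cos k_j = ½ (cos ((z + e_j)·k) + cos ((z - e_j)·k))` removes one power
and reduces to `n = 0`. Up to a positive factor the integral counts the walks of length `n` from `0`
to `z`. -/
theorem integral_cos_pairing_mul_pow_nonneg (n : ℕ) (z : Fin N → ℤ) :
    0 ≤ ∫ k in torus N, Real.cos (pairing z k) * (∑ j, Real.cos (k j)) ^ n := by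
  induction n generalizing z with
  | zero => simpa using integral_cos_pairing_nonneg z
  | succ n ih =>
    have e : ∀ k : Fin N → ℝ, Real.cos (pairing z k) * (∑ j, Real.cos (k j)) ^ (n + 1) =
        ∑ j, (1 / 2 * (Real.cos (pairing (z + Pi.single j 1) k) * (∑ j, Real.cos (k j)) ^ n) +
          1 / 2 * (Real.cos (pairing (z - Pi.single j 1) k) * (∑ j, Real.cos (k j)) ^ n)) := by
      intro k
      rw [pow_succ, ← mul_assoc, Finset.mul_sum]
      refine Finset.sum_congr rfl fun j _ => ?_
      have e1 : pairing (z + Pi.single j 1) k = pairing z k + k j := by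
        simp [pairing, add_mul, Finset.sum_add_distrib, Pi.single_apply]
      have e2 : pairing (z - Pi.single j 1) k = pairing z k - k j := by
        simp [pairing, sub_mul, Finset.sum_sub_distrib, Pi.single_apply]
      rw [e1, e2, Real.cos_add, Real.cos_sub]
      ring
    have hi : ∀ z' : Fin N → ℤ, Integrable (fun k : Fin N → ℝ =>
        1 / 2 * (Real.cos (pairing z' k) * (∑ j, Real.cos (k j)) ^ n))
        (volume.restrict (torus N)) := fun z' => by
      refine integrable_torus_of_continuous ?_
      have := continuous_pairing z'
      fun_prop
    simp only [e]
    rw [integral_finsetSum _ fun j _ => by exact (hi _).add (hi _)]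
    refine Finset.sum_nonneg fun j _ => ?_
    rw [integral_add (hi _) (hi _), integral_const_mul, integral_const_mul]
    have := ih (z + Pi.single j 1)
    have := ih (z - Pi.single j 1)
    positivity

/-- This coefficient is the rising factorial `s (s + 1) ⋯ (s + n - 1)` divided by `n!`. -/
theorem choose_nonneg {s : ℝ} (hs : 0 < s) (n : ℕ) : 0 ≤ Ring.choose (s + n - 1) n := by
  have h1 : Ring.choose (s + n - 1) n = Ring.multichoose s n := by
    rw [Ring.choose]
    congr 1
    ring
  have h2 := Ring.factorial_nsmul_multichoose_eq_ascPochhammer s n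
  rw [Polynomial.ascPochhammer_smeval_eq_eval, nsmul_eq_mul] at h2
  have h3 := ascPochhammer_pos n s hs
  rw [← h2] at h3
  rw [h1]
  exact (pos_of_mul_pos_right h3 (by positivity)).le

theorem hasSum_one_sub_rpow_neg {s q : ℝ} (hq : |q| < 1) :
    HasSum (fun n : ℕ => Ring.choose (s + n - 1) n * q ^ n) ((1 - q) ^ (-s)) := by
  have h := (Real.one_div_one_sub_rpow_hasFPowerSeriesOnBall_zero s).hasSum (y := q)
    (by simpa [enorm_eq_nnnorm] using! hq)
  simp only [FormalMultilinearSeries.ofScalars_apply_eq, smul_eq_mul, zero_add] at h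
  rw [Real.rpow_neg (by linarith [le_abs_self q])]
  simpa using h

theorem abs_sum_cos_le (k : Fin N → ℝ) : |∑ j, Real.cos (k j)| ≤ N := by
  refine (Finset.abs_sum_le_sum_abs _ _).trans ?_
  refine (Finset.sum_le_sum fun j _ => Real.abs_cos_le_one (k j)).trans ?_
  simp

/-- Here `symbol k + ε = (2N + ε) (1 - c ∑ cos k_j)`, and `ε > 0` gives `|c ∑ cos k_j| ≤ ρ < 1`. The
negative power thus expands in a uniformly convergent binomial series with nonnegative coefficients,
each term of which has a nonnegative integral. -/
theorem integral_cos_pairing_mul_symbol_add_nonneg {s ε : ℝ} (hs : 0 < s) (hε : 0 < ε)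
    (z : Fin N → ℤ) :
    0 ≤ ∫ k in torus N, Real.cos (pairing z k) * (symbol k + ε) ^ (-s) := by
  have hd : (0 : ℝ) < 2 * N + ε := by positivity
  set c : ℝ := 2 / (2 * N + ε) with hc
  have hc0 : 0 ≤ c := by positivity
  set ρ : ℝ := c * N with hρ
  have hρ0 : 0 ≤ ρ := by positivity
  have hρ1 : ρ < 1 := by
    rw [hρ, hc, div_mul_eq_mul_div, div_lt_one hd]
    linarith
  have hq : ∀ k : Fin N → ℝ, |c * ∑ j, Real.cos (k j)| ≤ ρ := fun k => by
    rw [abs_mul, abs_of_nonneg hc0]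
    exact mul_le_mul_of_nonneg_left (abs_sum_cos_le k) hc0
  have ha := hasSum_one_sub_rpow_neg (s := s) (q := ρ) (by rwa [abs_of_nonneg hρ0])
  have hsum : HasSum (fun n : ℕ => ∫ k in torus N, Real.cos (pairing z k) *
        (Ring.choose (s + n - 1) n * (c * ∑ j, Real.cos (k j)) ^ n))
      (∫ k in torus N, Real.cos (pairing z k) * (1 - c * ∑ j, Real.cos (k j)) ^ (-s)) := by
    refine hasSum_integral_of_dominated_convergence
      (fun n _ => Ring.choose (s + n - 1) n * ρ ^ n) (fun n => ?_)
      (fun n => Eventually.of_forall fun k => ?_) (Eventually.of_forall fun _ => ha.summable)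
      (integrable_const _) (Eventually.of_forall fun k => ?_)
    · refine Continuous.aestronglyMeasurable ?_
      have := continuous_pairing z
      fun_prop
    · rw [norm_mul, norm_mul, norm_pow, Real.norm_of_nonneg (choose_nonneg hs n)]
      have h1 : ‖Real.cos (pairing z k)‖ ≤ 1 := Real.abs_cos_le_one _
      have h2 : ‖c * ∑ j, Real.cos (k j)‖ ^ n ≤ ρ ^ n :=
        pow_le_pow_left₀ (norm_nonneg _) (hq k) n
      calc _ ≤ 1 * (Ring.choose (s + n - 1) n * ρ ^ n) := by
            refine mul_le_mul h1 (mul_le_mul_of_nonneg_left h2 (choose_nonneg hs n))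
              (mul_nonneg (choose_nonneg hs n) (by positivity)) zero_le_one
        _ = _ := one_mul _
    · exact (hasSum_one_sub_rpow_neg ((hq k).trans_lt hρ1)).mul_left _
  have e : ∀ k : Fin N → ℝ, Real.cos (pairing z k) * (symbol k + ε) ^ (-s) =
      (2 * N + ε) ^ (-s) *
        (Real.cos (pairing z k) * (1 - c * ∑ j, Real.cos (k j)) ^ (-s)) := fun k => by
    have h1 : symbol k + ε = (2 * N + ε) * (1 - c * ∑ j, Real.cos (k j)) := by
      rw [symbol, hc]
      field_simp
      ring
    have h2 := (abs_le.1 (hq k)).2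
    rw [h1, Real.mul_rpow hd.le (by linarith)]
    ring
  simp only [e]
  rw [integral_const_mul]
  refine mul_nonneg (by positivity) (hsum.nonneg fun n => ?_)
  have e2 : ∀ k : Fin N → ℝ, Real.cos (pairing z k) *
      (Ring.choose (s + n - 1) n * (c * ∑ j, Real.cos (k j)) ^ n) =
      Ring.choose (s + n - 1) n * c ^ n *
        (Real.cos (pairing z k) * (∑ j, Real.cos (k j)) ^ n) := fun k => by
    rw [mul_pow]
    ring
  simp only [e2]
  rw [integral_const_mul]
  exact mul_nonneg (mul_nonneg (choose_nonneg hs n) (by positivity))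
    (integral_cos_pairing_mul_pow_nonneg n z)

/-- The regularization by `ε = 1 / (n + 1)` is removed by dominated convergence, with the
unregularized power of the symbol as majorant. -/
theorem green_nonneg {α : ℝ} (hα : 0 < α) (hαN : α < N) (x y : Fin N → ℤ) :
    0 ≤ green α x y := by
  have hN : N ≠ 0 := by
    rintro rfl
    norm_num at hαN
    linarith
  rw [green_eq_integral_cos hα hαN]
  refine mul_nonneg (div_nonneg (fracDegree_nonneg α) (by positivity)) ?_
  have hlim : Tendsto (fun n : ℕ => ∫ k in torus N, Real.cos (pairing (x - y) k) *
      (symbol k + 1 / ((n : ℝ) + 1)) ^ (-(α / 2))) atTop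
      (𝓝 (∫ k in torus N, Real.cos (pairing (x - y) k) * symbol k ^ (-(α / 2)))) := by
    refine tendsto_integral_of_dominated_convergence _ (fun n => ?_)
      (integrable_symbol_rpow hα hαN) (fun n => ?_) ?_
    · exact ((Real.continuous_cos.comp (continuous_pairing _)).measurable.mul
        ((continuous_symbol.measurable.add_const _).pow_const _)).aestronglyMeasurable
    · filter_upwards [ae_symbol_pos hN] with k hk
      have hn : 0 < 1 / ((n : ℝ) + 1) := by positivity
      rw [norm_mul, Real.norm_of_nonneg (Real.rpow_nonneg (by linarith) _)]
      have h1 : ‖Real.cos (pairing (x - y) k)‖ ≤ 1 := Real.abs_cos_le_one _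
      calc _ ≤ 1 * (symbol k + 1 / ((n : ℝ) + 1)) ^ (-(α / 2)) := by gcongr
        _ ≤ symbol k ^ (-(α / 2)) := by
          rw [one_mul]
          exact Real.rpow_le_rpow_of_nonpos hk (by linarith) (by linarith)
    · filter_upwards [ae_symbol_pos hN] with k hk
      have h1 : Tendsto (fun n : ℕ => symbol k + 1 / ((n : ℝ) + 1)) atTop (𝓝 (symbol k + 0)) :=
        tendsto_one_div_add_atTop_nhds_zero_nat.const_add _
      rw [add_zero] at h1
      exact (h1.rpow_const (Or.inl hk.ne')).const_mul _
  exact ge_of_tendsto' hlim fun n =>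
    integral_cos_pairing_mul_symbol_add_nonneg (by positivity) (by positivity) _

end Choquard

end

/-! ### The embedding into `ℓ^p`, smoothness of the norm, translations -/

noncomputable section

namespace Choquard

variable {N : ℕ}

/-! ### Membership in `H` -/

theorem nbrs_eq_map (x : Fin N → ℤ) : nbrs x = (nbrs 0).map (addLeftEmbedding x) := by
  ext y
  simp only [mem_nbrs, Finset.mem_map, addLeftEmbedding_apply]
  constructor
  · intro hy
    refine ⟨y - x, ?_, by abel⟩
    rw [← hy]
    exact Finset.sum_congr rfl fun i _ => by simp
  · rintro ⟨z, hz, rfl⟩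
    rw [← hz]
    exact Finset.sum_congr rfl fun i _ => by simp

theorem sum_nbrs_eq (g : (Fin N → ℤ) → ℝ) (x : Fin N → ℤ) :
    ∑ y ∈ nbrs x, g y = ∑ z ∈ nbrs 0, g (x + z) := by
  rw [nbrs_eq_map, Finset.sum_map]
  rfl

theorem mem_nbrs_comm (x y : Fin N → ℤ) : y ∈ nbrs x ↔ x ∈ nbrs y := by
  simp only [mem_nbrs, abs_sub_comm]

theorem notMem_nbrs_self (x : Fin N → ℤ) : x ∉ nbrs x := by
  simp [mem_nbrs]

theorem exists_gradNorm_rpow_le (N : ℕ) {p : ℝ} (hp : 1 ≤ p) :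
    ∃ C, 0 ≤ C ∧ ∀ (u : (Fin N → ℤ) → ℝ) x,
      gradNorm u x ^ p ≤ C * (|u x| ^ p + ∑ z ∈ nbrs 0, |u (x + z)| ^ p) := by
  have hp0 : 0 ≤ p := by linarith
  set n : ℕ := (nbrs (0 : Fin N → ℤ)).card with hn
  have h0 : (0 : Fin N → ℤ) ∉ nbrs 0 := notMem_nbrs_self 0
  refine ⟨(n : ℝ) ^ p * ((insert 0 (nbrs (0 : Fin N → ℤ))).card : ℝ) ^ (p - 1), by positivity,
    fun u x => ?_⟩
  set s : ℝ := ∑ z ∈ insert 0 (nbrs 0), |u (x + z)| with hs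
  have hs' : s = |u x| + ∑ y ∈ nbrs x, |u y| := by
    rw [hs, Finset.sum_insert h0, add_zero, sum_nbrs_eq fun y => |u y|]
  have hs0 : 0 ≤ s := by positivity
  have h1 : gradNorm u x ≤ n * s := by
    refine Real.sqrt_le_iff.2 ⟨by positivity, ?_⟩
    have h2 : ∀ y ∈ nbrs x, (u y - u x) * (u y - u x) ≤ s ^ 2 := fun y hy => by
      rw [← sq, ← sq_abs]
      refine pow_le_pow_left₀ (abs_nonneg _) ?_ 2
      have := Finset.single_le_sum (f := fun y => |u y|) (fun i _ => abs_nonneg _) hy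
      rw [hs']
      have := abs_sub (u y) (u x)
      linarith
    have h3 := Finset.sum_le_card_nsmul _ _ _ h2
    have h4 : (nbrs x).card = n := by rw [nbrs_eq_map, Finset.card_map]
    rw [h4, nsmul_eq_mul] at h3
    have h5 : (n : ℝ) ≤ (n : ℝ) ^ 2 := by exact_mod_cast Nat.le_self_pow two_ne_zero n
    have h6 : (n : ℝ) * s ^ 2 ≤ (n : ℝ) ^ 2 * s ^ 2 := by gcongr
    have h7 : 0 ≤ (n : ℝ) * s ^ 2 := by positivity
    rw [gradForm, mul_pow]
    linarith
  have h2 : |u x| ^ p + ∑ z ∈ nbrs 0, |u (x + z)| ^ p =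
      ∑ z ∈ insert 0 (nbrs 0), |u (x + z)| ^ p := by
    rw [Finset.sum_insert h0, add_zero]
  rw [h2, mul_assoc]
  calc gradNorm u x ^ p ≤ (n * s) ^ p := Real.rpow_le_rpow (gradNorm_nonneg _ _) h1 hp0
    _ = (n : ℝ) ^ p * s ^ p := Real.mul_rpow (by positivity) hs0
    _ ≤ _ := by
      gcongr
      exact Real.rpow_sum_le_const_mul_sum_rpow _ _ hp

theorem exists_tsum_gradNorm_le (N : ℕ) {p : ℝ} (hp : 1 ≤ p) :
    ∃ C, 0 ≤ C ∧ ∀ u : (Fin N → ℤ) → ℝ, (Summable fun x => |u x| ^ p) →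
      (Summable fun x => gradNorm u x ^ p) ∧
        ∑' x, gradNorm u x ^ p ≤ C * ∑' x, |u x| ^ p := by
  obtain ⟨C, hC, H⟩ := exists_gradNorm_rpow_le N hp
  refine ⟨C * (1 + (nbrs (0 : Fin N → ℤ)).card), by positivity, fun u hu => ?_⟩
  have hz : ∀ z : Fin N → ℤ, Summable fun x => |u (x + z)| ^ p := fun z =>
    (Equiv.addRight z).summable_iff.2 hu
  have hz' : ∀ z : Fin N → ℤ, ∑' x, |u (x + z)| ^ p = ∑' x, |u x| ^ p := fun z =>
    (Equiv.addRight z).tsum_eq fun x => |u x| ^ p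
  have hs : Summable fun x => ∑ z ∈ nbrs 0, |u (x + z)| ^ p :=
    summable_sum fun z _ => hz z
  have hS : Summable fun x => C * (|u x| ^ p + ∑ z ∈ nbrs 0, |u (x + z)| ^ p) :=
    (hu.add hs).mul_left C
  have h1 : Summable fun x => gradNorm u x ^ p :=
    Summable.of_nonneg_of_le (fun x => Real.rpow_nonneg (gradNorm_nonneg _ _) _) (H u) hS
  refine ⟨h1, (h1.tsum_le_tsum (H u) hS).trans (le_of_eq ?_)⟩
  rw [tsum_mul_left, hu.tsum_add hs, Summable.tsum_finsetSum fun z _ => hz z]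
  simp only [hz', Finset.sum_const, nsmul_eq_mul]
  ring

/-- The gradient is bounded on `ℓ^p`, so truncations to finite sets converge in the `W^{1,p}` norm.
Membership in `H` is thereby reduced to summability of `h |u|^p`, which is easily checked for
translates, indicators and pointwise limits. -/
theorem memW_of_summable {p : ℝ} (hp : 2 ≤ p) {u : (Fin N → ℤ) → ℝ}
    (hu : Summable fun x => |u x| ^ p) : MemW p u := by
  have hp0 : 0 < p := by linarith
  obtain ⟨C, hC, H⟩ := exists_tsum_gradNorm_le N (p := p) (by linarith)
  have dens : ∀ v : (Fin N → ℤ) → ℝ, (Summable fun x => |v x| ^ p) →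
      Summable (density p 1 v) ∧ ∑' x, density p 1 v x ≤ (C + 1) * ∑' x, |v x| ^ p := by
    intro v hv
    have e : density p 1 v = fun x => gradNorm v x ^ p + |v x| ^ p := by
      funext x
      simp [density]
    rw [e]
    refine ⟨(H v hv).1.add hv, ?_⟩
    rw [(H v hv).1.tsum_add hv, add_mul, one_mul]
    exact add_le_add_left (H v hv).2 _
  refine ⟨(dens u hu).1, fun ε hε => ?_⟩
  have hη : 0 < ε ^ p / (2 * (C + 1)) := by positivity
  obtain ⟨s, hs⟩ := ((hu.hasSum.eventually (lt_mem_nhds (sub_lt_self _ hη)))).exists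
  classical
  have e : ∀ x, |(u - (s : Set (Fin N → ℤ)).indicator u) x| ^ p =
      |u x| ^ p - (s : Set (Fin N → ℤ)).indicator (fun x => |u x| ^ p) x := fun x => by
    by_cases hx : x ∈ s <;> simp [hx, Real.zero_rpow hp0.ne']
  have hi : Summable ((s : Set (Fin N → ℤ)).indicator fun x => |u x| ^ p) := hu.indicator _
  have hsum : Summable fun x => |(u - (s : Set (Fin N → ℤ)).indicator u) x| ^ p := by
    simp only [e]
    exact hu.sub hi
  refine ⟨(s : Set (Fin N → ℤ)).indicator u,
    s.finite_toSet.subset Set.support_indicator_subset, (dens _ hsum).1, ?_⟩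
  have h1 := (dens _ hsum).2
  have h2 : ∑' x, |(u - (s : Set (Fin N → ℤ)).indicator u) x| ^ p < ε ^ p / (2 * (C + 1)) := by
    simp only [e]
    rw [hu.tsum_sub hi, ← tsum_subtype, Finset.tsum_subtype' s fun x => |u x| ^ p]
    linarith
  have h3 : ∑' x, density p 1 (u - (s : Set (Fin N → ℤ)).indicator u) x < ε ^ p := by
    calc _ ≤ _ := h1
      _ ≤ (C + 1) * (ε ^ p / (2 * (C + 1))) := by gcongr
      _ = ε ^ p / 2 := by field_simp
      _ < ε ^ p := half_lt_self (by positivity)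
  rw [wnorm, one_div]
  exact (Real.rpow_inv_lt_iff_of_pos
    (tsum_nonneg (density_nonneg (fun _ => zero_le_one) _)) hε.le hp0).2 h3

theorem summable_abs_rpow {p : ℝ} {h u : (Fin N → ℤ) → ℝ} (h₁ : ∃ h₀ > 0, ∀ x, h₀ ≤ h x)
    (hs : Summable fun x => h x * |u x| ^ p) : Summable fun x => |u x| ^ p := by
  obtain ⟨c, hc, hx⟩ := h₁
  refine Summable.of_nonneg_of_le (fun x => by positivity) (fun x => ?_) (hs.mul_left c⁻¹)
  have : 0 ≤ |u x| ^ p := by positivity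
  rw [← mul_assoc]
  refine le_mul_of_one_le_left this ?_
  rw [inv_mul_eq_div, one_le_div hc]
  exact hx x

variable {p : ℝ} {h : (Fin N → ℤ) → ℝ} {hp : 2 ≤ p} {h₁ : ∃ h₀ > 0, ∀ x, h₀ ≤ h x}

namespace HSpace

/-- A function with `∑ h |u|^p < ∞` as an element of `H`. -/
def ofSummable (hp : 2 ≤ p) (h₁ : ∃ h₀ > 0, ∀ x, h₀ ≤ h x) (u : (Fin N → ℤ) → ℝ)
    (hs : Summable fun x => h x * |u x| ^ p) : HSpace p h hp h₁ :=
  ⟨u, memW_of_summable hp (summable_abs_rpow h₁ hs), hs⟩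

@[simp] theorem sub_apply (u v : HSpace p h hp h₁) (x) : (u - v) x = u x - v x := rfl

@[simp] theorem smul_apply (c : ℝ) (u : HSpace p h hp h₁) (x) : (c • u) x = c * u x := rfl

@[simp] theorem zero_apply (x) : (0 : HSpace p h hp h₁) x = 0 := rfl

theorem coe_sub (u v : HSpace p h hp h₁) :
    ((u - v : HSpace p h hp h₁) : (Fin N → ℤ) → ℝ) = (u : (Fin N → ℤ) → ℝ) - v := rfl

theorem norm_rpow (u : HSpace p h hp h₁) : ‖u‖ ^ p = ∑' x, density p h u x := by
  rw [norm_def, ← Real.rpow_mul, one_div_mul_cancel (by linarith), Real.rpow_one]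
  · rfl
  · exact tsum_nonneg (density_nonneg (potential_nonneg h₁) u)

theorem summable_grad (u : HSpace p h hp h₁) : Summable fun x => gradNorm u x ^ p :=
  summable_gradNorm u.2.1

theorem summable_pot (u : HSpace p h hp h₁) : Summable fun x => h x * |u x| ^ p := u.2.2

theorem summable_rpow (u : HSpace p h hp h₁) : Summable fun x => |u x| ^ p :=
  summable_abs_rpow h₁ u.2.2

theorem sum_grad_le (u : HSpace p h hp h₁) (s : Finset (Fin N → ℤ)) :
    ∑ x ∈ s, gradNorm u x ^ p ≤ ‖u‖ ^ p := by
  rw [norm_rpow]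
  refine le_trans (Finset.sum_le_sum fun x _ => ?_)
    (u.summable.sum_le_tsum s fun x _ => density_nonneg (potential_nonneg h₁) u x)
  exact le_add_of_nonneg_right
    (mul_nonneg (potential_nonneg h₁ x) (Real.rpow_nonneg (abs_nonneg _) _))

theorem sum_pot_le (u : HSpace p h hp h₁) (s : Finset (Fin N → ℤ)) :
    ∑ x ∈ s, h x * |u x| ^ p ≤ ‖u‖ ^ p := by
  rw [norm_rpow]
  refine le_trans (Finset.sum_le_sum fun x _ => ?_)
    (u.summable.sum_le_tsum s fun x _ => density_nonneg (potential_nonneg h₁) u x)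
  exact le_add_of_nonneg_left (Real.rpow_nonneg (gradNorm_nonneg _ _) _)

/-- The constant of the embedding of `H` into `ℓ^p`. -/
theorem exists_sum_rpow_le (hp : 2 ≤ p) (h₁ : ∃ h₀ > 0, ∀ x, h₀ ≤ h x) :
    ∃ B, 0 ≤ B ∧ ∀ (u : HSpace p h hp h₁) (s : Finset (Fin N → ℤ)),
      ∑ x ∈ s, |u x| ^ p ≤ (B * ‖u‖) ^ p := by
  have hp0 : p ≠ 0 := by linarith
  obtain ⟨c, hc, hx⟩ := id h₁
  refine ⟨c⁻¹ ^ (1 / p), by positivity, fun u s => ?_⟩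
  rw [Real.mul_rpow (by positivity) (norm_nonneg _), ← Real.rpow_mul (by positivity),
    one_div_mul_cancel hp0, Real.rpow_one, inv_mul_eq_div, le_div_iff₀ hc, Finset.sum_mul]
  refine le_trans (Finset.sum_le_sum fun x _ => ?_) (u.sum_pot_le s)
  rw [mul_comm]
  have : 0 ≤ |u x| ^ p := by positivity
  exact mul_le_mul_of_nonneg_right (hx x) this

/-- Point evaluation on `H`. -/
theorem exists_evalCLM (hp : 2 ≤ p) (h₁ : ∃ h₀ > 0, ∀ x, h₀ ≤ h x) (x : Fin N → ℤ) :
    ∃ L : HSpace p h hp h₁ →L[ℝ] ℝ, ∀ u, L u = u x := by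
  have hp0 : 0 < p := by linarith
  obtain ⟨B, hB, H⟩ := exists_sum_rpow_le hp h₁
  let l : HSpace p h hp h₁ →ₗ[ℝ] ℝ :=
    { toFun := fun u => u x, map_add' := fun u v => rfl, map_smul' := fun c u => rfl }
  refine ⟨l.mkContinuous B fun u => ?_, fun u => rfl⟩
  have := H u {x}
  rw [Finset.sum_singleton] at this
  exact (Real.rpow_le_rpow_iff (abs_nonneg _) (by positivity) hp0).1 this

/-- Point evaluation on `H` as a continuous linear form. -/
def eval (hp : 2 ≤ p) (h₁ : ∃ h₀ > 0, ∀ x, h₀ ≤ h x) (x : Fin N → ℤ) :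
    HSpace p h hp h₁ →L[ℝ] ℝ := (exists_evalCLM hp h₁ x).choose

@[simp] theorem eval_apply (x : Fin N → ℤ) (u : HSpace p h hp h₁) : eval hp h₁ x u = u x :=
  (exists_evalCLM hp h₁ x).choose_spec u

/-- The gradient at `x` as a vector indexed by the neighbours of `x`. -/
def gradCLM (hp : 2 ≤ p) (h₁ : ∃ h₀ > 0, ∀ x, h₀ ≤ h x) (x : Fin N → ℤ) :
    HSpace p h hp h₁ →L[ℝ] EuclideanSpace ℝ (nbrs x) :=
  ((EuclideanSpace.equiv (nbrs x) ℝ).symm : (nbrs x → ℝ) →L[ℝ] EuclideanSpace ℝ (nbrs x)).comp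
    (ContinuousLinearMap.pi fun y => √(1 / 2) • (eval hp h₁ (y : Fin N → ℤ) - eval hp h₁ x))

theorem gradCLM_apply (x : Fin N → ℤ) (u : HSpace p h hp h₁) (y : nbrs x) :
    gradCLM hp h₁ x u y = √(1 / 2) * (u y - u x) := by
  simp [gradCLM]

/-- The factor `√(1 / 2)` in `gradCLM` is chosen for this identity. It turns `|∇u|(x) ^ p` into the
`p`-th power of the norm of a linear map into a Hilbert space, whose derivative is known. -/
theorem inner_gradCLM (x : Fin N → ℤ) (u v : HSpace p h hp h₁) :
    inner ℝ (gradCLM hp h₁ x u) (gradCLM hp h₁ x v) = gradForm u v x := by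
  rw [PiLp.inner_apply, gradForm, ← Finset.sum_coe_sort (nbrs x), Finset.mul_sum]
  refine Finset.sum_congr rfl fun y _ => ?_
  rw [gradCLM_apply, gradCLM_apply]
  have : √(1 / 2 : ℝ) * √(1 / 2 : ℝ) = 1 / 2 := Real.mul_self_sqrt (by norm_num)
  simp only [RCLike.inner_apply, conj_trivial]
  linear_combination ((u y - u x) * (v y - v x)) * this

theorem norm_gradCLM (x : Fin N → ℤ) (u : HSpace p h hp h₁) :
    ‖gradCLM hp h₁ x u‖ = gradNorm u x := by
  rw [gradNorm, ← inner_gradCLM, norm_eq_sqrt_real_inner]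

/-- `‖u‖^p` is `C^1` on `H`. -/
theorem exists_hasFDerivAt_norm_rpow (hp : 2 ≤ p) (h₁ : ∃ h₀ > 0, ∀ x, h₀ ≤ h x) :
    ∃ D : HSpace p h hp h₁ → HSpace p h hp h₁ →L[ℝ] ℝ, Continuous D ∧
      ∀ u, HasFDerivAt (fun u : HSpace p h hp h₁ => ‖u‖ ^ p) (D u) u ∧
        ∀ v : HSpace p h hp h₁, HasSum (fun x => p * (gradNorm u x ^ (p - 2) * gradForm u v x) +
          p * (h x * |u x| ^ (p - 2) * u x * v x)) (D u v) := by
  have hp1 : 1 < p := by linarith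
  have hp0 : 0 < p := by linarith
  have cont : ∀ {E : Type} [NormedAddCommGroup E] [InnerProductSpace ℝ E],
      Continuous fun v : E => (p * ‖v‖ ^ (p - 2)) • innerSL ℝ v := fun {E} _ _ =>
    (continuous_const.mul (continuous_norm.rpow_const fun _ => Or.inr (by linarith))).smul
      (innerSL ℝ).continuous
  have bound : ∀ {E : Type} [NormedAddCommGroup E] [InnerProductSpace ℝ E] (v : E),
      ‖‖v‖ ^ p‖ ≤ p * ‖v‖ ^ p ∧ ‖(p * ‖v‖ ^ (p - 2)) • innerSL ℝ v‖ ≤ p * ‖v‖ ^ (p - 1) := by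
    intro E _ _ v
    constructor
    · rw [Real.norm_of_nonneg (by positivity)]
      exact le_mul_of_one_le_left (by positivity) hp1.le
    · rw [norm_smul, innerSL_apply_norm, Real.norm_of_nonneg (by positivity), mul_assoc]
      refine mul_le_mul_of_nonneg_left (le_of_eq ?_) hp0.le
      rw [show p - 1 = p - 2 + 1 by ring, Real.rpow_add_one' (norm_nonneg _) (by linarith)]
  obtain ⟨D₁, hD₁, H₁⟩ := exists_hasFDerivAt_tsum_comp (X := HSpace p h hp h₁) (W := ℝ) hp1
    zero_le_one (L := gradCLM hp h₁)
    (fun u s => by simpa only [norm_gradCLM, one_mul] using u.sum_grad_le s)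
    (g := fun _ v => ‖v‖ ^ p) (g' := fun _ v => (p * ‖v‖ ^ (p - 2)) • innerSL ℝ v)
    (fun _ v => hasFDerivAt_norm_rpow v hp1) (fun _ => cont)
    (fun M => ⟨p, hp0.le, fun _ v _ => bound v⟩)
  -- The weight is absorbed into the linear form, so the potential term is also a sum of `p`-th
  -- powers of norms.
  have hL : ∀ x (u : HSpace p h hp h₁),
      ‖(h x ^ (1 / p) • eval hp h₁ x) u‖ ^ p = h x * |u x| ^ p := fun x u => by
    have hx := potential_nonneg h₁ x
    rw [FunLike.coe_smul, Pi.smul_apply, eval_apply, norm_smul,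
      Real.norm_of_nonneg (by positivity), Real.mul_rpow (by positivity) (norm_nonneg _),
      ← Real.rpow_mul hx, one_div_mul_cancel hp0.ne', Real.rpow_one, Real.norm_eq_abs]
  obtain ⟨D₂, hD₂, H₂⟩ := exists_hasFDerivAt_tsum_comp (X := HSpace p h hp h₁) (W := ℝ) hp1
    zero_le_one (V := fun _ : Fin N → ℤ => ℝ) (L := fun x => h x ^ (1 / p) • eval hp h₁ x)
    (fun u s => by simpa only [hL, one_mul] using u.sum_pot_le s)
    (g := fun _ v => ‖v‖ ^ p) (g' := fun _ v => (p * ‖v‖ ^ (p - 2)) • innerSL ℝ v)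
    (fun _ v => hasFDerivAt_norm_rpow v hp1) (fun _ => cont)
    (fun M => ⟨p, hp0.le, fun _ v _ => bound v⟩)
  refine ⟨fun u => D₁ u + D₂ u, hD₁.add hD₂, fun u => ⟨?_, fun v => ?_⟩⟩
  · refine ((H₁ u).1.add (H₂ u).1).congr_of_eventuallyEq (Eventually.of_forall fun w => ?_)
    simp only [Pi.add_apply, hL, norm_gradCLM]
    rw [norm_rpow, ← w.summable_grad.tsum_add w.summable_pot]
    rfl
  · refine Eq.mpr (congrArg (fun F => HasSum F (D₁ u v + D₂ u v)) (funext fun x => ?_))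
      (((H₁ u).2 v).add ((H₂ u).2 v))
    have hx := potential_nonneg h₁ x
    -- The inner product contributes two factors `h x ^ (1 / p)` and the power of the norm another
    -- `p - 2`: together `h x`.
    have e1 : h x ^ (1 / p) * h x ^ (1 / p) * (h x ^ (1 / p)) ^ (p - 2) = h x := by
      rw [← Real.rpow_mul hx, ← Real.rpow_add' hx (by positivity),
        ← Real.rpow_add' hx (by
          rw [show 1 / p + 1 / p + 1 / p * (p - 2) = 1 by field_simp; ring]
          exact one_ne_zero)]
      convert Real.rpow_one (h x) using 2
      field_simp
      ring
    simp only [FunLike.coe_smul, Pi.smul_apply, innerSL_apply_apply, inner_gradCLM, norm_gradCLM,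
      eval_apply, smul_eq_mul, RCLike.inner_apply, conj_trivial, Real.norm_eq_abs]
    rw [abs_mul, abs_of_nonneg (by positivity : 0 ≤ h x ^ (1 / p)),
      Real.mul_rpow (by positivity) (abs_nonneg _)]
    linear_combination -(p * |u x| ^ (p - 2) * u x * v x) * e1

variable (hp h₁) in
/-- The indicator function of a point as an element of `H`. -/
def single (x : Fin N → ℤ) : HSpace p h hp h₁ :=
  ofSummable hp h₁ (Pi.single x 1) <| summable_of_ne_finset_zero (s := {x}) fun y hy => by
    have hp0 : p ≠ 0 := by linarith
    simp [Pi.single_eq_of_ne (Finset.notMem_singleton.1 hy), Real.zero_rpow hp0]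

theorem single_apply (x y : Fin N → ℤ) :
    (single hp h₁ x : HSpace p h hp h₁) y = (Pi.single x 1 : (Fin N → ℤ) → ℝ) y := rfl

theorem single_self (x : Fin N → ℤ) : (single hp h₁ x : HSpace p h hp h₁) x = 1 := by simp [single_apply]

theorem single_of_ne {x y : Fin N → ℤ} (hy : y ≠ x) :
    (single hp h₁ x : HSpace p h hp h₁) y = 0 := by
  simp [single_apply, hy]

/-- Translation by a period of `h`. -/
def shift (z : Fin N → ℤ) (hz : ∀ x, h (x + z) = h x) (u : HSpace p h hp h₁) :
    HSpace p h hp h₁ :=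
  ofSummable hp h₁ (fun x => u (x + z)) <| by
    have := (Equiv.addRight z).summable_iff.2 u.summable_pot
    simpa only [Function.comp_def, Equiv.coe_addRight, hz] using this

@[simp] theorem shift_apply (z : Fin N → ℤ) (hz : ∀ x, h (x + z) = h x) (u : HSpace p h hp h₁)
    (x : Fin N → ℤ) : shift z hz u x = u (x + z) := rfl

theorem density_shift (z : Fin N → ℤ) (hz : ∀ x, h (x + z) = h x) (u : HSpace p h hp h₁)
    (x : Fin N → ℤ) : density p h (shift z hz u) x = density p h u (x + z) := by
  have : gradNorm (shift z hz u) x = gradNorm u (x + z) := by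
    rw [gradNorm, gradNorm, gradForm, gradForm, sum_nbrs_eq, sum_nbrs_eq _ (x + z)]
    simp only [shift_apply, add_right_comm x _ z]
  rw [density, density, this, hz, shift_apply]

theorem norm_shift (z : Fin N → ℤ) (hz : ∀ x, h (x + z) = h x) (u : HSpace p h hp h₁) :
    ‖shift z hz u‖ = ‖u‖ := by
  change wnorm p h _ = wnorm p h _
  rw [wnorm, wnorm]
  congr 1
  simp only [density_shift]
  exact (Equiv.addRight z).tsum_eq (density p h u)

end HSpace

/-- Summation by parts against the indicator of `x`: only `x` and its neighbours contribute. The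
term at `x` carries the weight `gradNorm u x ^ (p - 2)`, and the term at a neighbour `y` the weight
`gradNorm u y ^ (p - 2)`; together they form the symmetrized weight of the `p`-Laplacian. -/
theorem hasSum_gradForm_single (u : (Fin N → ℤ) → ℝ) (x : Fin N → ℤ) :
    HasSum (fun y => gradNorm u y ^ (p - 2) * gradForm u (Pi.single x 1) y)
      (-pLaplacian p u x) := by
  have e0 : gradForm u (Pi.single x 1) x = -(1 / 2) * ∑ z ∈ nbrs x, (u z - u x) := by
    rw [gradForm, neg_mul, ← mul_neg, ← Finset.sum_neg_distrib]
    congr 1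
    refine Finset.sum_congr rfl fun z hz => ?_
    have : z ≠ x := fun h => notMem_nbrs_self x (h ▸ hz)
    simp [this]
  have e1 : ∀ y, y ≠ x → gradForm u (Pi.single x 1) y =
      if y ∈ nbrs x then 1 / 2 * (u x - u y) else 0 := fun y hy => by
    have e2 : ∑ z ∈ nbrs y, (u z - u y) * ((Pi.single x 1 : (Fin N → ℤ) → ℝ) z -
        (Pi.single x 1 : (Fin N → ℤ) → ℝ) y) = if x ∈ nbrs y then u x - u y else 0 := by
      simp [Pi.single_apply, hy]
    rw [gradForm, e2]
    simp only [mem_nbrs_comm x y]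
    split_ifs <;> simp
  have hs := hasSum_sum_of_ne_finset_zero (s := insert x (nbrs x))
    (L := SummationFilter.unconditional _)
    (f := fun y => gradNorm u y ^ (p - 2) * gradForm u (Pi.single x 1) y) fun y hy => by
      rw [Finset.mem_insert, not_or] at hy
      simp [e1 y hy.1, hy.2]
  convert hs using 1
  rw [Finset.sum_insert (notMem_nbrs_self x), e0, pLaplacian]
  have e3 : ∑ y ∈ nbrs x, gradNorm u y ^ (p - 2) * gradForm u (Pi.single x 1) y =
      ∑ y ∈ nbrs x, gradNorm u y ^ (p - 2) * (1 / 2 * (u x - u y)) :=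
    Finset.sum_congr rfl fun y hy => by
      have : y ≠ x := fun h => notMem_nbrs_self x (h ▸ hy)
      rw [e1 y this, if_pos hy]
  rw [e3, Finset.mul_sum, Finset.mul_sum, Finset.mul_sum, ← Finset.sum_add_distrib,
    ← Finset.sum_neg_distrib]
  refine Finset.sum_congr rfl fun y _ => ?_
  ring

end Choquard

end

/-! ### The nonlocal term as an inner product, and its splitting -/

noncomputable section

namespace Choquard

variable {N : ℕ}

/-! ### The nonlinearity -/

/-- The hypothesis lives on a punctured neighbourhood; the value at the origin is recovered from
continuity, as the limit of `f` there is `0`. -/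
theorem isSmallPow_of_isLittleO {q : ℝ} (hq : 0 < q) {f : ℝ → ℝ} (hf : Continuous f)
    (ho : f =o[𝓝[≠] 0] fun t => |t| ^ q) : IsSmallPow q f := by
  have key : ∀ ε > 0, ∃ δ > 0, ∀ t, t ≠ 0 → |t| < δ → |f t| ≤ ε * |t| ^ q := fun ε hε => by
    have := ho.def hε
    rw [eventually_nhdsWithin_iff, Metric.eventually_nhds_iff] at this
    obtain ⟨δ, hδ, H⟩ := this
    refine ⟨δ, hδ, fun t ht htδ => ?_⟩
    have h1 := H (y := t) (by simpa using htδ) ht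
    rwa [Real.norm_eq_abs, Real.norm_of_nonneg (by positivity)] at h1
  have h0 : f 0 = 0 := by
    have hg : Tendsto (fun t : ℝ => |t| ^ q) (𝓝[≠] 0) (𝓝 0) := by
      have : Continuous fun t : ℝ => |t| ^ q := continuous_abs.rpow_const fun _ => Or.inr hq.le
      have h := this.tendsto 0
      rw [abs_zero, Real.zero_rpow hq.ne'] at h
      exact h.mono_left nhdsWithin_le_nhds
    exact tendsto_nhds_unique ((hf.tendsto 0).mono_left nhdsWithin_le_nhds)
      (ho.isBigO.trans_tendsto hg)
  refine ⟨hf, fun ε hε => ?_⟩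
  obtain ⟨δ, hδ, H⟩ := key ε hε
  refine ⟨δ / 2, half_pos hδ, fun t ht => ?_⟩
  rcases eq_or_ne t 0 with rfl | h
  · simp only [h0, abs_zero]
    positivity
  · exact H t h (by linarith)

theorem hasDerivAt_primitive {f : ℝ → ℝ} (hf : Continuous f) (t : ℝ) :
    HasDerivAt (primitive f) (f t) t :=
  intervalIntegral.integral_hasDerivAt_right (hf.intervalIntegrable _ _)
    (hf.stronglyMeasurableAtFilter _ _) hf.continuousAt

theorem IsSmallPow.mul_id {p : ℝ} (hp : 1 < p) {f : ℝ → ℝ} (hf : IsSmallPow (p - 1) f) :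
    IsSmallPow p fun t => f t * t := by
  refine ⟨hf.cont.mul continuous_id, fun ε hε => ?_⟩
  obtain ⟨δ, hδ, H⟩ := hf.small ε hε
  refine ⟨δ, hδ, fun t ht => ?_⟩
  have e : |t| ^ p = |t| ^ (p - 1) * |t| := by
    rw [← Real.rpow_add_one' (abs_nonneg _) (by linarith), sub_add_cancel]
  rw [abs_mul, e, ← mul_assoc]
  exact mul_le_mul_of_nonneg_right (H t ht) (abs_nonneg _)

theorem IsSmallPow.primitive {p : ℝ} (hp : 1 < p) {f : ℝ → ℝ} (hf : IsSmallPow (p - 1) f) :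
    IsSmallPow p (primitive f) := by
  refine ⟨continuous_iff_continuousAt.2 fun t => (hasDerivAt_primitive hf.cont t).continuousAt,
    fun ε hε => ?_⟩
  obtain ⟨δ, hδ, H⟩ := hf.small ε hε
  refine ⟨δ, hδ, fun t ht => ?_⟩
  have e : |t| ^ p = |t| ^ (p - 1) * |t| := by
    rw [← Real.rpow_add_one' (abs_nonneg _) (by linarith), sub_add_cancel]
  have := intervalIntegral.norm_integral_le_of_norm_le_const (f := f) (a := 0) (b := t)
    (C := ε * |t| ^ (p - 1)) fun s hs => by
      have hst : |s| ≤ |t| := by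
        rw [Set.mem_uIoc] at hs
        rcases hs with hs | hs
        · rw [abs_of_pos hs.1, abs_of_pos (hs.1.trans_le hs.2)]
          exact hs.2
        · rw [abs_of_nonpos hs.2, abs_of_neg (hs.1.trans_le hs.2)]
          linarith [hs.1]
      refine (H s (hst.trans ht)).trans ?_
      have : 0 ≤ p - 1 := by linarith
      gcongr
  rw [sub_zero, mul_assoc, ← e] at this
  exact this

/-! ### Superposition operators with values in a Hilbert space -/

variable {p : ℝ} {h : (Fin N → ℤ) → ℝ} {hp : 2 ≤ p} {h₁ : ∃ h₀ > 0, ∀ x, h₀ ≤ h x}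
  {V : Type*} [NormedAddCommGroup V] [InnerProductSpace ℝ V] {α : ℝ} {e : (Fin N → ℤ) → V}

/-- `∑ k(u(x)) e(x)`. -/
def superpos (e : (Fin N → ℤ) → V) (k : ℝ → ℝ) (u : (Fin N → ℤ) → ℝ) : V := ∑' x, k (u x) • e x

/-- Translation invariance makes the diagonal of the Green's function constant. -/
theorem norm_gram (he : ∀ x y, inner ℝ (e x) (e y) = green α x y) (x : Fin N → ℤ) :
    ‖e x‖ = ‖e 0‖ := by
  rw [norm_eq_sqrt_real_inner, norm_eq_sqrt_real_inner (e 0), he, he, ← green_add_add α 0 0 x,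
    zero_add]

/-- On a ball of `H`, functions `o(|t|^p)` act boundedly into `ℓ^1`. -/
theorem exists_tsum_abs_le (hp : 2 ≤ p) (h₁ : ∃ h₀ > 0, ∀ x, h₀ ≤ h x) {k : ℝ → ℝ}
    (hk : IsSmallPow p k) (M : ℝ) : ∃ C, 0 ≤ C ∧ ∀ u : HSpace p h hp h₁, ‖u‖ ≤ M →
      (Summable fun x => |k (u x)|) ∧ ∑' x, |k (u x)| ≤ C := by
  have hp0 : 0 < p := by linarith
  obtain ⟨B, hB, H⟩ := HSpace.exists_sum_rpow_le hp h₁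
  obtain ⟨C, hC, hkC⟩ := hk.exists_abs_le hp0.le (B * |M|)
  refine ⟨C * (B * |M|) ^ p, by positivity, fun u hu => ?_⟩
  have huM : B * ‖u‖ ≤ B * |M| := by gcongr; exact hu.trans (le_abs_self M)
  have hle : ∀ x, |k (u x)| ≤ C * |u x| ^ p := fun x => by
    refine hkC _ (le_trans ?_ huM)
    have := H u {x}
    rw [Finset.sum_singleton] at this
    exact (Real.rpow_le_rpow_iff (abs_nonneg _) (by positivity) hp0).1 this
  have hs : Summable fun x => |k (u x)| :=
    Summable.of_nonneg_of_le (fun _ => abs_nonneg _) hle (u.summable_rpow.mul_left C)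
  refine ⟨hs, (hs.tsum_le_tsum hle (u.summable_rpow.mul_left C)).trans ?_⟩
  rw [tsum_mul_left]
  gcongr
  refine (u.summable_rpow.tsum_le_of_sum_le fun s => ?_)
  exact (H u s).trans (by gcongr)

theorem summable_abs_comp {k : ℝ → ℝ} (hk : IsSmallPow p k) (u : HSpace p h hp h₁) :
    Summable fun x => |k (u x)| := by
  obtain ⟨C, -, H⟩ := exists_tsum_abs_le hp h₁ hk ‖u‖
  exact (H u le_rfl).1

theorem norm_tsum_smul_gram_le (he : ∀ x y, inner ℝ (e x) (e y) = green α x y)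
    {a : (Fin N → ℤ) → ℝ} (ha : Summable fun x => |a x|) :
    ‖∑' x, a x • e x‖ ≤ (∑' x, |a x|) * ‖e 0‖ := by
  have hn : ∀ x, ‖a x • e x‖ = |a x| * ‖e 0‖ := fun x => by
    rw [norm_smul, norm_gram he, Real.norm_eq_abs]
  rw [← tsum_mul_right]
  simp only [← hn]
  refine norm_tsum_le_tsum_norm ?_
  simpa only [hn] using ha.mul_right ‖e 0‖

theorem exists_norm_superpos_le (he : ∀ x y, inner ℝ (e x) (e y) = green α x y) {k : ℝ → ℝ}
    (hk : IsSmallPow p k) (hp : 2 ≤ p) (h₁ : ∃ h₀ > 0, ∀ x, h₀ ≤ h x) (M : ℝ) :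
    ∃ C, 0 ≤ C ∧ ∀ u : HSpace p h hp h₁, ‖u‖ ≤ M → ‖superpos e k u‖ ≤ C := by
  obtain ⟨C, hC, H⟩ := exists_tsum_abs_le hp h₁ hk M
  refine ⟨C * ‖e 0‖, by positivity, fun u hu => ?_⟩
  refine (norm_tsum_smul_gram_le he (H u hu).1).trans ?_
  gcongr
  exact (H u hu).2

theorem exists_bounds (hp : 2 ≤ p) (h₁ : ∃ h₀ > 0, ∀ x, h₀ ≤ h x) (M : ℝ) :
    ∃ K, 0 ≤ K ∧ ∀ u : HSpace p h hp h₁, ‖u‖ ≤ M →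
      (∀ x, |u x| ≤ K) ∧ ∑' x, |u x| ^ p ≤ K := by
  have hp0 : 0 < p := by linarith
  obtain ⟨B, hB, hsum⟩ := HSpace.exists_sum_rpow_le hp h₁
  refine ⟨max (B * |M|) ((B * |M|) ^ p), by positivity, fun u hu => ?_⟩
  have huM : B * ‖u‖ ≤ B * |M| := by gcongr; exact hu.trans (le_abs_self M)
  refine ⟨fun x => ?_, ?_⟩
  · have := hsum u {x}
    rw [Finset.sum_singleton] at this
    exact ((Real.rpow_le_rpow_iff (abs_nonneg _) (by positivity) hp0).1 this).trans
      (huM.trans (le_max_left _ _))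
  · refine le_trans ?_ (le_max_right _ _)
    exact u.summable_rpow.tsum_le_of_sum_le fun s => (hsum u s).trans (by gcongr)

/-- By decay, the kernel is at most `ε` outside a finite set, where the `ℓ^1` norms of `k (u n)` are
bounded; on the finite set pointwise convergence suffices. -/
theorem tendsto_greenConv_zero (hα : 0 < α) (hαN : α < N)
    (he : ∀ x y, inner ℝ (e x) (e y) = green α x y) {k : ℝ → ℝ}
    (hk : IsSmallPow p k) {u : ℕ → HSpace p h hp h₁} {M : ℝ}
    (hu : ∀ n, ‖u n‖ ≤ M) (hlim : ∀ x, Tendsto (fun n => u n x) atTop (𝓝 0)) (y : Fin N → ℤ) :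
    Tendsto (fun n => greenConv α (fun x => k (u n x)) y) atTop (𝓝 0) := by
  have hp0 : 0 < p := by linarith
  obtain ⟨C, hC, HC⟩ := exists_tsum_abs_le hp h₁ hk M
  obtain ⟨K, hK, HK⟩ := exists_bounds hp h₁ M
  obtain ⟨C', hC', HC'⟩ := hk.exists_abs_le hp0.le K
  have hR : ∀ x, |green α y x| ≤ ‖e 0‖ * ‖e 0‖ := fun x => by
    rw [← he]
    refine (abs_real_inner_le_norm _ _).trans (le_of_eq ?_)
    rw [norm_gram he, norm_gram he x]
  have hsymm : ∀ x, green α y x = green α x y := fun x => by rw [← he, real_inner_comm, he]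
  have hd : Tendsto (fun n => ∑' x, |green α y x * k (u n x)|) atTop (𝓝 0) := by
    refine tendsto_tsum_zero_of_almost_dominated (m := fun n x => |k (u n x)|) (M := C)
      (fun n x => abs_nonneg _) (fun x => ?_) (fun n => (HC _ (hu n)).1)
      (fun n => (HC _ (hu n)).2) (fun n x => abs_nonneg _) (fun ε hε => ?_)
    · have h1 : Tendsto (fun n => green α y x * k (u n x)) atTop (𝓝 (green α y x * k 0)) :=
        ((hk.cont.tendsto _).comp (hlim x)).const_mul _
      rw [hk.apply_zero hp0, mul_zero] at h1
      simpa using h1.abs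
    · have hfin : {x | ¬ |green α x y| ≤ ε}.Finite := by
        have := (tendsto_green_cofinite hα hαN y).abs
        rw [abs_zero] at this
        exact this.eventually_le_const hε
      classical
      refine ⟨fun x => if x ∈ hfin.toFinset then ‖e 0‖ * ‖e 0‖ * (C' * K ^ p) else 0,
        summable_of_ne_finset_zero (s := hfin.toFinset) fun x hx => if_neg hx, fun n x => ?_⟩
      rw [abs_mul]
      beta_reduce
      split_ifs with hx
      · have h1 : |k (u n x)| ≤ C' * K ^ p := by
          refine (HC' _ ((HK _ (hu n)).1 x)).trans ?_
          gcongr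
          exact (HK _ (hu n)).1 x
        refine le_trans ?_ (le_add_of_nonneg_left (by positivity))
        exact mul_le_mul (hR x) h1 (abs_nonneg _) (by positivity)
      · rw [Set.Finite.mem_toFinset, Set.mem_ofPred_eq, not_not] at hx
        rw [add_zero, hsymm]
        gcongr
  refine squeeze_zero_norm (fun n => ?_) hd
  refine norm_tsum_le_tsum_norm (f := fun x => green α y x * k (u n x)) ?_
  refine Summable.of_nonneg_of_le (fun _ => norm_nonneg _) (fun x => ?_)
    ((HC _ (hu n)).1.mul_left (‖e 0‖ * ‖e 0‖))
  rw [norm_mul, Real.norm_eq_abs, Real.norm_eq_abs]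
  gcongr
  exact hR x

section Complete

variable [CompleteSpace V]

theorem summable_smul_gram (he : ∀ x y, inner ℝ (e x) (e y) = green α x y)
    {a : (Fin N → ℤ) → ℝ} (ha : Summable fun x => |a x|) : Summable fun x => a x • e x :=
  Summable.of_norm_bounded (ha.mul_right ‖e 0‖) fun x => by
    rw [norm_smul, norm_gram he, Real.norm_eq_abs]

theorem inner_gram_superpos (he : ∀ x y, inner ℝ (e x) (e y) = green α x y) {k : ℝ → ℝ}
    (hk : IsSmallPow p k) (u : HSpace p h hp h₁) (x : Fin N → ℤ) :
    inner ℝ (e x) (superpos e k u) = greenConv α (fun y => k (u y)) x := by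
  have := (innerSL ℝ (e x)).hasSum (summable_smul_gram he (summable_abs_comp hk u)).hasSum
  have h2 := this.tsum_eq
  simp only [innerSL_apply_apply, inner_smul_right, he] at h2
  rw [superpos, ← h2, greenConv]
  exact tsum_congr fun y => mul_comm _ _

/-- This is the purpose of the Gram representation: the double sum over the kernel becomes an inner
product, and Cauchy–Schwarz takes the place of convolution inequalities. -/
theorem hasSum_inner_superpos (he : ∀ x y, inner ℝ (e x) (e y) = green α x y) {j k : ℝ → ℝ}
    (hj : IsSmallPow p j) (hk : IsSmallPow p k) (u v : HSpace p h hp h₁) :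
    HasSum (fun x => greenConv α (fun y => j (u y)) x * k (v x))
      (inner ℝ (superpos e j u) (superpos e k v)) := by
  have := (innerSL ℝ (superpos e j u)).hasSum
    (summable_smul_gram he (summable_abs_comp hk v)).hasSum
  simp only [innerSL_apply_apply, inner_smul_right, real_inner_comm,
    inner_gram_superpos he hj] at this
  refine Eq.mpr (congrArg (fun F => HasSum F _) (funext fun x => mul_comm _ _)) this

/-- The superposition operator of a primitive is `C^1`. -/
theorem exists_hasFDerivAt_superpos (he : ∀ x y, inner ℝ (e x) (e y) = green α x y) {f : ℝ → ℝ}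
    (hf : IsSmallPow (p - 1) f) (hp : 2 ≤ p) (h₁ : ∃ h₀ > 0, ∀ x, h₀ ≤ h x) :
    ∃ D : HSpace p h hp h₁ → HSpace p h hp h₁ →L[ℝ] V, Continuous D ∧
      ∀ u, HasFDerivAt (fun u : HSpace p h hp h₁ => superpos e (primitive f) u) (D u) u ∧
        ∀ v : HSpace p h hp h₁, HasSum (fun x => (f (u x) * v x) • e x) (D u v) := by
  have hp1 : 1 < p := by linarith
  obtain ⟨B, hB, hsum⟩ := HSpace.exists_sum_rpow_le hp h₁
  obtain ⟨D, hD, H⟩ := exists_hasFDerivAt_tsum_comp (X := HSpace p h hp h₁) (W := V) hp1 hB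
    (V := fun _ : Fin N → ℤ => ℝ) (L := fun x => HSpace.eval hp h₁ x)
    (fun u s => by simpa only [HSpace.eval_apply, Real.norm_eq_abs] using hsum u s)
    (g := fun x t => primitive f t • e x)
    (g' := fun x t => f t • ContinuousLinearMap.toSpanSingleton ℝ (e x))
    (fun x t => by
      have := ((hasDerivAt_primitive hf.cont t).smul_const (e x)).hasFDerivAt
      have e1 : ContinuousLinearMap.toSpanSingleton ℝ (f t • e x) =
          f t • ContinuousLinearMap.toSpanSingleton ℝ (e x) := by
        ext
        simp
      rw [e1] at this
      exact this)
    (fun x => hf.cont.smul continuous_const)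
    (fun M => by
      obtain ⟨C₁, hC₁, H₁⟩ := hf.exists_abs_le (by linarith) M
      obtain ⟨C₂, hC₂, H₂⟩ := (hf.primitive hp1).exists_abs_le (by linarith) M
      refine ⟨max C₁ C₂ * ‖e 0‖, by positivity, fun x t ht => ⟨?_, ?_⟩⟩
      · rw [norm_smul, norm_gram he, mul_right_comm]
        gcongr
        refine (H₂ t ht).trans ?_
        gcongr
        exacts [le_max_right _ _, le_rfl]
      · rw [norm_smul, ContinuousLinearMap.norm_toSpanSingleton, norm_gram he, mul_right_comm]
        gcongr
        refine (H₁ t ht).trans ?_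
        gcongr
        exacts [le_max_left _ _, le_rfl])
  refine ⟨D, hD, fun u => ⟨?_, fun v => ?_⟩⟩
  · have := (H u).1
    simp only [HSpace.eval_apply] at this
    exact this
  · have := (H u).2 v
    simp only [HSpace.eval_apply, FunLike.coe_smul, Pi.smul_apply,
      ContinuousLinearMap.toSpanSingleton_apply, smul_smul] at this
    exact this

/-! ### Splitting along pointwise convergent bounded sequences -/

/-- The Brezis–Lieb argument gives `k (u n) - k (u n - v) - k v → 0` in `ℓ^1`, and `ℓ^1` maps
boundedly to `V` because the Gram vectors have equal norm. -/
theorem tendsto_superpos_sub (he : ∀ x y, inner ℝ (e x) (e y) = green α x y) {k : ℝ → ℝ}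
    (hk : IsSmallPow p k) {u : ℕ → HSpace p h hp h₁} {v : HSpace p h hp h₁} {M : ℝ}
    (hu : ∀ n, ‖u n‖ ≤ M) (hlim : ∀ x, Tendsto (fun n => u n x) atTop (𝓝 (v x))) :
    Tendsto (fun n => superpos e k (u n) - superpos e k (u n - v : HSpace p h hp h₁)) atTop
      (𝓝 (superpos e k v)) := by
  have hp0 : 0 < p := by linarith
  obtain ⟨K₁, hK₁, B₁⟩ := exists_bounds hp h₁ M
  obtain ⟨K₂, hK₂, B₂⟩ := exists_bounds hp h₁ (M + ‖v‖)
  have hw : ∀ n, ‖u n - v‖ ≤ M + ‖v‖ := fun n => (norm_sub_le _ _).trans (by gcongr; exact hu n)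
  have hd : Tendsto (fun n => ∑' x, |k (u n x) - k (u n x - v x) - k (v x)|) atTop (𝓝 0) := by
    refine tendsto_tsum_zero_of_almost_dominated
      (m := fun n x => |u n x| ^ p + |(u n - v) x| ^ p) (M := K₁ + K₂)
      (fun n x => abs_nonneg _) (fun x => ?_)
      (fun n => (u n).summable_rpow.add (u n - v).summable_rpow) (fun n => ?_)
      (fun n x => by positivity) (fun ε hε => ?_)
    · have h1 : Tendsto (fun n => k (u n x) - k (u n x - v x) - k (v x)) atTop
          (𝓝 (k (v x) - k (v x - v x) - k (v x))) :=
        (((hk.cont.tendsto _).comp (hlim x)).sub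
          ((hk.cont.tendsto _).comp ((hlim x).sub_const _))).sub_const _
      rw [sub_self, hk.apply_zero hp0, sub_zero, sub_self] at h1
      simpa using h1.abs
    · rw [(u n).summable_rpow.tsum_add (u n - v).summable_rpow]
      exact add_le_add (B₁ _ (hu n)).2 (B₂ _ (hw n)).2
    · obtain ⟨C, hC, HC⟩ := hk.exists_abs_sub_le hp0.le (max K₁ K₂) hε
      refine ⟨fun x => C * |v x| ^ p + |k (v x)|,
        (v.summable_rpow.mul_left C).add (summable_abs_comp hk v), fun n x => ?_⟩
      have h1 := HC (u n x) (u n x - v x) (((B₁ _ (hu n)).1 x).trans (le_max_left _ _))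
        (((B₂ _ (hw n)).1 x).trans (le_max_right _ _))
      rw [sub_sub_cancel] at h1
      have h2 := abs_sub (k (u n x) - k (u n x - v x)) (k (v x))
      simp only [HSpace.sub_apply]
      linarith
  rw [tendsto_iff_norm_sub_tendsto_zero]
  refine squeeze_zero (fun _ => norm_nonneg _) (fun n => ?_) (by simpa using hd.mul_const ‖e 0‖)
  have s1 := summable_smul_gram he (summable_abs_comp hk (u n))
  have s2 := summable_smul_gram he (summable_abs_comp hk (u n - v))
  have s3 := summable_smul_gram he (summable_abs_comp hk v)
  have hs : Summable fun x => |k (u n x) - k (u n x - v x) - k (v x)| :=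
    Summable.of_nonneg_of_le (fun _ => abs_nonneg _)
      (fun x => (abs_sub _ _).trans (add_le_add_left (abs_sub _ _) _))
      (((summable_abs_comp hk (u n)).add (summable_abs_comp hk (u n - v))).add
        (summable_abs_comp hk v))
  have e1 : superpos e k (u n) - superpos e k (u n - v : HSpace p h hp h₁) - superpos e k v =
      ∑' x, (k (u n x) - k (u n x - v x) - k (v x)) • e x := by
    rw [superpos, superpos, superpos, ← s1.tsum_sub s2, ← (s1.sub s2).tsum_sub s3]
    refine tsum_congr fun x => ?_
    rw [sub_smul, sub_smul]
    rfl
  rw [e1]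
  exact norm_tsum_smul_gram_le he hs

/-- A weak convergence statement: the pairing is `∑ (R_α ∗ j(u n)) k(v)`, whose terms tend to zero
by decay of the kernel and are dominated by a multiple of `|k (v x)|`. -/
theorem tendsto_inner_superpos_zero (hα : 0 < α) (hαN : α < N)
    (he : ∀ x y, inner ℝ (e x) (e y) = green α x y) {j k : ℝ → ℝ}
    (hj : IsSmallPow p j) (hk : IsSmallPow p k) {u : ℕ → HSpace p h hp h₁} {M : ℝ}
    (hu : ∀ n, ‖u n‖ ≤ M) (hlim : ∀ x, Tendsto (fun n => u n x) atTop (𝓝 0))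
    (v : HSpace p h hp h₁) :
    Tendsto (fun n => inner ℝ (superpos e j (u n)) (superpos e k v)) atTop (𝓝 0) := by
  obtain ⟨C, hC, HC⟩ := exists_norm_superpos_le he hj hp h₁ M
  have h1 : Tendsto (fun n => ∑' x, greenConv α (fun y => j (u n y)) x * k (v x)) atTop
      (𝓝 (∑' x, 0 * k (v x))) := by
    refine tendsto_tsum_of_dominated_convergence
      ((summable_abs_comp hk v).mul_left (‖e 0‖ * C))
      (fun x => (tendsto_greenConv_zero hα hαN he hj hu hlim x).mul_const _)
      (Eventually.of_forall fun n x => ?_)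
    rw [← inner_gram_superpos he hj, norm_mul, Real.norm_eq_abs, Real.norm_eq_abs]
    gcongr
    refine (abs_real_inner_le_norm _ _).trans ?_
    rw [norm_gram he]
    gcongr
    exact HC _ (hu n)
  simp only [zero_mul, tsum_zero] at h1
  exact h1.congr fun n => (hasSum_inner_superpos he hj hk (u n) v).tsum_eq

/-- Each superposition of `u n` is that of `u n - v` plus that of `v` up to a strongly vanishing
error; the cross terms vanish because the superpositions of `u n - v` are bounded and pair to zero
with fixed ones. -/
theorem tendsto_inner_superpos_sub (hα : 0 < α) (hαN : α < N)
    (he : ∀ x y, inner ℝ (e x) (e y) = green α x y) {j k : ℝ → ℝ}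
    (hj : IsSmallPow p j) (hk : IsSmallPow p k) {u : ℕ → HSpace p h hp h₁} {v : HSpace p h hp h₁}
    {M : ℝ} (hu : ∀ n, ‖u n‖ ≤ M) (hlim : ∀ x, Tendsto (fun n => u n x) atTop (𝓝 (v x))) :
    Tendsto (fun n => inner ℝ (superpos e j (u n)) (superpos e k (u n)) -
        inner ℝ (superpos e j (u n - v : HSpace p h hp h₁))
          (superpos e k (u n - v : HSpace p h hp h₁))) atTop
      (𝓝 (inner ℝ (superpos e j v) (superpos e k v))) := by
  have hw : ∀ n, ‖u n - v‖ ≤ M + ‖v‖ := fun n => (norm_sub_le _ _).trans (by gcongr; exact hu n)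
  have hwlim : ∀ x, Tendsto (fun n => (u n - v : HSpace p h hp h₁) x) atTop (𝓝 0) := fun x => by
    simpa using (hlim x).sub_const (v x)
  have cross : ∀ {j k : ℝ → ℝ}, IsSmallPow p j → IsSmallPow p k →
      Tendsto (fun n => inner ℝ (superpos e j (u n - v : HSpace p h hp h₁))
        (superpos e k (u n) - superpos e k (u n - v : HSpace p h hp h₁))) atTop (𝓝 0) := by
    intro j k hj hk
    obtain ⟨C, hC, HC⟩ := exists_norm_superpos_le he hj hp h₁ (M + ‖v‖)
    have h1 := tendsto_inner_superpos_zero hα hαN he hj hk hw hwlim v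
    have h2 : Tendsto (fun n => inner ℝ (superpos e j (u n - v : HSpace p h hp h₁))
        (superpos e k (u n) - superpos e k (u n - v : HSpace p h hp h₁) - superpos e k v)) atTop
        (𝓝 0) := by
      have h3 := (tendsto_iff_norm_sub_tendsto_zero.1
        (tendsto_superpos_sub he hk hu hlim)).const_mul C
      rw [mul_zero] at h3
      refine squeeze_zero_norm (fun n => ?_) h3
      refine (norm_inner_le_norm _ _).trans ?_
      gcongr
      exact HC _ (hw n)
    have h3 := h1.add h2
    rw [add_zero] at h3
    refine h3.congr fun n => ?_
    rw [← inner_add_right]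
    congr 1
    abel
  have h1 := cross hj hk
  have h2 := cross hk hj
  have h3 := (tendsto_superpos_sub he hj hu hlim).inner (𝕜 := ℝ)
    (tendsto_superpos_sub he hk hu hlim)
  have h4 := (h1.add h2).add h3
  rw [add_zero, zero_add] at h4
  refine h4.congr fun n => ?_
  simp only [inner_sub_left, inner_sub_right]
  rw [real_inner_comm (superpos e k (u n - v : HSpace p h hp h₁)) (superpos e j (u n)),
    real_inner_comm (superpos e k (u n - v : HSpace p h hp h₁))
      (superpos e j (u n - v : HSpace p h hp h₁))]
  ring

end Complete

/-- Brezis–Lieb on the densities: the triangle inequality bounds the change of `|∇ ·|` and of `|·|`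
by the corresponding quantity for `v`, so the defect is at most `ε` times the density of `u n - v`
plus a multiple of the density of `v`. -/
theorem tendsto_norm_rpow_sub {u : ℕ → HSpace p h hp h₁} {v : HSpace p h hp h₁}
    {M : ℝ} (hu : ∀ n, ‖u n‖ ≤ M) (hlim : ∀ x, Tendsto (fun n => u n x) atTop (𝓝 (v x))) :
    Tendsto (fun n => ‖u n‖ ^ p - ‖u n - v‖ ^ p) atTop (𝓝 (‖v‖ ^ p)) := by
  have hp0 : 0 < p := by linarith
  have hw : ∀ n, ‖u n - v‖ ≤ M + ‖v‖ := fun n => (norm_sub_le _ _).trans (by gcongr; exact hu n)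
  have hdn := fun (w : HSpace p h hp h₁) => density_nonneg (p := p) (potential_nonneg h₁) w
  have hcont : ∀ x, Continuous fun a : (Fin N → ℤ) → ℝ => density p h a x := fun x => by
    unfold density gradNorm gradForm
    have h1 : Continuous fun a : (Fin N → ℤ) → ℝ =>
        √(1 / 2 * ∑ y ∈ nbrs x, (a y - a x) * (a y - a x)) := by fun_prop
    exact (h1.rpow_const fun _ => Or.inr hp0.le).add (continuous_const.mul
      ((continuous_apply x).abs.rpow_const fun _ => Or.inr hp0.le))
  have hd : Tendsto (fun n => ∑' x, |density p h (u n) x -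
      density p h (u n - v : HSpace p h hp h₁) x - density p h v x|) atTop (𝓝 0) := by
    refine tendsto_tsum_zero_of_almost_dominated
      (m := fun n x => density p h (u n - v : HSpace p h hp h₁) x) (M := (M + ‖v‖) ^ p)
      (fun n x => abs_nonneg _) (fun x => ?_) (fun n => (u n - v).summable) (fun n => ?_)
      (fun n x => hdn _ x) (fun ε hε => ?_)
    · have h0 : Tendsto (fun n => (u n : (Fin N → ℤ) → ℝ)) atTop (𝓝 v) := tendsto_pi_nhds.2 hlim
      have h1 := (((hcont x).tendsto _).comp h0).sub (((hcont x).tendsto _).comp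
        (h0.sub_const (v : (Fin N → ℤ) → ℝ)))
      have h2 := (h1.sub_const (density p h v x)).abs
      rw [sub_self (v : (Fin N → ℤ) → ℝ), density_zero hp, Pi.zero_apply, sub_zero, sub_self,
        abs_zero] at h2
      exact h2
    · rw [← HSpace.norm_rpow]
      gcongr
      exact hw n
    · obtain ⟨C, hC, HC⟩ := exists_abs_rpow_sub_rpow_le hp0 hε
      refine ⟨fun x => (C + 1) * density p h v x, v.summable.mul_left _, fun n x => ?_⟩
      have hx := potential_nonneg h₁ x
      have g1 : |gradNorm (u n) x - gradNorm (u n - v : HSpace p h hp h₁) x| ≤ gradNorm v x := by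
        have a1 := gradNorm_add_le (u n - v : HSpace p h hp h₁) v x
        rw [HSpace.coe_sub, sub_add_cancel] at a1
        have a2 := gradNorm_add_le (u n) ((-1 : ℝ) • (v : (Fin N → ℤ) → ℝ)) x
        rw [gradNorm_smul, neg_one_smul, ← sub_eq_add_neg, abs_neg, abs_one, one_mul] at a2
        rw [HSpace.coe_sub, abs_le]
        constructor <;> linarith
      have b1 := HC _ _ _ (gradNorm_nonneg _ _) (gradNorm_nonneg _ _) g1
      have g2 : |(|u n x| - |(u n - v : HSpace p h hp h₁) x|)| ≤ |v x| := by
        refine (abs_abs_sub_abs_le_abs_sub _ _).trans (le_of_eq ?_)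
        simp
      have b2 := mul_le_mul_of_nonneg_left (HC _ _ _ (abs_nonneg _) (abs_nonneg _) g2) hx
      rw [← abs_of_nonneg hx, ← abs_mul, abs_of_nonneg hx] at b2
      have b3 := hdn v x
      have b4 := abs_sub (density p h (u n) x - density p h (u n - v : HSpace p h hp h₁) x)
        (density p h v x)
      rw [abs_of_nonneg b3] at b4
      refine b4.trans ?_
      have b5 : |density p h (u n) x - density p h (u n - v : HSpace p h hp h₁) x| ≤
          ε * density p h (u n - v : HSpace p h hp h₁) x + C * density p h v x := by
        have : density p h (u n) x - density p h (u n - v : HSpace p h hp h₁) x =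
            (gradNorm (u n) x ^ p - gradNorm (u n - v : HSpace p h hp h₁) x ^ p) +
            h x * (|u n x| ^ p - |(u n - v : HSpace p h hp h₁) x| ^ p) := by
          rw [density, density]
          ring
        rw [this]
        refine (abs_add_le _ _).trans ((add_le_add b1 b2).trans (le_of_eq ?_))
        rw [density, density]
        ring
      linarith
  rw [tendsto_iff_norm_sub_tendsto_zero]
  refine squeeze_zero (fun _ => norm_nonneg _) (fun n => ?_) hd
  have s1 := (u n).summable
  have s2 := (u n - v).summable
  have s3 := v.summable
  rw [HSpace.norm_rpow, HSpace.norm_rpow, HSpace.norm_rpow, ← s1.tsum_sub s2,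
    ← (s1.sub s2).tsum_sub s3]
  exact norm_tsum_le_tsum_norm ((s1.sub s2).sub s3).norm

end Choquard

end

noncomputable section

namespace Choquard

/-! ### The Nehari manifold of an abstract functional -/

section Nehari

variable {X : Type*} [NormedAddCommGroup X] [NormedSpace ℝ X]

/-- A minimizer on the Nehari manifold `{v ≠ 0 : D v v = 0}` of a `C^1` functional is critical,
if the functional has along the ray through it a strict change of monotonicity. -/
theorem critical_of_isMin_nehari {J : X → ℝ} {D : X → X →L[ℝ] ℝ} (hD : Continuous D)
    (hJ : ∀ u, HasFDerivAt J (D u) u) {u : X} (hu : u ≠ 0)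
    (hmin : ∀ v, v ≠ 0 → D v v = 0 → J u ≤ J v) (hmax : ∀ t : ℝ, 0 < t → J (t • u) ≤ J u)
    (hpos : ∀ t : ℝ, 0 < t → t < 1 → 0 < D (t • u) (t • u))
    (hneg : ∀ t : ℝ, 1 < t → D (t • u) (t • u) < 0) : D u = 0 := by
  by_contra hne
  obtain ⟨φ, hφ⟩ : ∃ φ, D u φ < 0 := by
    obtain ⟨ψ, hψ⟩ : ∃ ψ, D u ψ ≠ 0 := by
      by_contra! h0
      exact hne (ContinuousLinearMap.ext h0)
    rcases lt_or_gt_of_ne hψ with h | h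
    · exact ⟨ψ, h⟩
    · exact ⟨-ψ, by simpa using h⟩
  have hcw : Continuous fun q : ℝ × ℝ => q.1 • u + q.2 • φ := by fun_prop
  have hcg : Continuous fun q : ℝ × ℝ => D (q.1 • u + q.2 • φ) (q.1 • u + q.2 • φ) :=
    (hD.comp hcw).clm_apply hcw
  have hcφ : Continuous fun q : ℝ × ℝ => D (q.1 • u + q.2 • φ) φ :=
    (hD.comp hcw).clm_apply continuous_const
  have ev : ∀ᶠ q : ℝ × ℝ in 𝓝 (1, 0), D (q.1 • u + q.2 • φ) φ < 0 ∧ q.1 • u + q.2 • φ ≠ 0 := by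
    refine ((hcφ.tendsto _).eventually_lt_const (by simpa using hφ)).and
      ((hcw.tendsto _).eventually_ne (by simpa using hu))
  obtain ⟨δ, hδ, H⟩ := Metric.eventually_nhds_iff.1 ev
  -- Below `δ`, so that `J` decreases along `φ` on the whole square, and at most `1 / 2`, so that
  -- the factor `1 - η` is positive.
  set η := min (δ / 2) (1 / 2) with hη
  have hη0 : 0 < η := by positivity
  have hηδ : η < δ := (min_le_left _ _).trans_lt (half_lt_self hδ)
  have hη1 : η ≤ 1 / 2 := min_le_right _ _
  have H' : ∀ t s : ℝ, |t - 1| ≤ η → |s| ≤ η →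
      D (t • u + s • φ) φ < 0 ∧ t • u + s • φ ≠ 0 := fun t s ht hs => by
    refine H (y := (t, s)) ?_
    rw [Prod.dist_eq, max_lt_iff]
    constructor
    · exact lt_of_le_of_lt ht hηδ
    · simpa using lt_of_le_of_lt hs hηδ
  have e1 : ∀ᶠ s : ℝ in 𝓝[>] 0, 0 < D ((1 - η) • u + s • φ) ((1 - η) • u + s • φ) := by
    have hc : Continuous fun s : ℝ => D ((1 - η) • u + s • φ) ((1 - η) • u + s • φ) :=
      hcg.comp (by fun_prop : Continuous fun s : ℝ => ((1 - η, s) : ℝ × ℝ))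
    refine ((hc.tendsto 0).eventually_const_lt ?_).filter_mono nhdsWithin_le_nhds
    simpa using hpos (1 - η) (by linarith) (by linarith)
  have e2 : ∀ᶠ s : ℝ in 𝓝[>] 0, D ((1 + η) • u + s • φ) ((1 + η) • u + s • φ) < 0 := by
    have hc : Continuous fun s : ℝ => D ((1 + η) • u + s • φ) ((1 + η) • u + s • φ) :=
      hcg.comp (by fun_prop : Continuous fun s : ℝ => ((1 + η, s) : ℝ × ℝ))
    refine ((hc.tendsto 0).eventually_lt_const ?_).filter_mono nhdsWithin_le_nhds
    simpa using hneg (1 + η) (by linarith)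
  have e3 : ∀ᶠ s : ℝ in 𝓝[>] 0, s < η := (eventually_lt_nhds hη0).filter_mono nhdsWithin_le_nhds
  obtain ⟨s, hs1, hs2, hs3, hs0⟩ :=
    (e1.and (e2.and (e3.and (self_mem_nhdsWithin : Set.Ioi (0 : ℝ) ∈ 𝓝[>] 0)))).exists
  have hs0' : 0 < s := hs0
  -- For small `s` the signs at the two ends `1 ± η` of the ray survive the perturbation, so the
  -- segment shifted by `s • φ` still crosses the Nehari manifold. At the crossing `J (t • u + s •
  -- φ) < J (t • u) ≤ J u`.
  obtain ⟨t, ht, hgt⟩ : ∃ t ∈ Set.Icc (1 - η) (1 + η), D (t • u + s • φ) (t • u + s • φ) = 0 := by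
    have hc : Continuous fun t : ℝ => D (t • u + s • φ) (t • u + s • φ) :=
      hcg.comp (by fun_prop : Continuous fun t : ℝ => ((t, s) : ℝ × ℝ))
    exact intermediate_value_Icc' (by linarith) hc.continuousOn ⟨hs2.le, hs1.le⟩
  have ht1 : |t - 1| ≤ η := abs_le.2 ⟨by linarith [ht.1], by linarith [ht.2]⟩
  have hder : ∀ r : ℝ, HasDerivAt (fun r : ℝ => J (t • u + r • φ)) (D (t • u + r • φ) φ) r := by
    intro r
    have h1 : HasDerivAt (fun r : ℝ => t • u + r • φ) φ r := by
      simpa using ((hasDerivAt_id r).smul_const φ).const_add (t • u)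
    exact (hJ _).comp_hasDerivAt r h1
  have hanti : StrictAntiOn (fun r : ℝ => J (t • u + r • φ)) (Set.Icc 0 s) := by
    refine strictAntiOn_of_deriv_neg (convex_Icc 0 s)
      (fun r _ => (hder r).continuousAt.continuousWithinAt) fun r hr => ?_
    rw [interior_Icc] at hr
    rw [(hder r).deriv]
    exact (H' t r ht1 (by rw [abs_of_pos hr.1]; linarith [hr.2])).1
  have h1 := hanti (Set.left_mem_Icc.2 hs0'.le) (Set.right_mem_Icc.2 hs0'.le) hs0'
  simp only [zero_smul, add_zero] at h1
  have h2 := hmin _ (H' t s ht1 (by rw [abs_of_pos hs0']; linarith)).2 hgt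
  have h3 := hmax t (by linarith [ht.1])
  linarith

variable {p : ℝ} {J A : X → ℝ} {D : X → X →L[ℝ] ℝ}

/-- Monotonicity applied to `u / 2` with factor `2` makes `A u` strictly larger than a nonnegative
number. -/
theorem coupling_pos (hA : ∀ u, 0 ≤ A u)
    (hmono : ∀ u, u ≠ 0 → ∀ t : ℝ, 1 < t → t ^ (p + 1) * A u < A (t • u)) {u : X} (hu : u ≠ 0) :
    0 < A u := by
  have h2 := hmono ((2 : ℝ)⁻¹ • u) (smul_ne_zero (by norm_num) hu) 2 (by norm_num)
  rw [smul_smul, mul_inv_cancel₀ two_ne_zero, one_smul] at h2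
  exact lt_of_le_of_lt (mul_nonneg (by positivity) (hA _)) h2

theorem coupling_smul_lt (hmono : ∀ u, u ≠ 0 → ∀ t : ℝ, 1 < t → t ^ (p + 1) * A u < A (t • u))
    {u : X} (hu : u ≠ 0) {t : ℝ} (ht : 0 < t) (ht1 : t < 1) :
    A (t • u) < t ^ (p + 1) * A u := by
  have h2 := hmono (t • u) (smul_ne_zero ht.ne' hu) t⁻¹ (one_lt_inv_iff₀.2 ⟨ht, ht1⟩)
  rw [smul_smul, inv_mul_cancel₀ ht.ne', one_smul, Real.inv_rpow ht.le,
    inv_mul_lt_iff₀ (by positivity)] at h2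
  exact h2

/-- For a coupling homogeneous of degree `p + 1` the crossing would be exactly at `r = ‖u‖ ^ p / A
u`. Strict monotonicity of `A (t • u) / t ^ (p + 1)` places a crossing between `1` and `r`. -/
theorem exists_smul_mem_nehari (hD : Continuous D)
    (hDu : ∀ u, D u u = ‖u‖ ^ p - A u) (hA : ∀ u, 0 ≤ A u)
    (hmono : ∀ u, u ≠ 0 → ∀ t : ℝ, 1 < t → t ^ (p + 1) * A u < A (t • u)) {u : X} (hu : u ≠ 0) :
    ∃ t : ℝ, 0 < t ∧ D (t • u) (t • u) = 0 := by
  have hAu := coupling_pos hA hmono hu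
  have hnu : 0 < ‖u‖ ^ p := Real.rpow_pos_of_pos (norm_pos_iff.2 hu) p
  set r := ‖u‖ ^ p / A u with hr
  have hr0 : 0 < r := by positivity
  have hrA : r * A u = ‖u‖ ^ p := div_mul_cancel₀ _ hAu.ne'
  have hDt : ∀ t : ℝ, 0 < t → D (t • u) (t • u) = t ^ p * ‖u‖ ^ p - A (t • u) := fun t ht => by
    rw [hDu, norm_smul, Real.norm_of_nonneg ht.le, Real.mul_rpow ht.le (norm_nonneg _)]
  have hc : Continuous fun t : ℝ => D (t • u) (t • u) :=
    (hD.comp (by fun_prop)).clm_apply (by fun_prop)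
  have hpow : ∀ t : ℝ, 0 < t → t ^ (p + 1) = t ^ p * t := fun t ht => Real.rpow_add_one ht.ne' p
  have h1 : 0 ≤ D (min 1 r • u) (min 1 r • u) := by
    have hm : 0 < min 1 r := by positivity
    rw [hDt _ hm, ← hrA]
    have h2 : A (min 1 r • u) ≤ (min 1 r) ^ (p + 1) * A u := by
      rcases (min_le_left 1 r).eq_or_lt with h | h
      · rw [h]; simp
      · exact (coupling_smul_lt hmono hu hm h).le
    rw [hpow _ hm] at h2
    have h3 : (min 1 r) ^ p * min 1 r * A u ≤ (min 1 r) ^ p * (r * A u) := by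
      rw [mul_assoc]
      gcongr
      exact min_le_right _ _
    linarith
  have h2 : D (max 1 r • u) (max 1 r • u) ≤ 0 := by
    have hm : 0 < max 1 r := by positivity
    rw [hDt _ hm, ← hrA]
    have h2 : (max 1 r) ^ (p + 1) * A u ≤ A (max 1 r • u) := by
      rcases (le_max_left 1 r).eq_or_lt with h | h
      · rw [← h]; simp
      · exact (hmono u hu _ h).le
    rw [hpow _ hm] at h2
    have h3 : (max 1 r) ^ p * (r * A u) ≤ (max 1 r) ^ p * max 1 r * A u := by
      rw [mul_assoc]
      gcongr
      exact le_max_right _ _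
    linarith
  obtain ⟨t, ht, h0⟩ := intermediate_value_Icc' (min_le_max (a := 1) (b := r)) hc.continuousOn
    ⟨h2, h1⟩
  exact ⟨t, lt_of_lt_of_le (by positivity) ht.1, h0⟩

/-- Along a ray, `t ↦ t^p (A u - ‖u‖^p) / p + J (t u)` is maximal at `t = 1`. -/
theorem ray_le (hp : 0 < p) (hJ : ∀ u, HasFDerivAt J (D u) u)
    (hDu : ∀ u, D u u = ‖u‖ ^ p - A u) (hA : ∀ u, 0 ≤ A u)
    (hmono : ∀ u, u ≠ 0 → ∀ t : ℝ, 1 < t → t ^ (p + 1) * A u < A (t • u)) {u : X} (hu : u ≠ 0)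
    {t : ℝ} (ht : 0 < t) :
    (A u - ‖u‖ ^ p) / p * t ^ p + J (t • u) ≤ (A u - ‖u‖ ^ p) / p + J u := by
  have hAu := coupling_pos hA hmono hu
  set ψ : ℝ → ℝ := fun t => (A u - ‖u‖ ^ p) / p * t ^ p + J (t • u) with hψ
  have hDt : ∀ t : ℝ, 0 < t → D (t • u) u = t ^ (p - 1) * ‖u‖ ^ p - A (t • u) / t := by
    intro t ht
    have h1 := hDu (t • u)
    rw [map_smul, smul_eq_mul, norm_smul, Real.norm_of_nonneg ht.le,
      Real.mul_rpow ht.le (norm_nonneg _)] at h1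
    rw [Real.rpow_sub_one ht.ne']
    field_simp
    linarith
  -- The added multiple of `t ^ p` replaces `‖u‖ ^ p` by `A u` in the derivative, which is then
  -- nonnegative before `t = 1` and nonpositive after it, whether or not `u` lies on the Nehari
  -- manifold.
  have hder : ∀ t : ℝ, 0 < t → HasDerivAt ψ (t ^ (p - 1) * A u - A (t • u) / t) t := by
    intro t ht
    have h1 : HasDerivAt (fun t : ℝ => J (t • u)) (D (t • u) u) t := by
      have h2 : HasDerivAt (fun t : ℝ => t • u) u t := by
        simpa using (hasDerivAt_id t).smul_const u
      exact (hJ _).comp_hasDerivAt t h2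
    have h3 := ((Real.hasDerivAt_rpow_const (p := p) (Or.inl ht.ne')).const_mul
      ((A u - ‖u‖ ^ p) / p)).add h1
    refine h3.congr_deriv ?_
    rw [hDt t ht]
    field_simp
    ring
  have hpow : ∀ t : ℝ, 0 < t → t ^ (p + 1) = t ^ (p - 1) * t * t := fun t ht => by
    rw [Real.rpow_add_one ht.ne', ← Real.rpow_add_one ht.ne' (p - 1), sub_add_cancel]
  have hψ1 : ψ 1 = (A u - ‖u‖ ^ p) / p + J u := by simp [hψ]
  change ψ t ≤ _
  rw [← hψ1]
  rcases le_total t 1 with h | h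
  · have hm : MonotoneOn ψ (Set.Icc t 1) := by
      refine monotoneOn_of_deriv_nonneg (convex_Icc t 1)
        (fun s hs => (hder s (ht.trans_le hs.1)).continuousAt.continuousWithinAt)
        (fun s hs => ?_) fun s hs => ?_
      · rw [interior_Icc] at hs
        exact (hder s (ht.trans hs.1)).differentiableAt.differentiableWithinAt
      · rw [interior_Icc] at hs
        have hs0 : 0 < s := ht.trans hs.1
        rw [(hder s hs0).deriv, sub_nonneg, div_le_iff₀ hs0]
        have h1 := (coupling_smul_lt hmono hu hs0 hs.2).le
        rw [hpow s hs0] at h1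
        have h2 : 0 ≤ s ^ (p - 1) * s * A u := by positivity
        nlinarith [hs.2]
    exact hm (Set.left_mem_Icc.2 h) (Set.right_mem_Icc.2 h) h
  · have hm : AntitoneOn ψ (Set.Icc 1 t) := by
      refine antitoneOn_of_deriv_nonpos (convex_Icc 1 t)
        (fun s hs => (hder s (zero_lt_one.trans_le hs.1)).continuousAt.continuousWithinAt)
        (fun s hs => ?_) fun s hs => ?_
      · rw [interior_Icc] at hs
        exact (hder s (zero_lt_one.trans hs.1)).differentiableAt.differentiableWithinAt
      · rw [interior_Icc] at hs
        have hs0 : 0 < s := zero_lt_one.trans hs.1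
        rw [(hder s hs0).deriv, sub_nonpos, le_div_iff₀ hs0]
        have h1 := (hmono u hu s hs.1).le
        rw [hpow s hs0] at h1
        have h2 : 0 ≤ s ^ (p - 1) * s * A u := by positivity
        nlinarith [hs.1]
    exact hm (Set.left_mem_Icc.2 h) (Set.right_mem_Icc.2 h) h

/-- On the Nehari manifold `D (t • u) (t • u) = t ^ p * A u - A (t • u)`, which compares with `t ^ p
* (1 - t) * A u` and so changes sign at `t = 1`; `ray_le` reduces to maximality of `J` along the
ray. -/
theorem critical_of_isMin (hp : 0 < p) (hD : Continuous D) (hJ : ∀ u, HasFDerivAt J (D u) u)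
    (hDu : ∀ u, D u u = ‖u‖ ^ p - A u) (hA : ∀ u, 0 ≤ A u)
    (hmono : ∀ u, u ≠ 0 → ∀ t : ℝ, 1 < t → t ^ (p + 1) * A u < A (t • u)) {u : X} (hu : u ≠ 0)
    (huM : D u u = 0) (hmin : ∀ v, v ≠ 0 → D v v = 0 → J u ≤ J v) : D u = 0 := by
  have hAu := coupling_pos hA hmono hu
  have huA : ‖u‖ ^ p = A u := by
    have := hDu u
    rw [huM] at this
    linarith
  have hDt : ∀ t : ℝ, 0 < t → D (t • u) (t • u) = t ^ p * A u - A (t • u) := fun t ht => by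
    rw [hDu, norm_smul, Real.norm_of_nonneg ht.le, Real.mul_rpow ht.le (norm_nonneg _), huA]
  have hpow : ∀ t : ℝ, 0 < t → t ^ (p + 1) = t ^ p * t := fun t ht => Real.rpow_add_one ht.ne' p
  refine critical_of_isMin_nehari hD hJ hu hmin (fun t ht => ?_) (fun t ht ht1 => ?_)
    fun t ht1 => ?_
  · have := ray_le hp hJ hDu hA hmono hu ht
    rwa [huA, sub_self, zero_div, zero_mul, zero_add, zero_add] at this
  · have h1 := coupling_smul_lt hmono hu ht ht1
    rw [hpow t ht] at h1
    have h2 : 0 < t ^ p * A u := by positivity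
    rw [hDt t ht]
    nlinarith
  · have ht : 0 < t := zero_lt_one.trans ht1
    have h1 := hmono u hu t ht1
    rw [hpow t ht] at h1
    have h2 : 0 < t ^ p * A u := by positivity
    rw [hDt t ht]
    nlinarith

end Nehari

end Choquard

end

/-! ### The energy on `H` and a minimizer on its Nehari manifold -/

noncomputable section

namespace Choquard

variable {N : ℕ} {p : ℝ} {h : (Fin N → ℤ) → ℝ} {hp : 2 ≤ p} {h₁ : ∃ h₀ > 0, ∀ x, h₀ ≤ h x}
  {V : Type*} [NormedAddCommGroup V] [InnerProductSpace ℝ V]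
  {α : ℝ} {e : (Fin N → ℤ) → V} {f : ℝ → ℝ}

/-! ### The energy of the Choquard equation -/

/-- `∑ (R_α ∗ F(u)) f(u) u`, in terms of a Gram representation of the Green's function. -/
def coupling (e : (Fin N → ℤ) → V) (f : ℝ → ℝ) (u : (Fin N → ℤ) → ℝ) : ℝ :=
  inner ℝ (superpos e (primitive f) u) (superpos e (fun t => f t * t) u)

section Complete

variable [CompleteSpace V]

theorem energy_eq (he : ∀ x y, inner ℝ (e x) (e y) = green α x y) (hf : IsSmallPow (p - 1) f)
    (u : HSpace p h hp h₁) :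
    energy α f u = 1 / p * ‖u‖ ^ p - 1 / 2 * ‖superpos e (primitive f) u‖ ^ 2 := by
  have hF := hf.primitive (by linarith : 1 < p)
  rw [energy, ← real_inner_self_eq_norm_sq, ← (hasSum_inner_superpos he hF hF u u).tsum_eq,
    HSpace.norm_rpow]
  rfl

/-- The chain rule for half the squared norm of the superposition. Evaluation on `u` itself gives
the Nehari functional, and on the indicator of a point the two sides of the equation there. -/
theorem exists_hasFDerivAt_energy (he : ∀ x y, inner ℝ (e x) (e y) = green α x y)
    (hf : IsSmallPow (p - 1) f) (hp : 2 ≤ p) (h₁ : ∃ h₀ > 0, ∀ x, h₀ ≤ h x) :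
    ∃ D : HSpace p h hp h₁ → HSpace p h hp h₁ →L[ℝ] ℝ, Continuous D ∧
      (∀ u, HasFDerivAt (energy α f) (D u) u) ∧ (∀ u, D u u = ‖u‖ ^ p - coupling e f u) ∧
      ∀ u x, D u (HSpace.single hp h₁ x) = -pLaplacian p u x + h x * |u x| ^ (p - 2) * u x -
        greenConv α (fun y => primitive f (u y)) x * f (u x) := by
  have hp1 : 1 < p := by linarith
  have hp0 : p ≠ 0 := by linarith
  have hF := hf.primitive hp1
  obtain ⟨D₁, hD₁, H₁⟩ := HSpace.exists_hasFDerivAt_norm_rpow hp h₁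
  obtain ⟨D₂, hD₂, H₂⟩ := exists_hasFDerivAt_superpos he hf hp h₁
  have hc : Continuous fun u : HSpace p h hp h₁ => superpos e (primitive f) u :=
    continuous_iff_continuousAt.2 fun u => (H₂ u).1.continuousAt
  refine ⟨fun u => (1 / p) • D₁ u - (innerSL ℝ (superpos e (primitive f) u)).comp (D₂ u),
    (hD₁.fun_const_smul (1 / p)).sub (((innerSL ℝ).continuous.comp hc).clm_comp hD₂),
    fun u => ?_, fun u => ?_, fun u x => ?_⟩
  · have h1 := ((H₁ u).1.const_mul (1 / p)).sub ((H₂ u).1.norm_sq.const_mul (1 / 2))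
    refine HasFDerivAt.congr_of_eventuallyEq (h1.congr_fderiv ?_)
      (Eventually.of_forall fun w => energy_eq he hf w)
    ext v
    simp
  · have h1 : D₁ u u = p * ‖u‖ ^ p := by
      have h2 : HasSum (fun x => p * density p h u x) (p * ‖u‖ ^ p) := by
        rw [HSpace.norm_rpow]
        exact u.summable.hasSum.mul_left p
      refine ((H₁ u).2 u).unique ?_
      refine Eq.mpr (congrArg (fun F => HasSum F _) (funext fun x => ?_)) h2
      have g1 : gradNorm u x ^ (p - 2) * gradForm u u x = gradNorm u x ^ p := by
        have g0 : 0 ≤ gradForm u u x :=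
          mul_nonneg (by norm_num) (Finset.sum_nonneg fun y _ => mul_self_nonneg _)
        have : gradForm u u x = gradNorm u x ^ (2 : ℝ) := by
          rw [Real.rpow_two, gradNorm, Real.sq_sqrt g0]
        rw [this, ← Real.rpow_add' (gradNorm_nonneg _ _) (by simpa using hp0), sub_add_cancel]
      have g2 : |u x| ^ (p - 2) * (u x * u x) = |u x| ^ p := by
        rw [← abs_mul_abs_self, ← sq, ← Real.rpow_two,
          ← Real.rpow_add' (abs_nonneg _) (by simpa using hp0), sub_add_cancel]
      rw [density, g1, ← g2]
      ring
    have h2 : D₂ u u = superpos e (fun t => f t * t) u := ((H₂ u).2 u).tsum_eq.symm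
    simp only [FunLike.coe_sub, Pi.sub_apply, FunLike.coe_smul, Pi.smul_apply,
      ContinuousLinearMap.comp_apply, innerSL_apply_apply, smul_eq_mul]
    rw [h1, h2, coupling]
    field_simp
  · have h1 : D₁ u (HSpace.single hp h₁ x) =
        p * -pLaplacian p u x + p * (h x * |u x| ^ (p - 2) * u x) := by
      refine ((H₁ u).2 _).unique (((hasSum_gradForm_single u x).mul_left p).add ?_)
      have := hasSum_single (f := fun y => p * (h y * |u y| ^ (p - 2) * u y *
        (HSpace.single hp h₁ x : HSpace p h hp h₁) y)) x fun y hy => by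
          rw [HSpace.single_of_ne hy, mul_zero, mul_zero]
      rwa [HSpace.single_self, mul_one] at this
    have h2 : D₂ u (HSpace.single hp h₁ x) = f (u x) • e x := by
      refine ((H₂ u).2 _).unique ?_
      have := hasSum_single (f := fun y => (f (u y) *
        (HSpace.single hp h₁ x : HSpace p h hp h₁) y) • e y) x fun y hy => by
          rw [HSpace.single_of_ne hy, mul_zero, zero_smul]
      rwa [HSpace.single_self, mul_one] at this
    simp only [FunLike.coe_sub, Pi.sub_apply, FunLike.coe_smul, Pi.smul_apply,
      ContinuousLinearMap.comp_apply, innerSL_apply_apply, smul_eq_mul]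
    rw [h1, h2, inner_smul_right, real_inner_comm, inner_gram_superpos he hF]
    field_simp

theorem greenConv_nonneg (hα : 0 < α) (hαN : α < N) {g : (Fin N → ℤ) → ℝ} (hg : ∀ y, 0 ≤ g y)
    (x : Fin N → ℤ) : 0 ≤ greenConv α g x :=
  tsum_nonneg fun y => mul_nonneg (green_nonneg hα hαN x y) (hg y)

/-- Positivity of the kernel makes `R_α ∗ F(u)` nonnegative, so the pointwise inequality of `(f₃)`
may be multiplied by it and summed. -/
theorem le_coupling (hα : 0 < α) (hαN : α < N) (he : ∀ x y, inner ℝ (e x) (e y) = green α x y)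
    (hf : IsSmallPow (p - 1) f) {θ : ℝ} (hθ : 0 < θ)
    (f₃ : ∀ t, 0 ≤ θ * primitive f t ∧ θ * primitive f t ≤ 2 * f t * t) (u : HSpace p h hp h₁) :
    θ / 2 * ‖superpos e (primitive f) u‖ ^ 2 ≤ coupling e f u := by
  have hp1 : 1 < p := by linarith
  have hF := hf.primitive hp1
  have h1 := (hasSum_inner_superpos he hF hF u u).mul_left (θ / 2)
  rw [real_inner_self_eq_norm_sq] at h1
  refine hasSum_le (fun x => ?_) h1 (hasSum_inner_superpos he hF (hf.mul_id hp1) u u)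
  have h2 := greenConv_nonneg hα hαN (g := fun y => primitive f (u y))
    (fun y => nonneg_of_mul_nonneg_right (f₃ (u y)).1 hθ) x
  nlinarith [(f₃ (u x)).2]

theorem coupling_smul (he : ∀ x y, inner ℝ (e x) (e y) = green α x y)
    (hf : IsSmallPow (p - 1) f) (u : HSpace p h hp h₁) (t : ℝ) :
    coupling e f (t • u : HSpace p h hp h₁) =
      t * ∑' x, greenConv α (fun y => primitive f (t * u y)) x * f (t * u x) * u x := by
  have hp1 : 1 < p := by linarith
  rw [coupling, ← (hasSum_inner_superpos he (hf.primitive hp1) (hf.mul_id hp1) (t • u)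
    (t • u)).tsum_eq, ← tsum_mul_left]
  refine tsum_congr fun x => ?_
  simp only [HSpace.smul_apply]
  ring

theorem inner_superpos_shift (he : ∀ x y, inner ℝ (e x) (e y) = green α x y) {j k : ℝ → ℝ}
    (hj : IsSmallPow p j) (hk : IsSmallPow p k) (z : Fin N → ℤ) (hz : ∀ x, h (x + z) = h x)
    (u : HSpace p h hp h₁) :
    inner ℝ (superpos e j (u.shift z hz)) (superpos e k (u.shift z hz)) =
      inner ℝ (superpos e j u) (superpos e k u) := by
  have h1 : ∀ x, greenConv α (fun y => j (u (y + z))) x =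
      greenConv α (fun y => j (u y)) (x + z) := fun x => by
    rw [greenConv, greenConv,
      ← (Equiv.addRight z).tsum_eq fun y => green α (x + z) y * j (u y)]
    exact tsum_congr fun y => by rw [Equiv.coe_addRight, green_add_add]
  rw [← (hasSum_inner_superpos he hj hk _ _).tsum_eq, ← (hasSum_inner_superpos he hj hk u u).tsum_eq]
  simp only [HSpace.shift_apply, h1]
  exact (Equiv.addRight z).tsum_eq fun x => greenConv α (fun y => j (u y)) x * k (u x)

end Complete

/-- On bounded parts of the Nehari manifold the supremum norm is bounded from below. -/
theorem exists_lt_abs_apply (he : ∀ x y, inner ℝ (e x) (e y) = green α x y)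
    (hf : IsSmallPow (p - 1) f) (hp : 2 ≤ p) (h₁ : ∃ h₀ > 0, ∀ x, h₀ ≤ h x) (M : ℝ) :
    ∃ δ > 0, ∀ u : HSpace p h hp h₁, u ≠ 0 → ‖u‖ ^ p = coupling e f u → ‖u‖ ≤ M →
      ∃ x, δ < |u x| := by
  have hp1 : 1 < p := by linarith
  have hp0 : 0 < p := by linarith
  obtain ⟨B, hB, hsum⟩ := HSpace.exists_sum_rpow_le hp h₁
  -- If `u` were uniformly below the threshold, Cauchy–Schwarz would give `‖u‖ ^ p ≤ (ε * B ^ p * ‖e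
  -- 0‖ * ‖u‖ ^ p) ^ 2`, hence `1 ≤ ε ^ 2 * Q`; `ε = 1 / (Q + 1)` excludes this.
  set Q := (B ^ p * ‖e 0‖) ^ 2 * |M| ^ p with hQ
  have hQ0 : 0 ≤ Q := by positivity
  have hε : 0 < 1 / (Q + 1) := by positivity
  set ε := 1 / (Q + 1) with hε'
  have hε1 : ε ≤ 1 := by
    rw [hε', div_le_one (by positivity)]
    linarith
  have hεQ : ε * Q < 1 := by
    rw [hε', one_div_mul_eq_div, div_lt_one (by positivity)]
    linarith
  obtain ⟨δ₁, hδ₁, H₁⟩ := (hf.primitive hp1).small ε hε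
  obtain ⟨δ₂, hδ₂, H₂⟩ := (hf.mul_id hp1).small ε hε
  refine ⟨min δ₁ δ₂, by positivity, fun u hu huA huM => ?_⟩
  by_contra! hle
  have bd : ∀ {k : ℝ → ℝ}, IsSmallPow p k → (∀ x, |k (u x)| ≤ ε * |u x| ^ p) →
      ‖superpos e k u‖ ≤ ε * (B ^ p * ‖e 0‖) * ‖u‖ ^ p := by
    intro k hk hku
    have s1 := summable_abs_comp hk u
    refine (norm_tsum_smul_gram_le he s1).trans ?_
    have h1 := s1.tsum_le_tsum hku (u.summable_rpow.mul_left ε)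
    rw [tsum_mul_left] at h1
    have h2 : ∑' x, |u x| ^ p ≤ (B * ‖u‖) ^ p := u.summable_rpow.tsum_le_of_sum_le (hsum u)
    rw [Real.mul_rpow hB (norm_nonneg _)] at h2
    calc _ ≤ ε * (B ^ p * ‖u‖ ^ p) * ‖e 0‖ := by
          gcongr
          exact h1.trans (by gcongr)
      _ = _ := by ring
  have b1 := bd (hf.primitive hp1) fun x => H₁ _ ((hle x).trans (min_le_left _ _))
  have b2 := bd (hf.mul_id hp1) fun x => H₂ _ ((hle x).trans (min_le_right _ _))
  have hn : 0 < ‖u‖ ^ p := Real.rpow_pos_of_pos (norm_pos_iff.2 hu) p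
  have hMp : ‖u‖ ^ p ≤ |M| ^ p := by
    gcongr
    exact huM.trans (le_abs_self M)
  have h1 : ‖u‖ ^ p ≤ (ε * (B ^ p * ‖e 0‖) * ‖u‖ ^ p) * (ε * (B ^ p * ‖e 0‖) * ‖u‖ ^ p) := by
    exact huA.le.trans ((real_inner_le_norm _ _).trans (by gcongr))
  have h2 : (ε * (B ^ p * ‖e 0‖) * ‖u‖ ^ p) * (ε * (B ^ p * ‖e 0‖) * ‖u‖ ^ p) =
      (ε * ε * ((B ^ p * ‖e 0‖) ^ 2 * ‖u‖ ^ p)) * ‖u‖ ^ p := by ring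
  have h3 : ε * ε * ((B ^ p * ‖e 0‖) ^ 2 * ‖u‖ ^ p) < 1 := by
    calc ε * ε * ((B ^ p * ‖e 0‖) ^ 2 * ‖u‖ ^ p) ≤ 1 * ε * ((B ^ p * ‖e 0‖) ^ 2 * |M| ^ p) := by
          gcongr
      _ < 1 := by rwa [one_mul]
  rw [h2] at h1
  nlinarith

/-! ### Compactness up to translation -/

/-- The pointwise limit of a bounded sequence of `H` belongs to `H`. -/
theorem exists_eq_of_tendsto {u : ℕ → HSpace p h hp h₁} {M : ℝ} (hu : ∀ n, ‖u n‖ ≤ M)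
    {a : (Fin N → ℤ) → ℝ} (ha : ∀ x, Tendsto (fun n => u n x) atTop (𝓝 (a x))) :
    ∃ v : HSpace p h hp h₁, ∀ x, v x = a x := by
  have hp0 : 0 < p := by linarith
  refine ⟨HSpace.ofSummable hp h₁ a (summable_of_sum_le (c := M ^ p)
    (fun x => mul_nonneg (potential_nonneg h₁ x) (by positivity)) fun s => ?_), fun x => rfl⟩
  -- Fatou's lemma on finite partial sums. Only the potential term has to be controlled, as it
  -- already implies membership in `H`.
  have hlim : Tendsto (fun n => ∑ x ∈ s, h x * |u n x| ^ p) atTop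
      (𝓝 (∑ x ∈ s, h x * |a x| ^ p)) :=
    tendsto_finsetSum _ fun x _ => ((ha x).abs.rpow_const (Or.inr hp0.le)).const_mul _
  refine le_of_tendsto' hlim fun n => ((u n).sum_pot_le s).trans ?_
  gcongr
  exact hu n

/-- A bounded sequence whose supremum norms stay away from zero has, after translation by periods,
a subsequence with a nonzero pointwise limit. -/
theorem exists_shift_tendsto {T : ℤ} (hT : T ≠ 0) (h₂ : ∀ x k : Fin N → ℤ, h (x + T • k) = h x)
    {u : ℕ → HSpace p h hp h₁} {M δ : ℝ} (hδ : 0 < δ) (hu : ∀ n, ‖u n‖ ≤ M)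
    (hsup : ∀ n, ∃ x, δ < |u n x|) :
    ∃ (φ : ℕ → ℕ) (k : ℕ → Fin N → ℤ) (v : HSpace p h hp h₁), StrictMono φ ∧ v ≠ 0 ∧
      ∀ x, Tendsto (fun n => (u (φ n)).shift (T • k n) (fun x => h₂ x _) x) atTop (𝓝 (v x)) := by
  choose x hx using hsup
  -- Division by `T` with remainder: translation by the period `T • k n` moves the point where `u n`
  -- is large into a fixed finite box.
  set k : ℕ → Fin N → ℤ := fun n j => x n j / T with hk
  set r : ℕ → Fin N → ℤ := fun n j => x n j % T with hr
  set w : ℕ → HSpace p h hp h₁ := fun n => (u n).shift (T • k n) (fun x => h₂ x _) with hw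
  have hwr : ∀ n, δ < |w n (r n)| := fun n => by
    have : r n + T • k n = x n := by
      funext j
      simp [hr, hk, Int.emod_add_mul_ediv]
    rw [hw, HSpace.shift_apply, this]
    exact hx n
  have hwM : ∀ n, ‖w n‖ ≤ M := fun n => by
    rw [hw, HSpace.norm_shift]
    exact hu n
  obtain ⟨K, hK, HK⟩ := exists_bounds hp h₁ M
  have hcomp : IsCompact (Set.univ.pi fun _ : Fin N → ℤ => Set.Icc (-K) K) :=
    isCompact_univ_pi fun _ => isCompact_Icc
  obtain ⟨a, -, φ, hφ, hlim⟩ := hcomp.tendsto_subseq (x := fun n => (w n : (Fin N → ℤ) → ℝ))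
    fun n y _ => abs_le.1 ((HK _ (hwM n)).1 y)
  have hlim' : ∀ y, Tendsto (fun n => w (φ n) y) atTop (𝓝 (a y)) := tendsto_pi_nhds.1 hlim
  obtain ⟨v, hv⟩ := exists_eq_of_tendsto (fun n => hwM (φ n)) hlim'
  refine ⟨φ, fun n => k (φ n), v, hφ, fun h0 => ?_, fun y => by rw [hv]; exact hlim' y⟩
  have hbox : (Set.Icc (0 : Fin N → ℤ) fun _ => |T|).Finite := Set.finite_Icc _ _
  have hrbox : ∀ n, r n ∈ Set.Icc (0 : Fin N → ℤ) fun _ => |T| := fun n =>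
    ⟨fun j => Int.emod_nonneg _ hT, fun j => (Int.emod_lt_abs _ hT).le⟩
  -- If the limit were zero, convergence would be uniform on the finite box, against the lower bound
  -- `δ` at the points `r n`.
  have ev : ∀ᶠ n in atTop, ∀ y ∈ Set.Icc (0 : Fin N → ℤ) fun _ => |T|, |w (φ n) y| < δ := by
    refine (eventually_all_finite hbox).2 fun y _ => ?_
    have h1 := (hlim' y).abs
    rw [← hv, h0, HSpace.zero_apply, abs_zero] at h1
    exact h1.eventually_lt_const hδ
  obtain ⟨n, hn⟩ := ev.exists
  exact absurd (hwr (φ n)) (not_lt.2 (hn _ (hrbox _)).le)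

/-- The infimum of the energy on the Nehari manifold is attained. -/
theorem exists_isMin_nehari [CompleteSpace V] (hα : 0 < α) (hαN : α < N)
    (he : ∀ x y, inner ℝ (e x) (e y) = green α x y) (hf : IsSmallPow (p - 1) f)
    {T : ℤ} (hT : T ≠ 0) (h₂ : ∀ x k : Fin N → ℤ, h (x + T • k) = h x) {θ : ℝ} (hθ : p < θ)
    (f₃ : ∀ t, 0 ≤ θ * primitive f t ∧ θ * primitive f t ≤ 2 * f t * t)
    {D : HSpace p h hp h₁ → HSpace p h hp h₁ →L[ℝ] ℝ} (hD : Continuous D)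
    (hJ : ∀ u, HasFDerivAt (energy α f) (D u) u) (hDu : ∀ u, D u u = ‖u‖ ^ p - coupling e f u)
    (hmono : ∀ u : HSpace p h hp h₁, u ≠ 0 → ∀ t : ℝ, 1 < t →
      t ^ (p + 1) * coupling e f u < coupling e f (t • u : HSpace p h hp h₁)) :
    ∃ u : HSpace p h hp h₁, u ≠ 0 ∧ D u u = 0 ∧
      ∀ v : HSpace p h hp h₁, v ≠ 0 → D v v = 0 → energy α f u ≤ energy α f v := by
  have hp1 : 1 < p := by linarith
  have hp0 : 0 < p := by linarith
  have hθ0 : 0 < θ := by linarith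
  have hF := hf.primitive hp1
  have hft := hf.mul_id hp1
  set J : HSpace p h hp h₁ → ℝ := energy α f with hJdef
  set A : HSpace p h hp h₁ → ℝ := fun u => coupling e f u with hAdef
  set P : HSpace p h hp h₁ → ℝ := fun u => ‖superpos e (primitive f) u‖ ^ 2 with hPdef
  -- `G` is the energy with `‖u‖ ^ p` replaced by `A u`: it equals `J` on the Nehari manifold but is
  -- bounded below by `κ * A` on all of `H`, so it can be evaluated at remainders off the manifold.
  set G : HSpace p h hp h₁ → ℝ := fun u => 1 / p * A u - 1 / 2 * P u with hGdef
  have hAP : ∀ u, θ / 2 * P u ≤ A u := le_coupling hα hαN he hf hθ0 f₃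
  have hP0 : ∀ u, 0 ≤ P u := fun u => by positivity
  have hA0 : ∀ u, 0 ≤ A u := fun u => (mul_nonneg (by positivity) (hP0 u)).trans (hAP u)
  set κ := 1 / p - 1 / θ with hκ
  have hκ0 : 0 < κ := by
    rw [hκ, sub_pos]
    exact one_div_lt_one_div_of_lt hp0 hθ
  have hGA : ∀ u, κ * A u ≤ G u := fun u => by
    have h1 : 1 / θ * (θ / 2 * P u) ≤ 1 / θ * A u := by
      have := hAP u
      gcongr
    have h2 : 1 / θ * (θ / 2 * P u) = 1 / 2 * P u := by field_simp
    simp only [hGdef, hκ]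
    linarith
  have hG0 : ∀ u, 0 ≤ G u := fun u => (mul_nonneg hκ0.le (hA0 u)).trans (hGA u)
  have hJG : ∀ u, (A u - ‖u‖ ^ p) / p + J u = G u := fun u => by
    simp only [hJdef, energy_eq he hf, hGdef, hPdef]
    field_simp
    ring
  have hJGM : ∀ u, D u u = 0 → J u = G u := fun u h0 => by
    have h1 := hJG u
    rw [hDu] at h0
    have h2 : A u - ‖u‖ ^ p = 0 := by simp only [hAdef]; linarith
    rwa [h2, zero_div, zero_add] at h1
  set S : Set ℝ := J '' {v | v ≠ 0 ∧ D v v = 0} with hS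
  have hSb : BddBelow S := by
    refine ⟨0, ?_⟩
    rintro _ ⟨v, ⟨-, hv⟩, rfl⟩
    rw [hJGM v hv]
    exact hG0 v
  have hSle : ∀ v : HSpace p h hp h₁, v ≠ 0 → D v v = 0 → sInf S ≤ J v := fun v h0 hv =>
    csInf_le hSb ⟨v, ⟨h0, hv⟩, rfl⟩
  -- The ray inequality at the parameter that projects `u` to the Nehari manifold, where `J` is at
  -- least the infimum.
  have hproj : ∀ u : HSpace p h hp h₁, u ≠ 0 →
      ∃ t : ℝ, 0 < t ∧ sInf S + (A u - ‖u‖ ^ p) / p * t ^ p ≤ G u := fun u hu => by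
    obtain ⟨t, ht, h0⟩ := exists_smul_mem_nehari hD hDu hA0 hmono hu
    have h1 := ray_le hp0 hJ hDu hA0 hmono hu ht
    have h2 := hSle _ (smul_ne_zero ht.ne' hu) h0
    refine ⟨t, ht, ?_⟩
    rw [← hJG u]
    linarith
  have hSne : S.Nonempty := by
    have h0 : HSpace.single hp h₁ 0 ≠ (0 : HSpace p h hp h₁) := fun h0 => by
      have h1 := HSpace.single_self (hp := hp) (h₁ := h₁) (0 : Fin N → ℤ)
      rw [h0, HSpace.zero_apply] at h1
      exact zero_ne_one h1
    obtain ⟨t, ht, h1⟩ := exists_smul_mem_nehari hD hDu hA0 hmono h0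
    exact ⟨_, _, ⟨smul_ne_zero ht.ne' h0, h1⟩, rfl⟩
  obtain ⟨s, -, hslim, hsmem⟩ := exists_seq_tendsto_sInf hSne hSb
  choose u hu hus using hsmem
  have huA : ∀ n, ‖u n‖ ^ p = A (u n) := fun n => by
    have := hDu (u n)
    rw [(hu n).2] at this
    simp only [hAdef]
    linarith
  obtain ⟨c, hc⟩ := hslim.bddAbove_range
  -- On the manifold `κ * ‖u n‖ ^ p = κ * A (u n) ≤ J (u n) ≤ c`.
  have hbdd : ∀ n, ‖u n‖ ≤ (c / κ) ^ (1 / p) := fun n => by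
    have h1 : s n ≤ c := hc ⟨n, rfl⟩
    rw [← hus, hJGM _ (hu n).2] at h1
    have h2 := (hGA (u n)).trans h1
    rw [← huA] at h2
    have h3 : ‖u n‖ ^ p ≤ c / κ := by
      rw [le_div_iff₀ hκ0]
      linarith
    rw [one_div]
    refine (Real.le_rpow_inv_iff_of_pos (norm_nonneg _) ?_ hp0).2 h3
    exact le_trans (by positivity) h3
  obtain ⟨δ, hδ, hsup⟩ := exists_lt_abs_apply he hf hp h₁ ((c / κ) ^ (1 / p))
  obtain ⟨φ, k, v, hφ, hv0, hlim⟩ := exists_shift_tendsto hT h₂ hδ hbdd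
    fun n => hsup _ (hu n).1 (huA n) (hbdd n)
  set w : ℕ → HSpace p h hp h₁ :=
    fun n => (u (φ n)).shift (T • k n) (fun x => h₂ x _) with hw
  have hwn : ∀ n, ‖w n‖ = ‖u (φ n)‖ := fun n => HSpace.norm_shift _ _ _
  have hwA : ∀ n, A (w n) = A (u (φ n)) := fun n =>
    inner_superpos_shift he hF hft _ (fun x => h₂ x _) _
  have hwP : ∀ n, P (w n) = P (u (φ n)) := fun n => by
    simp only [hPdef, ← real_inner_self_eq_norm_sq]
    exact inner_superpos_shift he hF hF _ (fun x => h₂ x _) _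
  have hwG : Tendsto (fun n => G (w n)) atTop (𝓝 (sInf S)) := by
    refine (hslim.comp hφ.tendsto_atTop).congr fun n => ?_
    simp only [Function.comp_apply]
    rw [← hus, hJGM _ (hu _).2]
    simp only [hGdef, hwA, hwP]
  have hwM : ∀ n, ‖w n‖ ≤ (c / κ) ^ (1 / p) := fun n => (hwn n).trans_le (hbdd _)
  have lN := tendsto_norm_rpow_sub hwM hlim
  have lA : Tendsto (fun n => A (w n) - A (w n - v)) atTop (𝓝 (A v)) :=
    tendsto_inner_superpos_sub hα hαN he hF hft hwM hlim
  have lP : Tendsto (fun n => P (w n) - P (w n - v)) atTop (𝓝 (P v)) := by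
    simpa only [hPdef, real_inner_self_eq_norm_sq] using
      tendsto_inner_superpos_sub hα hαN he hF hF hwM hlim
  have lG : Tendsto (fun n => G (w n - v)) atTop (𝓝 (sInf S - G v)) := by
    have h1 := hwG.sub ((lA.const_mul (1 / p)).sub (lP.const_mul (1 / 2)))
    refine h1.congr fun n => ?_
    simp only [hGdef]
    ring
  have lI : Tendsto (fun n => ‖w n - v‖ ^ p - A (w n - v)) atTop (𝓝 (A v - ‖v‖ ^ p)) := by
    refine (lA.sub lN).congr fun n => ?_
    have h1 : ‖w n‖ ^ p = A (w n) := by rw [hwn, hwA, huA]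
    rw [h1]
    ring
  have hAv : 0 < A v := coupling_pos hA0 hmono hv0
  have hGv : 0 < G v := lt_of_lt_of_le (by positivity) (hGA v)
  -- In the first case the remainders eventually satisfy `A > ‖·‖ ^ p`, so `hproj` gives them `G ≥
  -- sInf S`, while `G (w n - v)` tends to `sInf S - G v < sInf S`.
  rcases lt_or_ge (A v) (‖v‖ ^ p) with hcase | hcase
  · exfalso
    have h1 : ∀ᶠ n in atTop, sInf S ≤ G (w n - v) := by
      filter_upwards [lI.eventually_lt_const (sub_neg.2 hcase)] with n hn
      have hne : w n - v ≠ 0 := fun h0 => by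
        have hA00 : A 0 = 0 := by
          have := hDu 0
          rw [map_zero, norm_zero, Real.zero_rpow hp0.ne'] at this
          simp only [hAdef]
          linarith
        rw [h0, norm_zero, Real.zero_rpow hp0.ne', hA00, sub_self] at hn
        exact lt_irrefl _ hn
      obtain ⟨t, ht, h2⟩ := hproj _ hne
      have h3 : 0 ≤ (A (w n - v) - ‖w n - v‖ ^ p) / p * t ^ p := by
        have : 0 ≤ A (w n - v) - ‖w n - v‖ ^ p := by linarith
        positivity
      linarith
    have h2 := ge_of_tendsto lG h1
    linarith
  -- In the second case `G v ≤ sInf S` because `G` is nonnegative on the remainders; `hproj` for `v`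
  -- then leaves no room for `A v > ‖v‖ ^ p`.
  · obtain ⟨t, ht, h1⟩ := hproj v hv0
    have h2 : 0 ≤ sInf S - G v := ge_of_tendsto' lG fun n => hG0 _
    have h3 : (A v - ‖v‖ ^ p) / p * t ^ p ≤ 0 := by linarith
    have h4 : A v - ‖v‖ ^ p = 0 := by
      refine le_antisymm ?_ (sub_nonneg.2 hcase)
      by_contra! h5
      exact absurd h3 (not_le.2 (by positivity))
    have hvM : D v v = 0 := by
      rw [hDu]
      simp only [hAdef] at h4
      linarith
    refine ⟨v, hv0, hvM, fun z hz0 hz => ?_⟩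
    have h5 := hSle z hz0 hz
    have h6 := hJGM v hvM
    linarith

end Choquard

end

/-! ### The main theorem -/

theorem theorem1p1 (N : ℕ) (p α : ℝ) (hp : 2 ≤ p) (hα : 0 < α) (hαN : α < N)
    (h : (Fin N → ℤ) → ℝ) (h₁ : ∃ h₀ > 0, ∀ x, h₀ ≤ h x)
    (T : ℤ) (hT : T ≠ 0) (h₂ : ∀ x k : Fin N → ℤ, h (x + T • k) = h x)
    (f : ℝ → ℝ) (f₁ : Continuous f)
    (f₁' : f =o[𝓝[≠] 0] fun t => |t| ^ (p - 1))
    (f₂ : ∃ C > 0, ∃ τ > (N + α) * p / (2 * N), ∀ t, |f t| ≤ C * (1 + |t| ^ (τ - 1)))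
    (f₃ : ∃ θ > p, ∀ t, 0 ≤ θ * Choquard.primitive f t ∧
      θ * Choquard.primitive f t ≤ 2 * f t * t)
    (f₄ : ∀ u : Choquard.HSpace p h hp h₁, u ≠ 0 →
      StrictMonoOn (fun t : ℝ =>
        (∑' x, Choquard.greenConv α (fun y => Choquard.primitive f (t * u y)) x *
          f (t * u x) * u x) / t ^ p) (Set.Ioi 0)) :
    ContDiff ℝ 1 (Choquard.energy α f : Choquard.HSpace p h hp h₁ → ℝ) ∧
    ∃ u : Choquard.HSpace p h hp h₁, Choquard.IsGroundState α f u ∧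
      ∀ x, -Choquard.pLaplacian p u x + h x * |u x| ^ (p - 2) * u x =
        Choquard.greenConv α (fun y => Choquard.primitive f (u y)) x * f (u x) := by
  obtain ⟨θ, hθ, f₃⟩ := f₃
  have hp0 : 0 < p := by linarith
  have hf := Choquard.isSmallPow_of_isLittleO (by linarith) f₁ f₁'
  obtain ⟨e, he⟩ := Choquard.exists_inner_eq_green hα hαN
  obtain ⟨D, hD, hJ, hDu, hEL⟩ := Choquard.exists_hasFDerivAt_energy he hf hp h₁
  -- `(f₄)` compares the parameters `1` and `t`; one extra factor `t` comes from `u` in `f(u) u`,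
  -- whence the exponent `p + 1`.
  have hmono : ∀ u : Choquard.HSpace p h hp h₁, u ≠ 0 → ∀ t : ℝ, 1 < t →
      t ^ (p + 1) * Choquard.coupling e f u <
        Choquard.coupling e f (t • u : Choquard.HSpace p h hp h₁) := by
    intro u hu t ht
    have ht0 : 0 < t := by linarith
    have h1 := f₄ u hu (Set.mem_Ioi.2 one_pos) (Set.mem_Ioi.2 ht0) ht
    have h2 := Choquard.coupling_smul he hf u 1
    have h3 := Choquard.coupling_smul he hf u t
    rw [one_smul, one_mul] at h2
    simp only [Real.one_rpow, div_one] at h1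
    rw [← h2, lt_div_iff₀ (by positivity)] at h1
    rw [h3, Real.rpow_add_one ht0.ne']
    nlinarith
  have hA : ∀ u : Choquard.HSpace p h hp h₁, 0 ≤ Choquard.coupling e f u := fun u =>
    (mul_nonneg (by linarith) (sq_nonneg _)).trans
      (Choquard.le_coupling hα hαN he hf (by linarith) f₃ u)
  obtain ⟨u, hu, huM, hmin⟩ :=
    Choquard.exists_isMin_nehari hα hαN he hf hT h₂ hθ f₃ hD hJ hDu hmono
  have hcrit : D u = 0 := Choquard.critical_of_isMin hp0 hD hJ hDu hA hmono hu huM hmin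
  refine ⟨contDiff_one_iff_hasFDerivAt.2 ⟨D, hD, hJ⟩, u, ⟨hu, hcrit ▸ hJ u, ⟨u, ⟨hu, ?_⟩, rfl⟩, ?_⟩,
    fun x => ?_⟩
  · rw [(hJ u).fderiv, huM]
  · rintro _ ⟨v, ⟨hv, hv'⟩, rfl⟩
    rw [(hJ v).fderiv] at hv'
    exact hmin v hv hv'
  · have h1 := hEL u x
    rw [hcrit, zero_apply] at h1
    linarith
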